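/- **Setting.** Let $T,R_0>0$. Let $(u,b)$ be a weak (distributional) solution on $\mathbb R^3\times(0,T)$ of the 3D MHD system $$u_t-\Delta u+(u\cdot\nabla)u-(b\cdot\nabla)b+\nabla P=0,\quad b_t-\Delta b+(u\cdot\nabla)b-(b\cdot\nabla)u=0,\quad \nabla\cdot u=\nabla\cdot b=0,$$ in the class $L^\infty(0,T;H)\cap L^2(0,T;H^1)$ with initial data $u_0,b_0\in H$, where $H$ is the $L^2$-closure of the smooth compactly supported divergence-free fields. Assume that $u,b$ are smooth on $B(0,2R_0+R_0^{2/3})\times(0,T]$, and put $\omega=\nabla\times u$, $j=\nabla\times b$. **Cut-offs.** Fix $C_0>0$ and $3/4<\delta,\rho<1$. Let $\eta\in C^\infty(0,T)$ with $0\le\eta\le1$, $\eta=0$ on $(0,T/3)$, $\eta=1$ on $(2T/3,T)$, $|\eta'|\le \frac{C_0}{T}\eta^\delta$. A *refined* function at scale $R$ is a $\psi\in C_0^\infty(\mathbb R^3)$ with $0\le\psi\le1$, $|\partial_i\psi|\le \frac{C_0}{R}\psi^\rho$, $|\partial_i\partial_j\psi|\le\frac{C_0}{R^2}\psi^{2\rho-1}$.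 Let $\psi_0$ be radial, refined at scale $R_0$, equal to $1$ on $B(0,R_0)$ and supported in $B(0,2R_0)$; $\phi_0=\eta\psi_0$. The cut-off of a ball $B(x_i,R)$ is $\phi_i=\eta\psi_i$ with $\psi_i$ refined at scale $R$, $\psi_i\le\psi_0$, and: if $\overline{B(x_i,R)}\subset B(0,R_0)$, then $\psi_i=1$ on $B(x_i,R)$ and $\psi_i$ is supported in $B(x_i,2R)$; otherwise $\psi_i=1$ on $B(x_i,R)\cap B(0,R_0)$, $\psi_i=0$ on $B(0,R_0)\setminus B(x_i,2R)$, and for $R_0\le|x|\le2R_0$, $\psi_i(x)=\psi_0(x)$ if $R_0x/|x|\in \overline{B(x_i,R)}$ and $\psi_i(x)=0$ if $R_0x/|x|\notin B(x_i,2R)$. A *$(K_1,K_2)$-cover at scale* $0<R\le R_0$ ($K_1,K_2$ positive integers) is a cover of $B(0,R_0)$ by $n$ balls $B(x_i,R)$ with $(R_0/R)^3\le n\le K_1(R_0/R)^3$ such that every $x\in B(0,R_0)$ lies in at most $K_2$ of the balls $B(x_i,2R)$. **Integral-scale quantities.** Set $$e_0=\frac1T\int_0^T\frac1{R_0^3}\int\phi_0^{4\rho-3}\Big(\frac{|u|^2}2+\frac{|b|^2}2\Big)dx\,ds,\qquad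 E_0=\frac1T\int_0^T\frac1{R_0^3}\int\phi_0^{2\rho-1}(|\omega|^2+|j|^2)\,dx\,ds,$$ $$P_0=\frac1T\int_0^T\frac1{R_0^3}\int\phi_0(|\nabla\omega|^2+|\nabla j|^2)\,dx\,ds+\frac1{TR_0^3}\int\frac12\big(|\omega(x,T)|^2+|j(x,T)|^2\big)\psi_0(x)\,dx,$$ assume $P_0>0$, and let $\sigma_0=\max\{(E_0/P_0)^{1/2},(e_0/P_0)^{1/4}\}$. **Assumptions.** For given $M,\alpha>0$, $0<\beta<1$: (A1) for $t\in(0,T)$ and $x\in B(0,2R_0)$ with $|\nabla u(x,t)|>M$: $|\omega(x+y,t)-\omega(x,t)|\le|\omega(x+y,t)||y|^{1/2}$ for (almost) all $|y|<2R_0+R_0^{2/3}$ with $\omega(x+y,t)\ne0$; (A2) $\sigma_0<\beta R_0$; (A3) $\big(\int_0^T\|\omega\|^2_{L^2(B(0,2R_0+R_0^{2/3}))}ds\big)^{1/2}\le1/\alpha$, and $\int|\omega(x,T)|^2\psi_0\,dx\ge\frac12\sup_{0<s<T}\int|\omega(x,s)|^2\psi_0\,dx$, and likewise for $j$. **Fluxes.**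 For a $(K_1,K_2)$-cover at scale $R$ with cut-offs as above let $$\Psi_{x_i,R}=\frac1T\int_0^T\int\frac12\big(|\omega|^2+|j|^2\big)(u\cdot\nabla\phi_i)\,dx\,ds,\qquad \langle\Psi\rangle_R=\frac1n\sum_{i=1}^n\Psi_{x_i,R}.$$ **Theorem.** Given $C_0,\rho,\delta,K_1,K_2$ there is a constant $K_P>0$ such that, for every $K_*\ge\max\{(K_1K_2)^{1/2},3K_2/4,K_1\}$, with $\alpha=4K_PK_*^2$, and for all $M>0$, $\Omega$ and $\kappa>0$, there is $\beta\in(0,1)$ with the following property. If $R_0\le\kappa$, $R_0^2\le\kappa T$, and $(u,b)$ is a solution as above with $\int_0^T\|\omega\|_{L^2(\mathbb R^3)}^2dt\le\Omega$ satisfying (A1)–(A3), then for any two scales $r,R\in[\sigma_0/\beta,R_0]$ and any $(K_1,K_2)$-covers at scales $r$ and $R$ with any admissible cut-offs, $$\frac1{16K_*^2}\Big(\frac rR\Big)^3\le\frac{\langle\Psi\rangle_r}{\langle\Psi\rangle_R}\le16K_*^2\Big(\frac rR\Big)^3.$$ -/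

import Mathlib

open MeasureTheory Set Metric
open scoped ContDiff

noncomputable section

namespace MHD

/-- Euclidean three-space. -/
abbrev E3 := EuclideanSpace ℝ (Fin 3)

/-- The `j`-th standard basis vector. -/
def e (j : Fin 3) : E3 := EuclideanSpace.single j 1

/-- The trace of a gradient: `∇ · f` when `L` is the derivative of `f`. -/
def divL (L : E3 →L[ℝ] E3) : ℝ := ∑ j, (L (e j)) j

/-- The curl read off from a gradient: `(L (e j)) i` is the partial derivative `∂_j f_i`. -/
def curlL (L : E3 →L[ℝ] E3) : E3 :=
  !₂[(L (e 1)) 2 - (L (e 2)) 1, (L (e 2)) 0 - (L (e 0)) 2, (L (e 0)) 1 - (L (e 1)) 0]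

/-- The squared Frobenius norm `∑_{i,j} (∂_j f_i)^2` of a gradient. -/
def gradSq (L : E3 →L[ℝ] E3) : ℝ := ∑ j, ‖L (e j)‖ ^ 2

/-! ### Weak solutions -/

/-- Membership in `H`, the `L²`-closure of the smooth compactly supported divergence-free
vector fields. -/
def InH (f : E3 → E3) : Prop :=
  MemLp f 2 volume ∧ ∀ ε : ENNReal, 0 < ε → ∃ v : E3 → E3,
    ContDiff ℝ ∞ v ∧ HasCompactSupport v ∧ (∀ x, divL (fderiv ℝ v x) = 0) ∧
      eLpNorm (f - v) 2 volume < ε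

/-- `G` is the weak gradient of `f`. -/
def HasWeakGradient (f : E3 → E3) (G : E3 → E3 →L[ℝ] E3) : Prop :=
  ∀ χ : E3 → ℝ, ContDiff ℝ ∞ χ → HasCompactSupport χ → ∀ v : E3,
    ∫ x, (fderiv ℝ χ x v) • f x = - ∫ x, χ x • G x v

/-- Lebesgue measure on the space-time slab `(0,T) × ℝ³`. -/
def slab (T : ℝ) : Measure (ℝ × E3) := (volume.restrict (Ioo 0 T)).prod volume

/-- `f` belongs to `L^∞(0,T;H) ∩ L²(0,T;H¹)`, with weak spatial gradient `Df`. -/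
structure EnergyClass (T : ℝ) (f : ℝ → E3 → E3) (Df : ℝ → E3 → E3 →L[ℝ] E3) : Prop where
  meas : AEStronglyMeasurable (fun z : ℝ × E3 => f z.1 z.2) (slab T)
  inH : ∀ᵐ t ∂(volume.restrict (Ioo 0 T)), InH (f t)
  bounded : ∃ C : ℝ, ∀ᵐ t ∂(volume.restrict (Ioo 0 T)), ∫ x, ‖f t x‖ ^ 2 ≤ C
  grad : ∀ᵐ t ∂(volume.restrict (Ioo 0 T)), HasWeakGradient (f t) (Df t)
  gradL2 : MemLp (fun z : ℝ × E3 => Df z.1 z.2) 2 (slab T)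

/-- Vector test functions, smooth with compact support in `[0,T) × ℝ³`. -/
def IsTest (T : ℝ) (φ : ℝ × E3 → E3) : Prop :=
  ContDiff ℝ ∞ φ ∧ HasCompactSupport φ ∧ tsupport φ ⊆ Iio T ×ˢ univ

/-- The heat part `⟨f, ∂_t φ + Δ φ⟩` of the integrands below. -/
def heatPair (f : ℝ → E3 → E3) (φ : ℝ × E3 → E3) (t : ℝ) (x : E3) : ℝ :=
  inner ℝ (f t x) (deriv (fun s => φ (s, x)) t + Laplacian.laplacian (fun y => φ (t, y)) x)

/-- The pairing `(v ⊗ w) : ∇φ = ∑ v_j w_i ∂_j φ_i`, i.e. minus `(v · ∇) w` tested against `φ`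
when `v` is divergence free. -/
def transportPair (v w : ℝ → E3 → E3) (φ : ℝ × E3 → E3) (t : ℝ) (x : E3) : ℝ :=
  inner ℝ (fderiv ℝ (fun y => φ (t, y)) x (v t x)) (w t x)

/-- `(u,b)` is a weak (distributional) solution of 3D MHD on `ℝ³ × (0,T)` with unit viscosity and
resistivity, in the energy class, with initial data `u₀, b₀ ∈ H`; `Du`, `Db` are the weak spatial
gradients. The pressure is eliminated by testing the momentum equation with divergence-free
fields. -/
structure IsWeakSolution (T : ℝ) (u b : ℝ → E3 → E3) (u₀ b₀ : E3 → E3)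
    (Du Db : ℝ → E3 → E3 →L[ℝ] E3) : Prop where
  u_class : EnergyClass T u Du
  b_class : EnergyClass T b Db
  u_init : InH u₀
  b_init : InH b₀
  momentum : ∀ φ : ℝ × E3 → E3, IsTest T φ →
    (∀ t x, divL (fderiv ℝ (fun y => φ (t, y)) x) = 0) →
    (∫ t in Ioo 0 T, ∫ x, (heatPair u φ t x + transportPair u u φ t x - transportPair b b φ t x))
      + ∫ x, inner ℝ (u₀ x) (φ (0, x)) = 0
  induction : ∀ φ : ℝ × E3 → E3, IsTest T φ →
    (∫ t in Ioo 0 T, ∫ x, (heatPair b φ t x + transportPair u b φ t x - transportPair b u φ t x))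
      + ∫ x, inner ℝ (b₀ x) (φ (0, x)) = 0

/-- `f` is smooth on `B(0,ϱ) × (0,T]`, and there `Df` is its classical spatial derivative. -/
def SmoothIn (T ϱ : ℝ) (f : ℝ → E3 → E3) (Df : ℝ → E3 → E3 →L[ℝ] E3) : Prop :=
  ContDiffOn ℝ ∞ (fun z : ℝ × E3 => f z.1 z.2) (Ioc 0 T ×ˢ ball 0 ϱ) ∧
    ∀ t ∈ Ioc 0 T, ∀ x ∈ ball (0 : E3) ϱ, Df t x = fderiv ℝ (f t) x

/-- The curl of a time-dependent field with spatial gradient `Df`: the vorticity for `Df = Du`, the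
current for `Df = Db`. -/
def curl (Df : ℝ → E3 → E3 →L[ℝ] E3) (t : ℝ) (x : E3) : E3 := curlL (Df t x)

/-- `∫₀ᵀ ‖curl‖²_{L²(S)} dt`. -/
def curlSq (T : ℝ) (S : Set E3) (Df : ℝ → E3 → E3 →L[ℝ] E3) : ℝ :=
  ∫ t in Ioo 0 T, ∫ x in S, ‖curl Df t x‖ ^ 2

/-! ### Cut-off functions and covers -/

/-- The temporal cut-off. -/
structure IsTimeCutoff (C₀ δ T : ℝ) (η : ℝ → ℝ) : Prop where
  smooth : ContDiffOn ℝ ∞ η (Ioo 0 T)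
  nonneg : ∀ t ∈ Ioo 0 T, 0 ≤ η t
  le_one : ∀ t ∈ Ioo 0 T, η t ≤ 1
  eq_zero : ∀ t ∈ Ioo 0 (T / 3), η t = 0
  eq_one : ∀ t ∈ Ioo (2 * T / 3) T, η t = 1
  deriv_le : ∀ t ∈ Ioo 0 T, |deriv η t| ≤ C₀ / T * η t ^ δ

/-- Smoothness, range and derivative bounds shared by all spatial cut-offs at scale `R`. -/
structure IsRefined (C₀ ρ R : ℝ) (ψ : E3 → ℝ) : Prop where
  smooth : ContDiff ℝ ∞ ψ
  compact : HasCompactSupport ψ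
  nonneg : ∀ x, 0 ≤ ψ x
  le_one : ∀ x, ψ x ≤ 1
  grad_le : ∀ x i, |fderiv ℝ ψ x (e i)| ≤ C₀ / R * ψ x ^ ρ
  hess_le : ∀ x i j, |fderiv ℝ (fun y => fderiv ℝ ψ y (e j)) x (e i)|
    ≤ C₀ / R ^ 2 * ψ x ^ (2 * ρ - 1)

/-- The radial spatial cut-off of the integral domain `B(0,R₀)`. -/
structure IsIntegralCutoff (C₀ ρ R₀ : ℝ) (ψ₀ : E3 → ℝ) : Prop where
  refined : IsRefined C₀ ρ R₀ ψ₀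
  eq_one : ∀ x ∈ ball (0 : E3) R₀, ψ₀ x = 1
  supp : Function.support ψ₀ ⊆ ball 0 (2 * R₀)
  radial : ∀ x y : E3, ‖x‖ = ‖y‖ → ψ₀ x = ψ₀ y

/-- The spatial cut-off of the cover element `B(c,R)`, relative to the cut-off `ψ₀` of the integral
domain. For `x` in the shell `R₀ ≤ |x| ≤ 2 R₀`, the condition `(R₀/|x|) x ∈ B(c,s)` says that `x`
lies in the cone with apex `0` through the intersection of `B(c,s)` with the sphere of radius
`R₀`. -/
structure IsLocalCutoff (C₀ ρ R₀ : ℝ) (ψ₀ : E3 → ℝ) (R : ℝ) (c : E3) (ψ : E3 → ℝ) : Prop where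
  refined : IsRefined C₀ ρ R ψ
  le_integral : ∀ x, ψ x ≤ ψ₀ x
  interior_one : closedBall c R ⊆ ball 0 R₀ → ∀ x ∈ ball c R, ψ x = 1
  interior_supp : closedBall c R ⊆ ball 0 R₀ → Function.support ψ ⊆ ball c (2 * R)
  boundary_one : ¬ closedBall c R ⊆ ball 0 R₀ → ∀ x ∈ ball c R ∩ ball 0 R₀, ψ x = 1
  boundary_cone : ¬ closedBall c R ⊆ ball 0 R₀ → ∀ x : E3, R₀ ≤ ‖x‖ → ‖x‖ ≤ 2 * R₀ →
    (R₀ / ‖x‖) • x ∈ closedBall c R → ψ x = ψ₀ x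
  boundary_inner_zero : ¬ closedBall c R ⊆ ball 0 R₀ →
    ∀ x ∈ ball (0 : E3) R₀ \ ball c (2 * R), ψ x = 0
  boundary_outer_zero : ¬ closedBall c R ⊆ ball 0 R₀ → ∀ x : E3, R₀ ≤ ‖x‖ → ‖x‖ ≤ 2 * R₀ →
    (R₀ / ‖x‖) • x ∉ ball c (2 * R) → ψ x = 0

/-- A `(K₁,K₂)`-cover of `B(0,R₀)` at scale `R`: the balls `B(c i,R)` cover, their number is
controlled by `K₁`, and at most `K₂` of the balls `B(c i,2R)`, on which the cut-offs live, meet at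
any point of `B(0,R₀)`. -/
structure IsCover (K₁ K₂ : ℕ) (R₀ R : ℝ) {n : ℕ} (c : Fin n → E3) : Prop where
  pos : 0 < R
  le : R ≤ R₀
  covers : ball (0 : E3) R₀ ⊆ ⋃ i, ball (c i) R
  card_ge : (R₀ / R) ^ 3 ≤ (n : ℝ)
  card_le : (n : ℝ) ≤ K₁ * (R₀ / R) ^ 3
  mult : ∀ x ∈ ball (0 : E3) R₀, {i | x ∈ ball (c i) (2 * R)}.ncard ≤ K₂

/-! ### Integral-scale quantities -/

/-- The time-averaged total energy `e₀`. -/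
def energy₀ (ρ T R₀ : ℝ) (η : ℝ → ℝ) (ψ₀ : E3 → ℝ) (u b : ℝ → E3 → E3) : ℝ :=
  1 / T * ∫ t in Ioo 0 T, 1 / R₀ ^ 3 * ∫ x,
    (η t * ψ₀ x) ^ (4 * ρ - 3) * (‖u t x‖ ^ 2 / 2 + ‖b t x‖ ^ 2 / 2)

/-- The time-averaged total enstrophy `E₀`. -/
def enstrophy₀ (ρ T R₀ : ℝ) (η : ℝ → ℝ) (ψ₀ : E3 → ℝ) (Du Db : ℝ → E3 → E3 →L[ℝ] E3) : ℝ :=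
  1 / T * ∫ t in Ioo 0 T, 1 / R₀ ^ 3 * ∫ x,
    (η t * ψ₀ x) ^ (2 * ρ - 1) * (‖curl Du t x‖ ^ 2 + ‖curl Db t x‖ ^ 2)

/-- The modified total palenstrophy `P₀`. -/
def palenstrophy₀ (T R₀ : ℝ) (η : ℝ → ℝ) (ψ₀ : E3 → ℝ) (Du Db : ℝ → E3 → E3 →L[ℝ] E3) : ℝ :=
  (1 / T * ∫ t in Ioo 0 T, 1 / R₀ ^ 3 * ∫ x, (η t * ψ₀ x) *
      (gradSq (fderiv ℝ (curl Du t) x) + gradSq (fderiv ℝ (curl Db t) x)))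
    + 1 / (T * R₀ ^ 3) * ∫ x, 1 / 2 * (‖curl Du T x‖ ^ 2 + ‖curl Db T x‖ ^ 2) * ψ₀ x

/-- The modified Kraichnan-type scale `σ₀ = max {(E₀/P₀)^{1/2}, (e₀/P₀)^{1/4}}`. -/
def kraichnan (ρ T R₀ : ℝ) (η : ℝ → ℝ) (ψ₀ : E3 → ℝ) (u b : ℝ → E3 → E3)
    (Du Db : ℝ → E3 → E3 →L[ℝ] E3) : ℝ :=
  max ((enstrophy₀ ρ T R₀ η ψ₀ Du Db / palenstrophy₀ T R₀ η ψ₀ Du Db) ^ (1 / 2 : ℝ))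
    ((energy₀ ρ T R₀ η ψ₀ u b / palenstrophy₀ T R₀ η ψ₀ Du Db) ^ (1 / 4 : ℝ))

/-! ### Assumptions -/

/-- The hybrid geometric/smoothness assumption with threshold `M`. -/
def HybridAssumption (T R₀ M : ℝ) (Du : ℝ → E3 → E3 →L[ℝ] E3) : Prop :=
  ∀ t ∈ Ioo 0 T, ∀ x ∈ ball (0 : E3) (2 * R₀), M < √(gradSq (Du t x)) →
    ∀ᵐ y : E3, ‖y‖ < 2 * R₀ + R₀ ^ (2 / 3 : ℝ) → curl Du t (x + y) ≠ 0 →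
      ‖curl Du t (x + y) - curl Du t x‖ ≤ ‖curl Du t (x + y)‖ * ‖y‖ ^ (1 / 2 : ℝ)

/-- The localization assumption with constant `α`. -/
def LocalizationAssumption (T R₀ α : ℝ) (Du : ℝ → E3 → E3 →L[ℝ] E3) : Prop :=
  √(curlSq T (ball 0 (2 * R₀ + R₀ ^ (2 / 3 : ℝ))) Du) ≤ 1 / α

/-- The modulation assumption for one of the two curls: the final localized enstrophy is at least
half of its supremum over `(0,T)`. -/
def ModulationAssumption (T : ℝ) (ψ₀ : E3 → ℝ) (Df : ℝ → E3 → E3 →L[ℝ] E3) : Prop :=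
  ∀ s ∈ Ioo 0 T,
    1 / 2 * ∫ x, ‖curl Df s x‖ ^ 2 * ψ₀ x ≤ ∫ x, ‖curl Df T x‖ ^ 2 * ψ₀ x

/-! ### Fluxes -/

/-- The time-averaged local flux of the enstrophy `½|curl|²` carried by `u` through the cut-off
`φ = η ψ`. -/
def localFlux (T : ℝ) (η : ℝ → ℝ) (ψ : E3 → ℝ) (u : ℝ → E3 → E3)
    (Df : ℝ → E3 → E3 →L[ℝ] E3) : ℝ :=
  1 / T * ∫ t in Ioo 0 T, ∫ x,
    1 / 2 * ‖curl Df t x‖ ^ 2 * fderiv ℝ (fun y => η t * ψ y) x (u t x)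

/-- The time-averaged combined (kinetic plus magnetic) local enstrophy flux. -/
def combinedFlux (T : ℝ) (η : ℝ → ℝ) (ψ : E3 → ℝ) (u : ℝ → E3 → E3)
    (Du Db : ℝ → E3 → E3 →L[ℝ] E3) : ℝ :=
  localFlux T η ψ u Du + localFlux T η ψ u Db

/-- The ensemble average of the combined flux over the cut-offs `ψ i` of a cover. -/
def ensembleFlux (T : ℝ) (η : ℝ → ℝ) {n : ℕ} (ψ : Fin n → E3 → ℝ) (u : ℝ → E3 → E3)
    (Du Db : ℝ → E3 → E3 →L[ℝ] E3) : ℝ :=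
  1 / (n : ℝ) * ∑ i, combinedFlux T η (ψ i) u Du Db

end MHD

end

/-!
The fluxes are compared with the total dissipation. Let `Φ = ∑ ψ_i` be the sum of the cut-offs of a
cover at scale `R`. The multiplicity bound and the radial geometry of the boundary cut-offs give
`ψ₀ ≤ Φ ≤ K₂ ψ₀`, with derivatives bounded by `K₂ C₀ R⁻¹ ψ₀^ρ` and `K₂ C₀ R⁻² ψ₀^{2ρ-1}`
(`IsCover.isSumCutoff`). Testing the equations for `ω = ∇ × u` and `j = ∇ × b` with `η Φ ω` and
`η Φ j` yields an exact balance (`SmoothMHD.dissip_sub_flux`)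

  `∬ η Φ (|∇ω|² + |∇j|²) + ∫ Φ ½(|ω|² + |j|²)(T) = ∬ η ½(|ω|² + |j|²) u·∇Φ + error`.

The left side lies between `L = T R₀³ P₀` and `K₂ L`. If every error term is at most of order `β L`,
then a small `β` puts the summed flux between `L/2` and `(K₂ + 1/2) L` at every admissible scale, and
dividing by the cardinalities of two covers gives the theorem, since `3 K₁ K₂ ≤ 16 K_*²`.

The error terms come from `η'`, `ΔΦ`, `b·∇Φ` and vortex stretching
(`SmoothMHD.abs_dissip_sub_flux_le`). The definition of `σ₀` bounds the time-averaged localized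
enstrophy by `σ₀² L` and the energy by `σ₀⁴ L`, with `σ₀ ≤ β R`; the modulation assumption bounds the
localized enstrophy at each time by `2 L`. Each stretching term, and the `b·∇Φ` term, contains a
velocity gradient; for the Lorentz contribution `ω·((j·∇)b)` this gradient is `ω` itself. Therefore
it suffices to bound `|∇u|` on `B(0, 2R₀)` in `L²` in time with values in `L^∞`
(`exists_velocity_gradient_bound`). Where `|∇u| > M`, the relative Hölder bound first gives a Harnack
inequality for `|ω|` on a ball of radius `r`, so that `|ω(x)| ≲ r^{-3/2} ‖ω‖_{L²}`, and then the
Biot-Savart law, in the form of an integral over the scales of a compactly supported kernel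
(`exists_gradient_bound`), gives `|∇u(x)| ≲ r^{-3/2} ‖ω‖_{L²(ℝ³)}`. The remaining gradient factor in
a stretching term is bounded in `L²` by the curls, as the fields are solenoidal
(`SmoothMHD.integral_grd_le`).

The pointwise equations for the curls are obtained from the weak formulation inside the cylinder of
smoothness by testing with curl-type separable fields, which also eliminates the pressure
(`IsWeakSolution.smoothMHD`, `SmoothMHD.vorticity`, `SmoothMHD.current`). Spatial derivatives are
written in components throughout: `pdx l` for a function of space, `pd l` for one of time and space.
-/

noncomputable section

namespace MHD

/-! ### Partial derivatives in space -/

/-- A continuous function on an open set that is orthogonal to all test functions supported there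
vanishes. -/
theorem eqOn_zero_of_integral_cutoff_mul {E : Type*} [NormedAddCommGroup E] [NormedSpace ℝ E]
    [FiniteDimensional ℝ E] [MeasureSpace E] [BorelSpace E] [(volume : Measure E).IsAddHaarMeasure]
    {U : Set E} {f : E → ℝ} (hU : IsOpen U) (hf : ContinuousOn f U)
    (h : ∀ χ : E → ℝ, ContDiff ℝ ∞ χ → HasCompactSupport χ → tsupport χ ⊆ U →
      ∫ x, χ x * f x = 0) : ∀ x ∈ U, f x = 0 := by
  have h1 := hU.ae_eq_zero_of_integral_contDiff_smul_eq_zero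
    (hf.locallyIntegrableOn hU.measurableSet (μ := (volume : Measure E)))
    (fun χ a b c => by simpa using h χ a b c)
  have h2 : f =ᵐ[volume.restrict U] fun _ => 0 := by
    rwa [Filter.EventuallyEq, ae_restrict_iff' hU.measurableSet]
  exact fun x hx => Measure.eqOn_open_of_ae_eq h2 hU hf continuousOn_const hx

/-- The `l`-th spatial partial derivative of a scalar function. -/
def pdx (l : Fin 3) (f : E3 → ℝ) (x : E3) : ℝ := fderiv ℝ f x (e l)

section Space

variable {U : Set E3} {f g ψ : E3 → ℝ} {x : E3}

theorem _root_.ContDiffOn.pdx (hU : IsOpen U) (hf : ContDiffOn ℝ ∞ f U) (l : Fin 3) :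
    ContDiffOn ℝ ∞ (pdx l f) U :=
  (hf.fderiv_of_isOpen hU (by simp)).clm_apply contDiffOn_const

theorem _root_.ContDiff.pdx (hf : ContDiff ℝ ∞ f) (l : Fin 3) : ContDiff ℝ ∞ (pdx l f) :=
  (hf.fderiv_right (by simp)).clm_apply contDiff_const

theorem differentiableAt_of_smoothOn (hU : IsOpen U) (hf : ContDiffOn ℝ ∞ f U) (hx : x ∈ U) :
    DifferentiableAt ℝ f x :=
  (hf.contDiffAt (hU.mem_nhds hx)).differentiableAt (by simp)

theorem pdx_add (l : Fin 3) (hf : DifferentiableAt ℝ f x) (hg : DifferentiableAt ℝ g x) :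
    pdx l (fun y => f y + g y) x = pdx l f x + pdx l g x := by
  simp [pdx, fderiv_fun_add hf hg]

theorem pdx_sub (l : Fin 3) (hf : DifferentiableAt ℝ f x) (hg : DifferentiableAt ℝ g x) :
    pdx l (fun y => f y - g y) x = pdx l f x - pdx l g x := by
  simp [pdx, fderiv_fun_sub hf hg]

theorem pdx_mul (l : Fin 3) (hf : DifferentiableAt ℝ f x) (hg : DifferentiableAt ℝ g x) :
    pdx l (fun y => f y * g y) x = f x * pdx l g x + g x * pdx l f x := by
  simp [pdx, fderiv_fun_mul hf hg]

theorem pdx_const_mul (l : Fin 3) (c : ℝ) (hf : DifferentiableAt ℝ f x) :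
    pdx l (fun y => c * f y) x = c * pdx l f x := by
  simp [pdx, fderiv_const_mul hf]

theorem pdx_sum {ι : Type*} (s : Finset ι) (l : Fin 3) {F : ι → E3 → ℝ}
    (hF : ∀ i ∈ s, DifferentiableAt ℝ (F i) x) :
    pdx l (fun y => ∑ i ∈ s, F i y) x = ∑ i ∈ s, pdx l (F i) x := by
  simp [pdx, fderiv_fun_sum hF]

theorem pdx_congr (l : Fin 3) (hU : IsOpen U) (h : EqOn f g U) (hx : x ∈ U) :
    pdx l f x = pdx l g x := by
  rw [pdx, pdx, (h.eventuallyEq_of_mem (hU.mem_nhds hx)).fderiv_eq]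

theorem pdx_comm (hU : IsOpen U) (hf : ContDiffOn ℝ ∞ f U) (hx : x ∈ U) (k l : Fin 3) :
    pdx k (pdx l f) x = pdx l (pdx k f) x := by
  have h := hf.contDiffAt (hU.mem_nhds hx)
  have hs := h.isSymmSndFDerivAt (by rw [minSmoothness_of_isRCLikeNormedField]; norm_cast)
  have hd : DifferentiableAt ℝ (fderiv ℝ f) x :=
    (h.fderiv_right (m := 1) (by norm_cast)).differentiableAt (by simp)
  have key : ∀ a b : Fin 3, pdx a (pdx b f) x = fderiv ℝ (fderiv ℝ f) x (e a) (e b) := by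
    intro a b
    change fderiv ℝ (fun y => fderiv ℝ f y (e b)) x (e a) = _
    rw [fderiv_clm_apply hd (by fun_prop)]
    simp
  rw [key, key, hs.eq]

theorem tsupport_pdx_subset (l : Fin 3) : tsupport (pdx l f) ⊆ tsupport f :=
  tsupport_fderiv_apply_subset ℝ (e l)

theorem pdx_eq_zero_of_notMem_tsupport (l : Fin 3) (hx : x ∉ tsupport f) : pdx l f x = 0 :=
  image_eq_zero_of_notMem_tsupport fun h => hx (tsupport_pdx_subset l h)

/-- A smooth function on an open set, cut off inside that set, extends by zero. -/
theorem contDiff_cutoff_mul (hU : IsOpen U) (hψ : ContDiff ℝ ∞ ψ) (hs : tsupport ψ ⊆ U)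
    (hf : ContDiffOn ℝ ∞ f U) : ContDiff ℝ ∞ (fun x => ψ x * f x) := by
  rw [contDiff_iff_contDiffAt]
  intro x
  by_cases hx : x ∈ U
  · exact hψ.contDiffAt.mul (hf.contDiffAt (hU.mem_nhds hx))
  · have h0 : (fun x => ψ x * f x) =ᶠ[nhds x] fun _ => 0 := by
      have : (tsupport ψ)ᶜ ∈ nhds x :=
        (isClosed_tsupport ψ).isOpen_compl.mem_nhds fun h => hx (hs h)
      filter_upwards [this] with y hy
      simp [image_eq_zero_of_notMem_tsupport hy]
    exact contDiffAt_const.congr_of_eventuallyEq h0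

theorem continuous_cutoff_mul (hU : IsOpen U) (hψ : Continuous ψ) (hs : tsupport ψ ⊆ U)
    (hf : ContinuousOn f U) : Continuous (fun x => ψ x * f x) := by
  rw [continuous_iff_continuousAt]
  intro x
  by_cases hx : x ∈ U
  · exact hψ.continuousAt.mul (hf.continuousAt (hU.mem_nhds hx))
  · have h0 : (fun x => ψ x * f x) =ᶠ[nhds x] fun _ => 0 := by
      have : (tsupport ψ)ᶜ ∈ nhds x :=
        (isClosed_tsupport ψ).isOpen_compl.mem_nhds fun h => hx (hs h)
      filter_upwards [this] with y hy
      simp [image_eq_zero_of_notMem_tsupport hy]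
    exact continuousAt_const.congr_of_eventuallyEq h0

theorem integrable_cutoff_mul (hU : IsOpen U) (hψ : Continuous ψ) (hc : HasCompactSupport ψ)
    (hs : tsupport ψ ⊆ U) (hf : ContinuousOn f U) :
    Integrable (fun x => ψ x * f x) :=
  (continuous_cutoff_mul hU hψ hs hf).integrable_of_hasCompactSupport hc.mul_right

theorem integral_pdx_eq_zero (hf : ContDiff ℝ ∞ f) (hc : HasCompactSupport f) (l : Fin 3) :
    ∫ x, pdx l f x = 0 := by
  have h := integral_mul_fderiv_eq_neg_fderiv_mul_of_integrable (μ := (volume : Measure E3))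
    (f := fun _ : E3 => (1 : ℝ)) (g := f) (v := e l) (by simp)
    (by
      simpa using! (hf.pdx l).continuous.integrable_of_hasCompactSupport
        (hc.fderiv_apply ℝ (e l)))
    (by simpa using hf.continuous.integrable_of_hasCompactSupport hc)
    (fun _ _ => by simp) (fun x _ => hf.differentiable (by simp) x)
  simpa [pdx] using h

/-- Integration by parts against a cut-off. -/
theorem integral_cutoff_mul_pdx (hU : IsOpen U) (hψ : ContDiff ℝ ∞ ψ) (hc : HasCompactSupport ψ)
    (hs : tsupport ψ ⊆ U) (hf : ContDiffOn ℝ ∞ f U) (l : Fin 3) :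
    ∫ x, ψ x * pdx l f x = - ∫ x, pdx l ψ x * f x := by
  have h0 := integral_pdx_eq_zero (contDiff_cutoff_mul hU hψ hs hf) hc.mul_right l
  have h1 : ∀ x, pdx l (fun x => ψ x * f x) x = ψ x * pdx l f x + pdx l ψ x * f x := by
    intro x
    by_cases hx : x ∈ U
    · rw [pdx_mul l (hψ.differentiable (by simp) x) (differentiableAt_of_smoothOn hU hf hx)]
      ring
    · have hx' : x ∉ tsupport ψ := fun h => hx (hs h)
      rw [pdx_eq_zero_of_notMem_tsupport l hx', image_eq_zero_of_notMem_tsupport hx',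
        pdx_eq_zero_of_notMem_tsupport l]
      · simp
      · exact fun h => hx' (tsupport_mul_subset_left h)
  simp_rw [h1] at h0
  rw [integral_add] at h0
  · linarith
  · exact integrable_cutoff_mul hU hψ.continuous hc hs (hf.pdx hU l).continuousOn
  · exact integrable_cutoff_mul hU (hψ.pdx l).continuous (hc.fderiv_apply ℝ (e l))
      ((tsupport_pdx_subset l).trans hs) hf.continuousOn

end Space

/-! ### Space-time smooth scalars -/

/-- `h` is smooth on `(0,T] × B(0,ϱ)`, in the sense of one-sided derivatives at the final time. -/
def Sm (T ϱ : ℝ) (h : ℝ → E3 → ℝ) : Prop :=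
  ContDiffOn ℝ ∞ (fun z : ℝ × E3 => h z.1 z.2) (Ioc 0 T ×ˢ ball 0 ϱ)

/-- The time derivative on `(0,T]`, one-sided at `T`. -/
def td (T : ℝ) (h : ℝ → E3 → ℝ) (t : ℝ) (x : E3) : ℝ := derivWithin (fun s => h s x) (Ioc 0 T) t

/-- The spatial partial derivative of a time-dependent scalar. -/
def pd (l : Fin 3) (h : ℝ → E3 → ℝ) (t : ℝ) : E3 → ℝ := pdx l (h t)

section SpaceTime

variable {T ϱ : ℝ} {h k : ℝ → E3 → ℝ} {t : ℝ} {x : E3}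

theorem uniqueDiffOn_cylinder (T ϱ : ℝ) : UniqueDiffOn ℝ (Ioc 0 T ×ˢ ball (0 : E3) ϱ) :=
  (uniqueDiffOn_Ioc 0 T).prod isOpen_ball.uniqueDiffOn

namespace Sm

theorem add (hh : Sm T ϱ h) (hk : Sm T ϱ k) : Sm T ϱ (fun t x => h t x + k t x) :=
  ContDiffOn.add hh hk

theorem sub (hh : Sm T ϱ h) (hk : Sm T ϱ k) : Sm T ϱ (fun t x => h t x - k t x) :=
  ContDiffOn.sub hh hk

theorem mul (hh : Sm T ϱ h) (hk : Sm T ϱ k) : Sm T ϱ (fun t x => h t x * k t x) :=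
  ContDiffOn.mul hh hk

theorem pow (hh : Sm T ϱ h) (n : ℕ) : Sm T ϱ (fun t x => h t x ^ n) :=
  ContDiffOn.pow hh n

theorem sum {ι : Type*} {s : Finset ι} {F : ι → ℝ → E3 → ℝ} (hF : ∀ i ∈ s, Sm T ϱ (F i)) :
    Sm T ϱ (fun t x => ∑ i ∈ s, F i t x) :=
  ContDiffOn.sum hF

theorem slice (hh : Sm T ϱ h) (ht : t ∈ Ioc 0 T) : ContDiffOn ℝ ∞ (h t) (ball 0 ϱ) :=
  ContDiffOn.comp (t := Ioc 0 T ×ˢ ball (0 : E3) ϱ) hh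
    (contDiff_prodMk_right t).contDiffOn fun _ hx => ⟨ht, hx⟩

theorem continuousOn (hh : Sm T ϱ h) :
    ContinuousOn (fun z : ℝ × E3 => h z.1 z.2) (Ioc 0 T ×ˢ ball 0 ϱ) :=
  ContDiffOn.continuousOn hh

theorem hasFDerivWithinAt (hh : Sm T ϱ h) (ht : t ∈ Ioc 0 T) (hx : x ∈ ball 0 ϱ) :
    HasFDerivWithinAt (fun z : ℝ × E3 => h z.1 z.2)
      (fderivWithin ℝ (fun z : ℝ × E3 => h z.1 z.2) (Ioc 0 T ×ˢ ball 0 ϱ) (t, x))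
      (Ioc 0 T ×ˢ ball 0 ϱ) (t, x) := by
  have h1 : ContDiffOn ℝ ∞ (fun z : ℝ × E3 => h z.1 z.2) (Ioc 0 T ×ˢ ball 0 ϱ) := hh
  have h2 := h1.differentiableOn (by simp) (t, x) ⟨ht, hx⟩
  exact h2.hasFDerivWithinAt

theorem pd_eq (hh : Sm T ϱ h) (l : Fin 3) (ht : t ∈ Ioc 0 T) (hx : x ∈ ball 0 ϱ) :
    pd l h t x
      = fderivWithin ℝ (fun z : ℝ × E3 => h z.1 z.2) (Ioc 0 T ×ˢ ball 0 ϱ) (t, x) (0, e l) := by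
  have h1 := (hh.hasFDerivWithinAt ht hx).comp x
    (hasFDerivAt_prodMk_right t x).hasFDerivWithinAt (s := ball 0 ϱ) fun y hy => ⟨ht, hy⟩
  have h2 := h1.hasFDerivAt (isOpen_ball.mem_nhds hx)
  rw [pd, pdx]
  have h3 : fderiv ℝ (h t) x = _ := h2.fderiv
  rw [h3]
  simp

theorem hasDerivWithinAt (hh : Sm T ϱ h) (ht : t ∈ Ioc 0 T) (hx : x ∈ ball 0 ϱ) :
    HasDerivWithinAt (fun s => h s x)
      (fderivWithin ℝ (fun z : ℝ × E3 => h z.1 z.2) (Ioc 0 T ×ˢ ball 0 ϱ) (t, x) (1, 0))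
      (Ioc 0 T) t := by
  have h1 : HasFDerivWithinAt (fun s : ℝ => (s, x)) (ContinuousLinearMap.inl ℝ ℝ E3) (Ioc 0 T) t :=
    (hasFDerivAt_prodMk_left t x).hasFDerivWithinAt
  have h2 := HasFDerivWithinAt.comp t (hh.hasFDerivWithinAt ht hx) h1 (fun _ hy => mk_mem_prod hy hx)
  simpa using! h2.hasDerivWithinAt

theorem td_eq (hh : Sm T ϱ h) (ht : t ∈ Ioc 0 T) (hx : x ∈ ball 0 ϱ) :
    td T h t x
      = fderivWithin ℝ (fun z : ℝ × E3 => h z.1 z.2) (Ioc 0 T ×ˢ ball 0 ϱ) (t, x) (1, 0) :=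
  (hh.hasDerivWithinAt ht hx).derivWithin (uniqueDiffOn_Ioc 0 T t ht)

theorem hasDerivAt (hh : Sm T ϱ h) (ht : t ∈ Ioo 0 T) (hx : x ∈ ball 0 ϱ) :
    HasDerivAt (fun s => h s x) (td T h t x) t := by
  rw [hh.td_eq (Ioo_subset_Ioc_self ht) hx]
  exact (hh.hasDerivWithinAt (Ioo_subset_Ioc_self ht) hx).hasDerivAt
    (Filter.mem_of_superset (isOpen_Ioo.mem_nhds ht) Ioo_subset_Ioc_self)

theorem pd (hh : Sm T ϱ h) (l : Fin 3) : Sm T ϱ (pd l h) := by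
  refine ContDiffOn.congr (f := fun z : ℝ × E3 => fderivWithin ℝ (fun z : ℝ × E3 => h z.1 z.2)
    (Ioc 0 T ×ˢ ball 0 ϱ) z (0, e l)) ?_ fun z hz => hh.pd_eq l hz.1 hz.2
  exact (ContDiffOn.fderivWithin hh (uniqueDiffOn_cylinder T ϱ) (by simp)).clm_apply
    contDiffOn_const

theorem td (hh : Sm T ϱ h) : Sm T ϱ (td T h) := by
  refine ContDiffOn.congr (f := fun z : ℝ × E3 => fderivWithin ℝ (fun z : ℝ × E3 => h z.1 z.2)
    (Ioc 0 T ×ˢ ball 0 ϱ) z (1, 0)) ?_ fun z hz => hh.td_eq hz.1 hz.2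
  exact (ContDiffOn.fderivWithin hh (uniqueDiffOn_cylinder T ϱ) (by simp)).clm_apply
    contDiffOn_const

/-- Time and space derivatives commute in the interior. -/
theorem td_pd (hh : Sm T ϱ h) (l : Fin 3) (ht : t ∈ Ioo 0 T) (hx : x ∈ ball 0 ϱ) :
    MHD.td T (MHD.pd l h) t x = MHD.pd l (MHD.td T h) t x := by
  set F : ℝ × E3 → ℝ := fun z => h z.1 z.2
  have hO : IsOpen (Ioo 0 T ×ˢ ball (0 : E3) ϱ) := isOpen_Ioo.prod isOpen_ball
  have hsub : Ioo 0 T ×ˢ ball (0 : E3) ϱ ⊆ Ioc 0 T ×ˢ ball (0 : E3) ϱ :=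
    prod_mono Ioo_subset_Ioc_self subset_rfl
  have hF : ContDiffOn ℝ ∞ F (Ioo 0 T ×ˢ ball 0 ϱ) := ContDiffOn.mono hh hsub
  have hz : (t, x) ∈ Ioo 0 T ×ˢ ball (0 : E3) ϱ := ⟨ht, hx⟩
  have hat := hF.contDiffAt (hO.mem_nhds hz)
  have hs := hat.isSymmSndFDerivAt (by rw [minSmoothness_of_isRCLikeNormedField]; norm_cast)
  have hd : DifferentiableAt ℝ (fderiv ℝ F) (t, x) :=
    (hat.fderiv_right (m := 1) (by norm_cast)).differentiableAt (by simp)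
  have hw : ∀ z ∈ Ioo 0 T ×ˢ ball (0 : E3) ϱ,
      fderivWithin ℝ F (Ioc 0 T ×ˢ ball 0 ϱ) z = fderiv ℝ F z := fun z hz =>
    fderivWithin_of_mem_nhds (Filter.mem_of_superset (hO.mem_nhds hz) hsub)
  have key : ∀ (G : ℝ → E3 → ℝ) (v : ℝ × E3), Sm T ϱ G →
      (∀ z ∈ Ioo 0 T ×ˢ ball (0 : E3) ϱ, G z.1 z.2 = fderiv ℝ F z v) → ∀ w : ℝ × E3,
      fderiv ℝ (fun z : ℝ × E3 => G z.1 z.2) (t, x) w = fderiv ℝ (fderiv ℝ F) (t, x) w v := by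
    intro G v _ hGv w
    have : (fun z : ℝ × E3 => G z.1 z.2) =ᶠ[nhds (t, x)] fun z => fderiv ℝ F z v := by
      filter_upwards [hO.mem_nhds hz] with z hz using hGv z hz
    rw [this.fderiv_eq, fderiv_clm_apply hd (by fun_prop)]
    simp
  have hw' : ∀ G : ℝ → E3 → ℝ, fderivWithin ℝ (fun z : ℝ × E3 => G z.1 z.2)
      (Ioc 0 T ×ˢ ball 0 ϱ) (t, x) = fderiv ℝ (fun z : ℝ × E3 => G z.1 z.2) (t, x) := fun G =>
    fderivWithin_of_mem_nhds (Filter.mem_of_superset (hO.mem_nhds hz) hsub)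
  have ht' := Ioo_subset_Ioc_self ht
  rw [(hh.pd l).td_eq ht' hx, (hh.td).pd_eq l ht' hx, hw', hw',
    key (MHD.pd l h) (0, e l) (hh.pd l), key (MHD.td T h) (1, 0) hh.td, hs.eq]
  · exact fun z hz => by rw [← hw z hz, ← hh.td_eq (Ioo_subset_Ioc_self hz.1) hz.2]
  · exact fun z hz => by rw [← hw z hz, ← hh.pd_eq l (Ioo_subset_Ioc_self hz.1) hz.2]

end Sm

/-- A weighted space integral of a function continuous on `(0,T] × B(0,ϱ)` is continuous in
time. -/
theorem continuousOn_integral_cutoff {ψ : E3 → ℝ} (hψ : Continuous ψ) (hc : HasCompactSupport ψ)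
    (hs : tsupport ψ ⊆ ball 0 ϱ)
    (hh : ContinuousOn (fun z : ℝ × E3 => h z.1 z.2) (Ioc 0 T ×ˢ ball 0 ϱ)) :
    ContinuousOn (fun t => ∫ x, ψ x * h t x) (Ioc 0 T) := by
  refine continuousOn_integral_of_compact_support (k := tsupport ψ) hc ?_ ?_
  · intro ⟨t, x⟩ ⟨ht, _⟩
    by_cases hx : x ∈ ball (0 : E3) ϱ
    · have h1 : ContinuousWithinAt (fun z : ℝ × E3 => h z.1 z.2) (Ioc 0 T ×ˢ univ) (t, x) := by
        refine (hh (t, x) ⟨ht, hx⟩).mono_of_mem_nhdsWithin ?_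
        rw [mem_nhdsWithin]
        exact ⟨univ ×ˢ ball 0 ϱ, isOpen_univ.prod isOpen_ball, ⟨trivial, hx⟩,
          fun z hz => ⟨hz.2.1, hz.1.2⟩⟩
      exact (hψ.comp continuous_snd).continuousWithinAt.mul h1
    · have h0 : (fun z : ℝ × E3 => ψ z.2 * h z.1 z.2) =ᶠ[nhds (t, x)] fun _ => 0 := by
        have : (univ : Set ℝ) ×ˢ (tsupport ψ)ᶜ ∈ nhds (t, x) :=
          (isOpen_univ.prod (isClosed_tsupport ψ).isOpen_compl).mem_nhds
            ⟨trivial, fun h => hx (hs h)⟩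
        filter_upwards [this] with y hy
        simp [image_eq_zero_of_notMem_tsupport hy.2]
      exact (continuousAt_const.congr_of_eventuallyEq h0).continuousWithinAt
  · intro t x _ hx
    simp [image_eq_zero_of_notMem_tsupport hx]

/-- Differentiation in time under a weighted space integral. -/
theorem hasDerivAt_integral_cutoff {ψ : E3 → ℝ} (hψ : Continuous ψ) (hc : HasCompactSupport ψ)
    (hs : tsupport ψ ⊆ ball 0 ϱ) (hh : Sm T ϱ h) (ht : t ∈ Ioo 0 T) :
    HasDerivAt (fun t => ∫ x, ψ x * h t x) (∫ x, ψ x * td T h t x) t := by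
  obtain ⟨a, ha0, hat⟩ := exists_between ht.1
  obtain ⟨b, htb, hbT⟩ := exists_between ht.2
  have hcpt : IsCompact (Icc a b ×ˢ tsupport ψ) := isCompact_Icc.prod hc
  have hsub : Icc a b ⊆ Ioo 0 T := fun s hs => ⟨ha0.trans_le hs.1, hs.2.trans_lt hbT⟩
  obtain ⟨C, hC⟩ := hcpt.exists_bound_of_continuousOn
    (f := fun z : ℝ × E3 => td T h z.1 z.2)
    (hh.td.continuousOn.mono (prod_mono (hsub.trans Ioo_subset_Ioc_self) hs))
  have hint : ∀ s ∈ Ioo 0 T, ∀ k : ℝ → E3 → ℝ, Sm T ϱ k → Integrable fun x => ψ x * k s x :=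
    fun s hs' k hk => integrable_cutoff_mul isOpen_ball hψ hc hs
      (hk.slice (Ioo_subset_Ioc_self hs')).continuousOn
  refine (hasDerivAt_integral_of_dominated_loc_of_deriv_le (s := Ioo a b)
    (F := fun t x => ψ x * h t x) (F' := fun t x => ψ x * td T h t x)
    (bound := fun x => ‖ψ x‖ * C) (Ioo_mem_nhds hat htb) ?_ (hint t ht h hh)
    (hint t ht _ hh.td).aestronglyMeasurable ?_ ?_ ?_).2
  · filter_upwards [isOpen_Ioo.mem_nhds ht] with s hs using (hint s hs h hh).aestronglyMeasurable
  · refine Filter.Eventually.of_forall fun x s hs' => ?_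
    by_cases hx : x ∈ tsupport ψ
    · rw [norm_mul]
      exact mul_le_mul_of_nonneg_left (hC (s, x) ⟨Ioo_subset_Icc_self hs', hx⟩) (norm_nonneg _)
    · simp [image_eq_zero_of_notMem_tsupport hx]
  · exact (hψ.norm.integrable_of_hasCompactSupport hc.norm).mul_const C
  · refine Filter.Eventually.of_forall fun x s hs' => ?_
    by_cases hx : x ∈ tsupport ψ
    · exact (hh.hasDerivAt (hsub (Ioo_subset_Icc_self hs')) (hs hx)).const_mul (ψ x)
    · simpa [image_eq_zero_of_notMem_tsupport hx] using! hasDerivAt_const s (0 : ℝ)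

end SpaceTime

/-! ### From the weak formulation to the pointwise equations -/

/-- A scalar ODE in weak form holds pointwise. -/
theorem eq_of_integral_deriv_test {T : ℝ} {a a' c : ℝ → ℝ}
    (ha : ∀ t ∈ Ioo 0 T, HasDerivAt a (a' t) t) (ha' : ContinuousOn a' (Ioo 0 T))
    (hc : ContinuousOn c (Ioo 0 T))
    (h : ∀ θ : ℝ → ℝ, ContDiff ℝ ∞ θ → HasCompactSupport θ → tsupport θ ⊆ Ioo 0 T →
      ∫ t in Ioo 0 T, (deriv θ t * a t + θ t * c t) = 0) :
    ∀ t ∈ Ioo 0 T, a' t = c t := by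
  have hac : ContinuousOn a (Ioo 0 T) := fun t ht => (ha t ht).continuousAt.continuousWithinAt
  have key := eqOn_zero_of_integral_cutoff_mul isOpen_Ioo (ha'.sub hc) fun θ hθ hcs hsub => ?_
  · intro t ht
    have := key t ht
    simp only [Pi.sub_apply] at this
    linarith
  have hcont : ∀ (θ : ℝ → ℝ) (b : ℝ → ℝ), Continuous θ → HasCompactSupport θ →
      tsupport θ ⊆ Ioo 0 T → ContinuousOn b (Ioo 0 T) → Integrable fun t => θ t * b t := by
    intro θ b hθ hcs hsub hb
    refine Continuous.integrable_of_hasCompactSupport ?_ hcs.mul_right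
    refine continuous_of_tsupport fun x hx => ?_
    have hx' := hsub (tsupport_mul_subset_left hx)
    exact hθ.continuousAt.mul (hb.continuousAt (isOpen_Ioo.mem_nhds hx'))
  have hd : Continuous (deriv θ) := hθ.continuous_deriv (by simp)
  have hdsub : tsupport (deriv θ) ⊆ Ioo 0 T :=
    (closure_minimal support_deriv_subset (isClosed_tsupport θ)).trans hsub
  have hi1 := hcont (deriv θ) a hd hcs.deriv hdsub hac
  have hi2 := hcont θ a' hθ.continuous hcs hsub ha'
  have hi3 := hcont θ c hθ.continuous hcs hsub hc
  have hz : ∫ t, (deriv θ t * a t + θ t * a' t) = 0 := by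
    refine integral_eq_zero_of_hasDerivAt_of_integrable (f := fun t => θ t * a t) (fun t => ?_)
      (hi1.add hi2) (hcont θ a hθ.continuous hcs hsub hac)
    by_cases ht : t ∈ Ioo 0 T
    · exact ((hθ.differentiable (by simp)) t).hasDerivAt.mul (ha t ht)
    · have ht' : t ∉ tsupport θ := fun h => ht (hsub h)
      have e0 : (fun t => θ t * a t) =ᶠ[nhds t] fun _ => 0 := by
        filter_upwards [(isClosed_tsupport θ).isOpen_compl.mem_nhds ht'] with y hy
        simp [image_eq_zero_of_notMem_tsupport hy]
      rw [image_eq_zero_of_notMem_tsupport ht',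
        image_eq_zero_of_notMem_tsupport (fun h => ht (hdsub h))]
      simpa using (hasDerivAt_const t (0 : ℝ)).congr_of_eventuallyEq e0
  have hw : ∫ t, (deriv θ t * a t + θ t * c t) = 0 := by
    rw [← h θ hθ hcs hsub, setIntegral_eq_integral_of_forall_compl_eq_zero]
    intro t ht
    rw [image_eq_zero_of_notMem_tsupport (fun h => ht (hsub h)),
        image_eq_zero_of_notMem_tsupport (fun h => ht (hdsub h))]
    simp
  rw [integral_add hi1 hi2] at hz
  rw [integral_add hi1 hi3] at hw
  simp only [Pi.sub_apply, mul_sub]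
  rw [integral_sub hi2 hi3]
  linarith

/-- The `k`-th component of a time-dependent field. -/
def cp (f : ℝ → E3 → E3) (k : Fin 3) : ℝ → E3 → ℝ := fun t x => f t x k

/-- The vector field with prescribed components. -/
def vec (Z : Fin 3 → E3 → ℝ) (x : E3) : E3 := WithLp.toLp 2 fun k => Z k x

@[simp] theorem vec_apply (Z : Fin 3 → E3 → ℝ) (x : E3) (k : Fin 3) : vec Z x k = Z k x := rfl

theorem contDiff_vec {Z : Fin 3 → E3 → ℝ} (hZ : ∀ k, ContDiff ℝ ∞ (Z k)) :
    ContDiff ℝ ∞ (vec Z) := contDiff_euclidean.2 hZ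

theorem hasCompactSupport_vec {Z : Fin 3 → E3 → ℝ} (hZ : ∀ k, HasCompactSupport (Z k)) :
    HasCompactSupport (vec Z) := by
  refine HasCompactSupport.of_support_subset_isCompact
    (K := ⋃ k, tsupport (Z k)) (isCompact_iUnion hZ) fun x hx => ?_
  by_contra h
  simp only [mem_iUnion, not_exists] at h
  refine hx ?_
  ext k
  exact image_eq_zero_of_notMem_tsupport (f := Z k) (h k)

theorem fderiv_apply_coord {f : E3 → E3} {x : E3} (hf : DifferentiableAt ℝ f x) (v : E3)
    (k : Fin 3) : (fderiv ℝ f x v) k = fderiv ℝ (fun y => f y k) x v := by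
  have := ((EuclideanSpace.proj (𝕜 := ℝ) k).hasFDerivAt.comp x hf.hasFDerivAt).fderiv
  exact (congrArg (fun L : E3 →L[ℝ] ℝ => L v) this).symm

theorem sum_coord (v : E3) : v = ∑ l, v l • e l := by
  have := (EuclideanSpace.basisFun (Fin 3) ℝ).sum_repr v
  simpa [e] using this.symm

theorem fderiv_eq_sum_pdx (f : E3 → ℝ) (x v : E3) : fderiv ℝ f x v = ∑ l, v l * pdx l f x := by
  conv_lhs => rw [sum_coord v]
  simp [pdx]

theorem divL_fderiv_vec {Z : Fin 3 → E3 → ℝ} (hZ : ∀ k, ContDiff ℝ ∞ (Z k)) (x : E3) :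
    divL (fderiv ℝ (vec Z) x) = ∑ l, pdx l (Z l) x := by
  have := (contDiff_vec hZ).differentiable (by simp) x
  simp only [divL, fderiv_apply_coord this]
  rfl

theorem laplacian_vec_apply {Z : Fin 3 → E3 → ℝ} (hZ : ∀ k, ContDiff ℝ ∞ (Z k)) (x : E3)
    (k : Fin 3) : (Laplacian.laplacian (vec Z) x) k = ∑ l, pdx l (pdx l (Z k)) x := by
  have h1 : ContDiffAt ℝ 2 (vec Z) x := ((contDiff_vec hZ).of_le (by norm_cast)).contDiffAt
  have h2 := h1.laplacian_CLM_comp_left (l := EuclideanSpace.proj (𝕜 := ℝ) k)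
  change _ = (EuclideanSpace.proj (𝕜 := ℝ) k) (Laplacian.laplacian (vec Z) x) at h2
  change (EuclideanSpace.proj (𝕜 := ℝ) k) (Laplacian.laplacian (vec Z) x) = _
  rw [← h2, InnerProductSpace.laplacian_eq_iteratedFDeriv_orthonormalBasis _
    (EuclideanSpace.basisFun (Fin 3) ℝ)]
  refine Finset.sum_congr rfl fun l _ => ?_
  rw [iteratedFDeriv_two_apply]
  have hd : DifferentiableAt ℝ (fderiv ℝ (Z k)) x :=
    ((hZ k).fderiv_right (m := ∞) (by simp)).differentiable (by simp) x
  change fderiv ℝ (fderiv ℝ (Z k)) x _ _ = fderiv ℝ (fun y => fderiv ℝ (Z k) y (e l)) x (e l)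
  rw [fderiv_clm_apply hd (by fun_prop)]
  simp [e]

/-- A separable test field. -/
def sepTest (θ : ℝ → ℝ) (Z : Fin 3 → E3 → ℝ) (z : ℝ × E3) : E3 := θ z.1 • vec Z z.2

section Sep

variable {θ : ℝ → ℝ} {Z : Fin 3 → E3 → ℝ} {T : ℝ}

theorem isTest_sepTest (hθ : ContDiff ℝ ∞ θ) (hcθ : HasCompactSupport θ)
    (hsθ : tsupport θ ⊆ Ioo 0 T) (hZ : ∀ k, ContDiff ℝ ∞ (Z k))
    (hcZ : ∀ k, HasCompactSupport (Z k)) : IsTest T (sepTest θ Z) := by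
  have hsub : Function.support (sepTest θ Z) ⊆ tsupport θ ×ˢ tsupport (vec Z) := by
    intro z hz
    refine ⟨?_, ?_⟩
    · by_contra h
      exact hz (by simp [sepTest, image_eq_zero_of_notMem_tsupport h])
    · by_contra h
      exact hz (by simp [sepTest, image_eq_zero_of_notMem_tsupport h])
  have hcpt : IsCompact (tsupport θ ×ˢ tsupport (vec Z)) :=
    IsCompact.prod hcθ (hasCompactSupport_vec hcZ)
  refine ⟨?_, HasCompactSupport.of_support_subset_isCompact hcpt hsub, ?_⟩
  · exact (hθ.comp contDiff_fst).smul ((contDiff_vec hZ).comp contDiff_snd)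
  · exact (closure_minimal hsub hcpt.isClosed).trans fun z hz => ⟨(hsθ hz.1).2, trivial⟩

theorem heatPair_sepTest (hθ : ContDiff ℝ ∞ θ) (hZ : ∀ k, ContDiff ℝ ∞ (Z k))
    (f : ℝ → E3 → E3) (t : ℝ) (x : E3) :
    heatPair f (sepTest θ Z) t x = deriv θ t * ∑ k, Z k x * cp f k t x
      + θ t * ∑ k, (∑ l, pdx l (pdx l (Z k)) x) * cp f k t x := by
  have h1 : deriv (fun s => sepTest θ Z (s, x)) t = deriv θ t • vec Z x :=
    ((hθ.differentiable (by simp) t).hasDerivAt.smul_const (vec Z x)).deriv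
  have h2 : Laplacian.laplacian (fun y => sepTest θ Z (t, y)) x
      = θ t • Laplacian.laplacian (vec Z) x :=
    InnerProductSpace.laplacian_smul (θ t)
      ((contDiff_vec hZ).of_le (by norm_cast)).contDiffAt
  rw [heatPair, h1, h2]
  simp only [PiLp.inner_apply, PiLp.add_apply, PiLp.smul_apply, laplacian_vec_apply hZ, vec_apply,
    cp, Fin.sum_univ_three]
  simp only [RCLike.inner_apply, conj_trivial, smul_eq_mul]
  ring

theorem transportPair_sepTest (hZ : ∀ k, ContDiff ℝ ∞ (Z k))
    (v w : ℝ → E3 → E3) (t : ℝ) (x : E3) :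
    transportPair v w (sepTest θ Z) t x
      = θ t * ∑ k, ∑ l, pdx l (Z k) x * (cp v l t x * cp w k t x) := by
  have hd := (contDiff_vec hZ).differentiable (by simp) x
  have h1 : fderiv ℝ (fun y => sepTest θ Z (t, y)) x = θ t • fderiv ℝ (vec Z) x :=
    fderiv_const_smul hd (θ t)
  rw [transportPair, h1]
  simp only [PiLp.inner_apply, smul_apply, PiLp.smul_apply,
    fderiv_apply_coord hd, vec_apply, fderiv_eq_sum_pdx, cp, Fin.sum_univ_three]
  simp only [RCLike.inner_apply, conj_trivial, smul_eq_mul]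
  ring

theorem divL_sepTest (hZ : ∀ k, ContDiff ℝ ∞ (Z k)) (hdiv : ∀ x, ∑ l, pdx l (Z l) x = 0)
    (t : ℝ) (x : E3) : divL (fderiv ℝ (fun y => sepTest θ Z (t, y)) x) = 0 := by
  have hd := (contDiff_vec hZ).differentiable (by simp) x
  have h1 : fderiv ℝ (fun y => sepTest θ Z (t, y)) x = θ t • fderiv ℝ (vec Z) x :=
    fderiv_const_smul hd (θ t)
  have h2 : divL (θ t • fderiv ℝ (vec Z) x) = θ t * divL (fderiv ℝ (vec Z) x) := by
    simp [divL, Finset.mul_sum]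
  rw [h1, h2, divL_fderiv_vec hZ, hdiv, mul_zero]

end Sep

/-- If a field `F` satisfies `∂_t F - Δ F + ∂_l S_{l·} = 0` weakly against all separable tests with
spatial part `Z`, then at each time the equation holds when paired with `Z`. -/
theorem integral_equation_eq_zero {T ϱ : ℝ} {F : Fin 3 → ℝ → E3 → ℝ}
    {S : Fin 3 → Fin 3 → ℝ → E3 → ℝ} (hF : ∀ k, Sm T ϱ (F k)) (hS : ∀ l k, Sm T ϱ (S l k))
    {Z : Fin 3 → E3 → ℝ} (hZ : ∀ k, ContDiff ℝ ∞ (Z k)) (hcZ : ∀ k, HasCompactSupport (Z k))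
    (hsZ : ∀ k, tsupport (Z k) ⊆ ball 0 ϱ)
    (h : ∀ θ : ℝ → ℝ, ContDiff ℝ ∞ θ → HasCompactSupport θ → tsupport θ ⊆ Ioo 0 T →
      ∫ t in Ioo 0 T, ∫ x, (deriv θ t * ∑ k, Z k x * F k t x
        + θ t * ∑ k, (∑ l, pdx l (pdx l (Z k)) x) * F k t x
        + θ t * ∑ k, ∑ l, pdx l (Z k) x * S l k t x) = 0) :
    ∀ t ∈ Ioo 0 T, ∑ k, ∫ x, Z k x * (td T (F k) t x - ∑ l, pd l (pd l (F k)) t x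
      + ∑ l, pd l (S l k) t x) = 0 := by
  set R : Fin 3 → ℝ → E3 → ℝ := fun k t x =>
    ∑ l, pd l (pd l (F k)) t x - ∑ l, pd l (S l k) t x with hR
  have hRs : ∀ k, Sm T ϱ (R k) := fun k =>
    (Sm.sum fun l _ => ((hF k).pd l).pd l).sub (Sm.sum fun l _ => (hS l k).pd l)
  have hint : ∀ k, ∀ G : ℝ → E3 → ℝ, Sm T ϱ G → ∀ t ∈ Ioo 0 T, Integrable fun x => Z k x * G t x :=
    fun k G hG t ht => integrable_cutoff_mul isOpen_ball (hZ k).continuous (hcZ k) (hsZ k)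
      (hG.slice (Ioo_subset_Ioc_self ht)).continuousOn
  have hcont : ∀ k, ∀ G : ℝ → E3 → ℝ, Sm T ϱ G →
      ContinuousOn (fun t => ∫ x, Z k x * G t x) (Ioo 0 T) := fun k G hG =>
    (continuousOn_integral_cutoff (hZ k).continuous (hcZ k) (hsZ k) hG.continuousOn).mono
      Ioo_subset_Ioc_self
  have key := eq_of_integral_deriv_test (T := T) (a := fun t => ∑ k, ∫ x, Z k x * F k t x)
    (a' := fun t => ∑ k, ∫ x, Z k x * td T (F k) t x) (c := fun t => ∑ k, ∫ x, Z k x * R k t x)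
    (fun t ht => HasDerivAt.fun_sum fun k _ =>
      hasDerivAt_integral_cutoff (hZ k).continuous (hcZ k) (hsZ k) (hF k) ht)
    (continuousOn_finsetSum _ fun k _ => hcont k _ (hF k).td)
    (continuousOn_finsetSum _ fun k _ => hcont k _ (hRs k)) ?_
  · intro t ht
    have h1 := key t ht
    have h2 : ∀ k, ∫ x, Z k x * (td T (F k) t x - ∑ l, pd l (pd l (F k)) t x
        + ∑ l, pd l (S l k) t x) = (∫ x, Z k x * td T (F k) t x) - ∫ x, Z k x * R k t x := by
      intro k
      rw [← integral_sub (hint k _ (hF k).td t ht) (hint k _ (hRs k) t ht)]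
      congr 1 with x
      rw [hR]
      ring
    simp only [h2, Finset.sum_sub_distrib]
    linarith
  intro θ hθ hcθ hsθ
  refine Eq.trans ?_ (h θ hθ hcθ hsθ)
  refine setIntegral_congr_fun measurableSet_Ioo fun t ht => ?_
  have ht' := Ioo_subset_Ioc_self ht
  have hsl : ∀ G : ℝ → E3 → ℝ, Sm T ϱ G → ContDiffOn ℝ ∞ (G t) (ball 0 ϱ) := fun G hG =>
    hG.slice ht'
  -- integrate by parts once in the flux and twice in the diffusion
  have p1 : ∀ k l, ∫ x, Z k x * pd l (S l k) t x = - ∫ x, pdx l (Z k) x * S l k t x := fun k l =>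
    integral_cutoff_mul_pdx isOpen_ball (hZ k) (hcZ k) (hsZ k) (hsl _ (hS l k)) l
  have p2 : ∀ k l, ∫ x, Z k x * pd l (pd l (F k)) t x
      = ∫ x, pdx l (pdx l (Z k)) x * F k t x := by
    intro k l
    have q1 := integral_cutoff_mul_pdx isOpen_ball (hZ k) (hcZ k) (hsZ k)
      (hsl _ ((hF k).pd l)) l
    have q2 := integral_cutoff_mul_pdx isOpen_ball ((hZ k).pdx l) ((hcZ k).fderiv_apply ℝ (e l))
      ((tsupport_pdx_subset l).trans (hsZ k)) (hsl _ (hF k)) l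
    change ∫ x, Z k x * pdx l (pd l (F k) t) x = _
    rw [q1]
    change - ∫ x, pdx l (Z k) x * pdx l (F k t) x = _
    rw [q2, neg_neg]
  have i1 : ∀ k l, Integrable fun x => pdx l (Z k) x * S l k t x := fun k l =>
    integrable_cutoff_mul isOpen_ball ((hZ k).pdx l).continuous ((hcZ k).fderiv_apply ℝ (e l))
      ((tsupport_pdx_subset l).trans (hsZ k)) (hsl _ (hS l k)).continuousOn
  have i2 : ∀ k l, Integrable fun x => pdx l (pdx l (Z k)) x * F k t x := fun k l =>
    integrable_cutoff_mul isOpen_ball (((hZ k).pdx l).pdx l).continuous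
      (((hcZ k).fderiv_apply ℝ (e l)).fderiv_apply ℝ (e l))
      ((tsupport_pdx_subset l).trans ((tsupport_pdx_subset l).trans (hsZ k)))
      (hsl _ (hF k)).continuousOn
  have i3 : ∀ k l, Integrable fun x => Z k x * pd l (pd l (F k)) t x := fun k l =>
    hint k _ (((hF k).pd l).pd l) t ht
  have i4 : ∀ k l, Integrable fun x => Z k x * pd l (S l k) t x := fun k l =>
    hint k _ ((hS l k).pd l) t ht
  have hRk : ∀ k, ∫ x, Z k x * R k t x = (∑ l, ∫ x, pdx l (pdx l (Z k)) x * F k t x)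
      + ∑ l, ∫ x, pdx l (Z k) x * S l k t x := by
    intro k
    simp only [hR, mul_sub, Finset.mul_sum]
    rw [integral_sub (integrable_finsetSum _ fun l _ => i3 k l)
      (integrable_finsetSum _ fun l _ => i4 k l), integral_finsetSum _ fun l _ => i3 k l,
      integral_finsetSum _ fun l _ => i4 k l]
    simp only [p1, p2, Finset.sum_neg_distrib, sub_neg_eq_add]
  simp only [hRk, Finset.sum_mul]
  rw [integral_add, integral_add, integral_const_mul, integral_const_mul, integral_const_mul,
    integral_finsetSum _ fun k _ => hint k _ (hF k) t ht,
    integral_finsetSum _ fun k _ => integrable_finsetSum _ fun l _ => i2 k l,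
    integral_finsetSum _ fun k _ => integrable_finsetSum _ fun l _ => i1 k l]
  · simp only [integral_finsetSum _ fun l _ => i1 _ l, integral_finsetSum _ fun l _ => i2 _ l,
      Finset.sum_add_distrib]
    ring
  · exact (integrable_finsetSum _ fun k _ => hint k _ (hF k) t ht).const_mul _
  · exact (integrable_finsetSum _ fun k _ => integrable_finsetSum _ fun l _ => i2 k l).const_mul _
  · exact ((integrable_finsetSum _ fun k _ => hint k _ (hF k) t ht).const_mul _).add
      ((integrable_finsetSum _ fun k _ => integrable_finsetSum _ fun l _ => i2 k l).const_mul _)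
  · exact (integrable_finsetSum _ fun k _ => integrable_finsetSum _ fun l _ => i1 k l).const_mul _

/-! ### The smooth MHD system inside the cylinder -/

theorem integral_abs_mul_le_sqrt {α : Type*} [MeasurableSpace α] {μ : Measure α} {f g : α → ℝ}
    (hf : MemLp f 2 μ) (hg : MemLp g 2 μ) :
    ∫ x, |f x| * |g x| ∂μ ≤ √(∫ x, f x ^ 2 ∂μ) * √(∫ x, g x ^ 2 ∂μ) := by
  have h := integral_mul_norm_le_Lp_mul_Lq (μ := μ) (f := f) (g := g) Real.HolderConjugate.two_two
    (by simpa using hf) (by simpa using hg)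
  simpa [Real.sqrt_eq_rpow] using h

theorem sum_apply_mul_eq_inner (a b : E3) : ∑ l, a l * b l = inner ℝ a b := by
  simp [PiLp.inner_apply, mul_comm]

/-- Elements of `H` are weakly divergence free. -/
theorem InH.integral_grad_eq_zero {f : E3 → E3} (hf : InH f) {χ : E3 → ℝ} (hχ : ContDiff ℝ ∞ χ)
    (hc : HasCompactSupport χ) : ∫ x, ∑ l, pdx l χ x * f x l = 0 := by
  set G : E3 → E3 := vec fun l => pdx l χ with hG
  have hGc : Continuous G := (contDiff_vec fun l => hχ.pdx l).continuous
  have hGs : HasCompactSupport G := hasCompactSupport_vec fun l => hc.fderiv_apply ℝ (e l)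
  have hG2 : MemLp G 2 volume := hGc.memLp_of_hasCompactSupport hGs
  have hsum : ∀ v : E3 → E3, ∀ x, ∑ l, pdx l χ x * v x l = inner ℝ (G x) (v x) := fun v x => by
    rw [← sum_apply_mul_eq_inner]; rfl
  simp_rw [hsum f]
  by_contra hne
  set I := ∫ x, inner ℝ (G x) (f x) with hI
  set A := √(∫ x, ‖G x‖ ^ 2) with hA
  have hA0 : 0 ≤ A := Real.sqrt_nonneg _
  have hpos : 0 < |I| / (A + 1) := by positivity
  obtain ⟨v, hv, hvc, hdiv, hlt⟩ := hf.2 (ENNReal.ofReal (|I| / (A + 1))) (by simpa using hpos)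
  have hv2 : MemLp v 2 volume := hv.continuous.memLp_of_hasCompactSupport hvc
  have hw : MemLp (f - v) 2 volume := hf.1.sub hv2
  have hvI : ∫ x, inner ℝ (G x) (v x) = 0 := by
    have hvl : ∀ l, ContDiff ℝ ∞ fun x => v x l := fun l => contDiff_euclidean.1 hv l
    have hpart : ∀ l, ∫ x, pdx l χ x * v x l = - ∫ x, χ x * pdx l (fun y => v y l) x := fun l => by
      rw [integral_cutoff_mul_pdx isOpen_univ hχ hc (subset_univ _) (hvl l).contDiffOn l, neg_neg]
    have hi1 : ∀ l, Integrable fun x => pdx l χ x * v x l := fun l =>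
      integrable_cutoff_mul isOpen_univ (hχ.pdx l).continuous (hc.fderiv_apply ℝ (e l))
        (subset_univ _) (hvl l).continuous.continuousOn
    have hi2 : ∀ l, Integrable fun x => χ x * pdx l (fun y => v y l) x := fun l =>
      integrable_cutoff_mul isOpen_univ hχ.continuous hc
        (subset_univ _) ((hvl l).pdx l).continuous.continuousOn
    simp_rw [← hsum v]
    rw [integral_finsetSum _ fun l _ => hi1 l]
    simp only [hpart, Finset.sum_neg_distrib]
    rw [← integral_finsetSum _ fun l _ => hi2 l, neg_eq_zero]
    refine integral_eq_zero_of_ae (Filter.Eventually.of_forall fun x => ?_)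
    have h1 := hdiv x
    simp only [divL, fderiv_apply_coord (hv.differentiable (by simp) x)] at h1
    simp only [Pi.zero_apply, ← Finset.mul_sum]
    rw [show ∑ l, pdx l (fun y => v y l) x = 0 from h1, mul_zero]
  have hint : ∀ w : E3 → E3, MemLp w 2 volume → Integrable fun x => inner ℝ (G x) (w x) :=
    fun w hw => by
      refine (hG2.norm.integrable_mul hw.norm).mono' ?_ ?_
      · exact hGc.aestronglyMeasurable.inner hw.1
      · exact Filter.Eventually.of_forall fun x => norm_inner_le_norm _ _
  have hIw : I = ∫ x, inner ℝ (G x) ((f - v) x) := by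
    simp only [Pi.sub_apply, inner_sub_right]
    rw [integral_sub (hint f hf.1) (hint v hv2), hvI, sub_zero]
  have hbd : |I| ≤ A * √(∫ x, ‖(f - v) x‖ ^ 2) := by
    rw [hIw]
    refine (abs_integral_le_integral_abs).trans ?_
    refine le_trans ?_ (integral_abs_mul_le_sqrt hG2.norm hw.norm)
    refine integral_mono (hint _ hw).abs (hG2.norm.abs.integrable_mul hw.norm.abs) fun x => ?_
    simpa using abs_real_inner_le_norm (G x) ((f - v) x)
  have hn : √(∫ x, ‖(f - v) x‖ ^ 2) ≤ |I| / (A + 1) := by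
    have h1 := hw.eLpNorm_eq_integral_rpow_norm (by simp) (by simp)
    rw [h1] at hlt
    have h2 := ((ENNReal.ofReal_lt_ofReal_iff hpos).1 hlt).le
    rw [Real.sqrt_eq_rpow]
    simpa using h2
  have h3 : |I| ≤ A * (|I| / (A + 1)) := hbd.trans (mul_le_mul_of_nonneg_left hn hA0)
  have h4 : A * (|I| / (A + 1)) < |I| := by
    rw [← mul_div_assoc, div_lt_iff₀ (by positivity)]
    nlinarith [abs_pos.2 hne]
  linarith

/-- The components of the velocity and the magnetic field form a smooth solution of the MHD system
in the cylinder; the pressure is eliminated by the symmetry of the gradient of the remaining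
terms of the momentum equation. -/
structure SmoothMHD (T ϱ : ℝ) (U B : Fin 3 → ℝ → E3 → ℝ) : Prop where
  smU : ∀ k, Sm T ϱ (U k)
  smB : ∀ k, Sm T ϱ (B k)
  divU : ∀ t ∈ Ioo 0 T, ∀ x ∈ ball (0 : E3) ϱ, ∑ l, pd l (U l) t x = 0
  divB : ∀ t ∈ Ioo 0 T, ∀ x ∈ ball (0 : E3) ϱ, ∑ l, pd l (B l) t x = 0
  momentum : ∀ j k, ∀ t ∈ Ioo 0 T, ∀ x ∈ ball (0 : E3) ϱ,
    pd j (fun t x => td T (U k) t x - ∑ l, pd l (pd l (U k)) t x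
      + ∑ l, pd l (fun t x => U l t x * U k t x - B l t x * B k t x) t x) t x
    = pd k (fun t x => td T (U j) t x - ∑ l, pd l (pd l (U j)) t x
      + ∑ l, pd l (fun t x => U l t x * U j t x - B l t x * B j t x) t x) t x
  induction : ∀ k, ∀ t ∈ Ioo 0 T, ∀ x ∈ ball (0 : E3) ϱ,
    td T (B k) t x - ∑ l, pd l (pd l (B k)) t x
      + ∑ l, pd l (fun t x => U l t x * B k t x - B l t x * U k t x) t x = 0

theorem SmoothIn.sm {T ϱ : ℝ} {f : ℝ → E3 → E3} {Df : ℝ → E3 → E3 →L[ℝ] E3}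
    (h : SmoothIn T ϱ f Df) (k : Fin 3) : Sm T ϱ (cp f k) :=
  contDiffOn_euclidean.1 h.1 k

theorem SmoothIn.differentiableAt {T ϱ : ℝ} {f : ℝ → E3 → E3} {Df : ℝ → E3 → E3 →L[ℝ] E3}
    (h : SmoothIn T ϱ f Df) {t : ℝ} (ht : t ∈ Ioc 0 T) {x : E3} (hx : x ∈ ball 0 ϱ) :
    DifferentiableAt ℝ (f t) x := by
  have h2 : ContDiffOn ℝ ∞ (f t) (ball 0 ϱ) := contDiffOn_euclidean.2 fun k => (h.sm k).slice ht
  exact (h2.contDiffAt (isOpen_ball.mem_nhds hx)).differentiableAt (by simp)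

theorem SmoothIn.apply_eq {T ϱ : ℝ} {f : ℝ → E3 → E3} {Df : ℝ → E3 → E3 →L[ℝ] E3}
    (h : SmoothIn T ϱ f Df) {t : ℝ} (ht : t ∈ Ioc 0 T) {x : E3} (hx : x ∈ ball 0 ϱ)
    (l k : Fin 3) : (Df t x (e l)) k = pd l (cp f k) t x := by
  rw [h.2 t ht x hx, fderiv_apply_coord (h.differentiableAt ht hx)]
  rfl

theorem SmoothIn.div_eq_zero {T ϱ : ℝ} {f : ℝ → E3 → E3} {Df : ℝ → E3 → E3 →L[ℝ] E3}
    (h : SmoothIn T ϱ f Df) (hH : ∀ᵐ t ∂(volume.restrict (Ioo 0 T)), InH (f t)) :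
    ∀ t ∈ Ioo 0 T, ∀ x ∈ ball (0 : E3) ϱ, ∑ l, pd l (cp f l) t x = 0 := by
  have hae : ∀ᵐ t ∂(volume.restrict (Ioo 0 T)), ∀ x ∈ ball (0 : E3) ϱ,
      ∑ l, pd l (cp f l) t x = 0 := by
    filter_upwards [hH, ae_restrict_mem measurableSet_Ioo] with t hft ht
    have ht' := Ioo_subset_Ioc_self ht
    have hsl : ∀ l, ContDiffOn ℝ ∞ (cp f l t) (ball 0 ϱ) := fun l => (h.sm l).slice ht'
    refine eqOn_zero_of_integral_cutoff_mul isOpen_ball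
      (continuousOn_finsetSum _ fun l _ => ((hsl l).pdx isOpen_ball l).continuousOn)
      fun χ hχ hc hs => ?_
    have h0 := hft.integral_grad_eq_zero hχ hc
    have hi1 : ∀ l, Integrable fun x => pdx l χ x * f t x l := fun l =>
      integrable_cutoff_mul isOpen_ball (hχ.pdx l).continuous (hc.fderiv_apply ℝ (e l))
        ((tsupport_pdx_subset l).trans hs) (hsl l).continuousOn
    have hi2 : ∀ l, Integrable fun x => χ x * pd l (cp f l) t x := fun l =>
      integrable_cutoff_mul isOpen_ball hχ.continuous hc hs ((hsl l).pdx isOpen_ball l).continuousOn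
    rw [integral_finsetSum _ fun l _ => hi1 l] at h0
    simp only [Finset.mul_sum]
    rw [integral_finsetSum _ fun l _ => hi2 l, ← neg_eq_zero, ← h0, ← Finset.sum_neg_distrib]
    refine Finset.sum_congr rfl fun l _ => ?_
    rw [neg_eq_iff_eq_neg]
    exact integral_cutoff_mul_pdx isOpen_ball hχ hc hs (hsl l) l
  intro t ht x hx
  have hcont : ContinuousOn (fun t => ∑ l, pd l (cp f l) t x) (Ioo 0 T) := by
    refine continuousOn_finsetSum _ fun l _ => ?_
    exact ((h.sm l).pd l).continuousOn.comp (f := fun s : ℝ => (s, x)) (by fun_prop)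
      fun s hs => mk_mem_prod (Ioo_subset_Ioc_self hs) hx
  have hz : (fun t => ∑ l, pd l (cp f l) t x) =ᵐ[volume.restrict (Ioo 0 T)] fun _ => 0 := by
    filter_upwards [hae] with s hs using hs x hx
  exact Measure.eqOn_open_of_ae_eq hz isOpen_Ioo hcont continuousOn_const ht

theorem tsupport_sub_pdx_subset (χ : E3 → ℝ) (a b : ℝ) (j k : Fin 3) :
    tsupport (fun x => a * pdx j χ x - b * pdx k χ x) ⊆ tsupport χ := by
  refine closure_minimal (fun x hx => ?_) (isClosed_tsupport χ)
  by_contra h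
  exact hx (by simp [pdx_eq_zero_of_notMem_tsupport _ h])

theorem tsupport_const_mul_subset (χ : E3 → ℝ) (a : ℝ) :
    tsupport (fun x => a * χ x) ⊆ tsupport χ := by
  refine closure_minimal (fun x hx => ?_) (isClosed_tsupport χ)
  by_contra h
  exact hx (by simp [image_eq_zero_of_notMem_tsupport h])

/-- A weak solution that is smooth in the cylinder solves the system there pointwise. -/
theorem IsWeakSolution.smoothMHD {T ϱ : ℝ} {u b : ℝ → E3 → E3} {u₀ b₀ : E3 → E3}
    {Du Db : ℝ → E3 → E3 →L[ℝ] E3} (h : IsWeakSolution T u b u₀ b₀ Du Db)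
    (hu : SmoothIn T ϱ u Du) (hb : SmoothIn T ϱ b Db) : SmoothMHD T ϱ (cp u) (cp b) := by
  have init : ∀ (θ : ℝ → ℝ) (Z : Fin 3 → E3 → ℝ) (w : E3 → E3), tsupport θ ⊆ Ioo 0 T →
      ∫ x, inner ℝ (w x) (sepTest θ Z (0, x)) = 0 := by
    intro θ Z w hs
    have : θ 0 = 0 := image_eq_zero_of_notMem_tsupport fun h => lt_irrefl 0 (hs h).1
    simp [sepTest, this]
  refine ⟨hu.sm, hb.sm, hu.div_eq_zero h.u_class.inH, hb.div_eq_zero h.b_class.inH, ?_, ?_⟩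
  · intro j k t ht
    set S : Fin 3 → Fin 3 → ℝ → E3 → ℝ := fun l k t x =>
      cp u l t x * cp u k t x - cp b l t x * cp b k t x with hS
    have hSs : ∀ l k, Sm T ϱ (S l k) := fun l k =>
      ((hu.sm l).mul (hu.sm k)).sub ((hb.sm l).mul (hb.sm k))
    set N : Fin 3 → ℝ → E3 → ℝ := fun k t x => td T (cp u k) t x
      - ∑ l, pd l (pd l (cp u k)) t x + ∑ l, pd l (S l k) t x with hN
    have hNs : ∀ k, Sm T ϱ (N k) := fun k =>
      ((hu.sm k).td.sub (Sm.sum fun l _ => ((hu.sm k).pd l).pd l)).add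
        (Sm.sum fun l _ => (hSs l k).pd l)
    have ht' := Ioo_subset_Ioc_self ht
    have hsl : ∀ k, ContDiffOn ℝ ∞ (N k t) (ball 0 ϱ) := fun k => (hNs k).slice ht'
    have key := eqOn_zero_of_integral_cutoff_mul (f := fun x => pdx j (N k t) x - pdx k (N j t) x)
      isOpen_ball (((hsl k).pdx isOpen_ball j).continuousOn.sub
        ((hsl j).pdx isOpen_ball k).continuousOn) ?_
    · intro x hx
      exact sub_eq_zero.1 (key x hx)
    intro χ hχ hc hs
    set Z : Fin 3 → E3 → ℝ := fun i x => (if i = k then 1 else 0) * pdx j χ x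
      - (if i = j then 1 else 0) * pdx k χ x with hZ
    have hZs : ∀ i, ContDiff ℝ ∞ (Z i) := fun i =>
      (contDiff_const.mul (hχ.pdx j)).sub (contDiff_const.mul (hχ.pdx k))
    have hZt : ∀ i, tsupport (Z i) ⊆ tsupport χ := fun i => tsupport_sub_pdx_subset χ _ _ j k
    have hZc : ∀ i, HasCompactSupport (Z i) := fun i =>
      HasCompactSupport.of_support_subset_isCompact hc ((subset_tsupport _).trans (hZt i))
    have hdiv : ∀ x, ∑ l, pdx l (Z l) x = 0 := by
      intro x
      have h1 : ∀ l, pdx l (Z l) x = (if l = k then 1 else 0) * pdx l (pdx j χ) x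
          - (if l = j then 1 else 0) * pdx l (pdx k χ) x := by
        intro l
        have d1 := (hχ.pdx j).differentiable (by simp) x
        have d2 := (hχ.pdx k).differentiable (by simp) x
        rw [hZ, pdx_sub l (d1.const_mul _) (d2.const_mul _), pdx_const_mul l _ d1,
          pdx_const_mul l _ d2]
      simp only [h1, Finset.sum_sub_distrib, ite_mul, one_mul, zero_mul, Finset.sum_ite_eq',
        Finset.mem_univ, if_true]
      rw [pdx_comm isOpen_univ hχ.contDiffOn (mem_univ x) k j, sub_self]
    have h1 := integral_equation_eq_zero hu.sm hSs hZs hZc (fun i => (hZt i).trans hs) ?_ t ht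
    · have h2 : ∀ i, ∫ x, Z i x * N i t x = (if i = k then 1 else 0) * (∫ x, pdx j χ x * N i t x)
          - (if i = j then 1 else 0) * ∫ x, pdx k χ x * N i t x := by
        intro i
        have hi : ∀ l, Integrable fun x => pdx l χ x * N i t x := fun l =>
          integrable_cutoff_mul isOpen_ball (hχ.pdx l).continuous (hc.fderiv_apply ℝ (e l))
            ((tsupport_pdx_subset l).trans hs) (hsl i).continuousOn
        rw [← integral_const_mul, ← integral_const_mul,
          ← integral_sub ((hi j).const_mul _) ((hi k).const_mul _)]
        congr 1 with x
        rw [hZ]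
        ring
      change ∑ i, ∫ x, Z i x * N i t x = 0 at h1
      simp only [h2, Finset.sum_sub_distrib, ite_mul, one_mul, zero_mul, Finset.sum_ite_eq',
        Finset.mem_univ, if_true] at h1
      have p1 := integral_cutoff_mul_pdx isOpen_ball hχ hc hs (hsl k) j
      have p2 := integral_cutoff_mul_pdx isOpen_ball hχ hc hs (hsl j) k
      simp only [mul_sub]
      rw [integral_sub, p1, p2]
      · linarith
      · exact integrable_cutoff_mul isOpen_ball hχ.continuous hc hs
          ((hsl k).pdx isOpen_ball j).continuousOn
      · exact integrable_cutoff_mul isOpen_ball hχ.continuous hc hs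
          ((hsl j).pdx isOpen_ball k).continuousOn
    · intro θ hθ hcθ hsθ
      have h3 := h.momentum _ (isTest_sepTest hθ hcθ hsθ hZs hZc) (divL_sepTest hZs hdiv)
      rw [init θ Z u₀ hsθ, add_zero] at h3
      refine Eq.trans ?_ h3
      congr 1 with t
      congr 1 with x
      rw [heatPair_sepTest hθ hZs, transportPair_sepTest hZs, transportPair_sepTest hZs, add_sub_assoc,
        ← mul_sub, ← Finset.sum_sub_distrib]
      simp only [← Finset.sum_sub_distrib, ← mul_sub, hS]
  · intro k t ht
    set S : Fin 3 → Fin 3 → ℝ → E3 → ℝ := fun l k t x =>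
      cp u l t x * cp b k t x - cp b l t x * cp u k t x with hS
    have hSs : ∀ l k, Sm T ϱ (S l k) := fun l k =>
      ((hu.sm l).mul (hb.sm k)).sub ((hb.sm l).mul (hu.sm k))
    set N : Fin 3 → ℝ → E3 → ℝ := fun k t x => td T (cp b k) t x
      - ∑ l, pd l (pd l (cp b k)) t x + ∑ l, pd l (S l k) t x with hN
    have hNs : ∀ k, Sm T ϱ (N k) := fun k =>
      ((hb.sm k).td.sub (Sm.sum fun l _ => ((hb.sm k).pd l).pd l)).add
        (Sm.sum fun l _ => (hSs l k).pd l)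
    have ht' := Ioo_subset_Ioc_self ht
    refine eqOn_zero_of_integral_cutoff_mul (f := N k t) isOpen_ball
      ((hNs k).slice ht').continuousOn fun χ hχ hc hs => ?_
    set Z : Fin 3 → E3 → ℝ := fun i x => (if i = k then 1 else 0) * χ x with hZ
    have hZs : ∀ i, ContDiff ℝ ∞ (Z i) := fun i => contDiff_const.mul hχ
    have hZt : ∀ i, tsupport (Z i) ⊆ tsupport χ := fun i => tsupport_const_mul_subset χ _
    have hZc : ∀ i, HasCompactSupport (Z i) := fun i =>
      HasCompactSupport.of_support_subset_isCompact hc ((subset_tsupport _).trans (hZt i))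
    have h1 := integral_equation_eq_zero hb.sm hSs hZs hZc (fun i => (hZt i).trans hs) ?_ t ht
    · change ∑ i, ∫ x, Z i x * N i t x = 0 at h1
      have h2 : ∀ i, ∫ x, Z i x * N i t x = (if i = k then 1 else 0) * ∫ x, χ x * N i t x := by
        intro i
        rw [← integral_const_mul]
        simp only [hZ, mul_assoc]
      simpa only [h2, ite_mul, one_mul, zero_mul, Finset.sum_ite_eq', Finset.mem_univ,
        if_true] using h1
    · intro θ hθ hcθ hsθ
      have h3 := h.induction _ (isTest_sepTest hθ hcθ hsθ hZs hZc)
      rw [init θ Z b₀ hsθ, add_zero] at h3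
      refine Eq.trans ?_ h3
      congr 1 with t
      congr 1 with x
      rw [heatPair_sepTest hθ hZs, transportPair_sepTest hZs, transportPair_sepTest hZs, add_sub_assoc,
        ← mul_sub, ← Finset.sum_sub_distrib]
      simp only [← Finset.sum_sub_distrib, ← mul_sub, hS]

/-! ### The vorticity and current equations -/

/-- The component `∂_j F_k - ∂_k F_j` of the curl. -/
def crl (F : Fin 3 → ℝ → E3 → ℝ) (j k : Fin 3) (t : ℝ) (x : E3) : ℝ :=
  pd j (F k) t x - pd k (F j) t x

/-- The commutator of `∂_j · - ∂_k ·` with the transport term `F_l ∂_l G`. -/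
def quad (F G : Fin 3 → ℝ → E3 → ℝ) (j k : Fin 3) (t : ℝ) (x : E3) : ℝ :=
  ∑ l, (pd j (F l) t x * pd l (G k) t x - pd k (F l) t x * pd l (G j) t x)

section

variable {T ϱ : ℝ} {t : ℝ} {x : E3}

theorem Sm.differentiableAt {h : ℝ → E3 → ℝ} (hh : Sm T ϱ h) (ht : t ∈ Ioc 0 T)
    (hx : x ∈ ball 0 ϱ) : DifferentiableAt ℝ (h t) x :=
  differentiableAt_of_smoothOn isOpen_ball (hh.slice ht) hx

theorem Sm.pd_comm {h : ℝ → E3 → ℝ} (hh : Sm T ϱ h) (ht : t ∈ Ioc 0 T)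
    (hx : x ∈ ball 0 ϱ) (j l : Fin 3) : MHD.pd j (MHD.pd l h) t x = MHD.pd l (MHD.pd j h) t x :=
  pdx_comm isOpen_ball (hh.slice ht) hx j l

/-- Third derivatives: a gradient component commutes with a repeated derivative. -/
theorem Sm.pd_pd_pd {h : ℝ → E3 → ℝ} (hh : Sm T ϱ h) (ht : t ∈ Ioc 0 T)
    (hx : x ∈ ball 0 ϱ) (j l : Fin 3) :
    MHD.pd j (MHD.pd l (MHD.pd l h)) t x = MHD.pd l (MHD.pd l (MHD.pd j h)) t x := by
  rw [(hh.pd l).pd_comm ht hx j l]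
  exact pdx_congr l isOpen_ball (fun y hy => hh.pd_comm ht hy j l) hx

theorem Sm.crl {F : Fin 3 → ℝ → E3 → ℝ} (hF : ∀ k, Sm T ϱ (F k)) (j k : Fin 3) :
    Sm T ϱ (crl F j k) := ((hF k).pd j).sub ((hF j).pd k)

theorem pd_crl {F : Fin 3 → ℝ → E3 → ℝ} (hF : ∀ k, Sm T ϱ (F k)) (ht : t ∈ Ioc 0 T)
    (hx : x ∈ ball 0 ϱ) (j k l : Fin 3) :
    pd l (crl F j k) t x = pd l (pd j (F k)) t x - pd l (pd k (F j)) t x :=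
  pdx_sub l (((hF k).pd j).differentiableAt ht hx) (((hF j).pd k).differentiableAt ht hx)

theorem pd_pd_crl {F : Fin 3 → ℝ → E3 → ℝ} (hF : ∀ k, Sm T ϱ (F k)) (ht : t ∈ Ioc 0 T)
    (hx : x ∈ ball 0 ϱ) (j k l : Fin 3) :
    pd l (pd l (crl F j k)) t x
      = pd l (pd l (pd j (F k))) t x - pd l (pd l (pd k (F j))) t x := by
  refine Eq.trans ?_ (pdx_sub l ((((hF k).pd j).pd l).differentiableAt ht hx)
    ((((hF j).pd k).pd l).differentiableAt ht hx))
  exact pdx_congr l isOpen_ball (fun y hy => pd_crl hF ht hy j k l) hx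

theorem td_crl {F : Fin 3 → ℝ → E3 → ℝ} (hF : ∀ k, Sm T ϱ (F k)) (ht : t ∈ Ioo 0 T)
    (hx : x ∈ ball 0 ϱ) (j k : Fin 3) :
    td T (crl F j k) t x = td T (pd j (F k)) t x - td T (pd k (F j)) t x :=
  ((Sm.crl hF j k).hasDerivAt ht hx).unique
    ((((hF k).pd j).hasDerivAt ht hx).sub (((hF j).pd k).hasDerivAt ht hx))

/-- The curl of a transport equation `∂_t W - Δ W + (U·∇) W - (B·∇) Y`, with a gradient on the right
hand side, written in conservative form. -/
theorem crl_equation {U B W Y : Fin 3 → ℝ → E3 → ℝ} (hU : ∀ k, Sm T ϱ (U k))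
    (hB : ∀ k, Sm T ϱ (B k)) (hW : ∀ k, Sm T ϱ (W k)) (hY : ∀ k, Sm T ϱ (Y k))
    (ht : t ∈ Ioo 0 T) (divU : ∀ x ∈ ball (0 : E3) ϱ, ∑ l, pd l (U l) t x = 0)
    (divB : ∀ x ∈ ball (0 : E3) ϱ, ∑ l, pd l (B l) t x = 0) (j k : Fin 3)
    (hE : ∀ x ∈ ball (0 : E3) ϱ,
      pd j (fun t x => td T (W k) t x - ∑ l, pd l (pd l (W k)) t x
        + ∑ l, pd l (fun t x => U l t x * W k t x - B l t x * Y k t x) t x) t x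
      = pd k (fun t x => td T (W j) t x - ∑ l, pd l (pd l (W j)) t x
        + ∑ l, pd l (fun t x => U l t x * W j t x - B l t x * Y j t x) t x) t x)
    (hx : x ∈ ball 0 ϱ) :
    td T (crl W j k) t x = ∑ l, pd l (pd l (crl W j k)) t x
      - ∑ l, U l t x * pd l (crl W j k) t x + ∑ l, B l t x * pd l (crl Y j k) t x
      - quad U W j k t x + quad B Y j k t x := by
  have ht' := Ioo_subset_Ioc_self ht
  have hd : ∀ {h : ℝ → E3 → ℝ}, Sm T ϱ h → ∀ {x : E3}, x ∈ ball 0 ϱ →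
      DifferentiableAt ℝ (h t) x := fun hh _ hx => hh.differentiableAt ht' hx
  have expand : ∀ a c : Fin 3,
      pd a (fun t x => td T (W c) t x - ∑ l, pd l (pd l (W c)) t x
        + ∑ l, pd l (fun t x => U l t x * W c t x - B l t x * Y c t x) t x) t x
      = td T (pd a (W c)) t x - ∑ l, pd l (pd l (pd a (W c))) t x
        + ∑ l, (pd a (U l) t x * pd l (W c) t x + U l t x * pd l (pd a (W c)) t x
          - (pd a (B l) t x * pd l (Y c) t x + B l t x * pd l (pd a (Y c)) t x)) := by
    intro a c
    -- incompressibility turns the conservative form into the convective one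
    have e1 : EqOn (fun y => td T (W c) t y - ∑ l, pd l (pd l (W c)) t y
          + ∑ l, pd l (fun t x => U l t x * W c t x - B l t x * Y c t x) t y)
        (fun y => td T (W c) t y - ∑ l, pd l (pd l (W c)) t y
          + ∑ l, (U l t y * pd l (W c) t y - B l t y * pd l (Y c) t y)) (ball 0 ϱ) := by
      intro y hy
      have h1 : ∀ l, pd l (fun t x => U l t x * W c t x - B l t x * Y c t x) t y
          = U l t y * pd l (W c) t y - B l t y * pd l (Y c) t y
            + (W c t y * pd l (U l) t y - Y c t y * pd l (B l) t y) := by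
        intro l
        have := pdx_sub l ((hd (hU l) hy).mul (hd (hW c) hy)) ((hd (hB l) hy).mul (hd (hY c) hy))
        refine this.trans ?_
        have m1 := pdx_mul l (hd (hU l) hy) (hd (hW c) hy)
        have m2 := pdx_mul l (hd (hB l) hy) (hd (hY c) hy)
        refine (congrArg₂ (· - ·) m1 m2).trans ?_
        simp only [pd]
        ring
      simp only [h1, Finset.sum_add_distrib]
      rw [Finset.sum_sub_distrib (fun l => W c t y * pd l (U l) t y), ← Finset.mul_sum,
        ← Finset.mul_sum, divU y hy, divB y hy]
      ring
    have e2 := pdx_congr a isOpen_ball e1 hx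
    refine e2.trans ?_
    have d1 : DifferentiableAt ℝ (fun y => ∑ l, pd l (pd l (W c)) t y) x :=
      DifferentiableAt.fun_sum fun l _ => hd (((hW c).pd l).pd l) hx
    have d2 : ∀ l, DifferentiableAt ℝ (fun y => U l t y * pd l (W c) t y
        - B l t y * pd l (Y c) t y) x := fun l =>
      ((hd (hU l) hx).mul (hd ((hW c).pd l) hx)).sub ((hd (hB l) hx).mul (hd ((hY c).pd l) hx))
    have d3 : DifferentiableAt ℝ (fun y => ∑ l, (U l t y * pd l (W c) t y
        - B l t y * pd l (Y c) t y)) x := DifferentiableAt.fun_sum fun l _ => d2 l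
    rw [pdx_add a ((hd (hW c).td hx).fun_sub d1) d3, pdx_sub a (hd (hW c).td hx) d1,
      pdx_sum _ a (fun l _ => hd (((hW c).pd l).pd l) hx), pdx_sum _ a (fun l _ => d2 l)]
    have s1 : pdx a (td T (W c) t) x = td T (pd a (W c)) t x := ((hW c).td_pd a ht hx).symm
    have s2 : ∀ l, pdx a (pd l (pd l (W c)) t) x = pd l (pd l (pd a (W c))) t x := fun l =>
      (hW c).pd_pd_pd ht' hx a l
    have s3 : ∀ l, pdx a (fun y => U l t y * pd l (W c) t y - B l t y * pd l (Y c) t y) x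
        = pd a (U l) t x * pd l (W c) t x + U l t x * pd l (pd a (W c)) t x
          - (pd a (B l) t x * pd l (Y c) t x + B l t x * pd l (pd a (Y c)) t x) := by
      intro l
      rw [pdx_sub a ((hd (hU l) hx).fun_mul (hd ((hW c).pd l) hx))
        ((hd (hB l) hx).fun_mul (hd ((hY c).pd l) hx)), pdx_mul a (hd (hU l) hx) (hd ((hW c).pd l) hx),
        pdx_mul a (hd (hB l) hx) (hd ((hY c).pd l) hx)]
      have c1 := (hW c).pd_comm ht' hx a l
      have c2 := (hY c).pd_comm ht' hx a l
      change pdx a (pd l (W c) t) x = _ at c1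
      change pdx a (pd l (Y c) t) x = _ at c2
      rw [c1, c2]
      simp only [pd]
      ring
    simp only [s1, s2, s3]
  have h0 := hE x hx
  rw [expand j k, expand k j] at h0
  rw [td_crl hW ht hx]
  simp only [pd_pd_crl hW ht' hx, pd_crl hW ht' hx, pd_crl hY ht' hx, quad]
  simp only [Fin.sum_univ_three] at h0 ⊢
  linear_combination h0

end

namespace SmoothMHD

variable {T ϱ : ℝ} {U B : Fin 3 → ℝ → E3 → ℝ} {t : ℝ} {x : E3}

/-- The vorticity equation. -/
theorem vorticity (h : SmoothMHD T ϱ U B) (j k : Fin 3) (ht : t ∈ Ioo 0 T) (hx : x ∈ ball 0 ϱ) :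
    td T (crl U j k) t x = ∑ l, pd l (pd l (crl U j k)) t x
      - ∑ l, U l t x * pd l (crl U j k) t x + ∑ l, B l t x * pd l (crl B j k) t x
      - quad U U j k t x + quad B B j k t x :=
  crl_equation h.smU h.smB h.smU h.smB ht (h.divU t ht) (h.divB t ht) j k
    (h.momentum j k t ht) hx

/-- The equation for the current. -/
theorem current (h : SmoothMHD T ϱ U B) (j k : Fin 3) (ht : t ∈ Ioo 0 T) (hx : x ∈ ball 0 ϱ) :
    td T (crl B j k) t x = ∑ l, pd l (pd l (crl B j k)) t x
      - ∑ l, U l t x * pd l (crl B j k) t x + ∑ l, B l t x * pd l (crl U j k) t x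
      - quad U B j k t x + quad B U j k t x := by
  refine crl_equation h.smU h.smB h.smB h.smU ht (h.divU t ht) (h.divB t ht) j k ?_ hx
  intro y hy
  have hz : ∀ a c, pd a (fun t x => td T (B c) t x - ∑ l, pd l (pd l (B c)) t x
      + ∑ l, pd l (fun t x => U l t x * B c t x - B l t x * U c t x) t x) t y = 0 := by
    intro a c
    refine (pdx_congr a isOpen_ball (g := fun _ => 0) (fun z hz => h.induction c t ht z hz) hy).trans ?_
    simp [pdx]
  rw [hz, hz]

end SmoothMHD

/-! ### The local enstrophy identity -/

section

variable {T ϱ : ℝ}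

/-- Space integration of the energy identity for two scalars `f`, `g` solving advection-diffusion
equations coupled through `B`. -/
theorem integral_energy_identity {V : Set E3} (hV : IsOpen V) {f g ψ : E3 → ℝ}
    {U B : Fin 3 → E3 → ℝ} {ft gt s₁ s₂ : E3 → ℝ}
    (hψ : ContDiff ℝ ∞ ψ) (hc : HasCompactSupport ψ) (hs : tsupport ψ ⊆ V)
    (hf : ContDiffOn ℝ ∞ f V) (hg : ContDiffOn ℝ ∞ g V) (hU : ∀ l, ContDiffOn ℝ ∞ (U l) V)
    (hB : ∀ l, ContDiffOn ℝ ∞ (B l) V) (hs₁ : ContinuousOn s₁ V) (hs₂ : ContinuousOn s₂ V)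
    (divU : ∀ x ∈ V, ∑ l, pdx l (U l) x = 0) (divB : ∀ x ∈ V, ∑ l, pdx l (B l) x = 0)
    (eqf : ∀ x ∈ V, ft x = ∑ l, pdx l (pdx l f) x - ∑ l, U l x * pdx l f x
      + ∑ l, B l x * pdx l g x + s₁ x)
    (eqg : ∀ x ∈ V, gt x = ∑ l, pdx l (pdx l g) x - ∑ l, U l x * pdx l g x
      + ∑ l, B l x * pdx l f x + s₂ x) :
    ∫ x, ψ x * (f x * ft x + g x * gt x)
      = - (∫ x, ψ x * ∑ l, (pdx l f x ^ 2 + pdx l g x ^ 2))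
        + (∫ x, (∑ l, pdx l (pdx l ψ) x) * (1 / 2 * (f x ^ 2 + g x ^ 2)))
        + (∫ x, ∑ l, pdx l ψ x * (U l x * (1 / 2 * (f x ^ 2 + g x ^ 2))))
        - (∫ x, ∑ l, pdx l ψ x * (B l x * (f x * g x)))
        + ∫ x, ψ x * (f x * s₁ x + g x * s₂ x) := by
  -- the flux whose divergence is the difference of the two sides
  set A : Fin 3 → E3 → ℝ := fun l x => f x * pdx l f x + g x * pdx l g x
    - U l x * (1 / 2 * (f x ^ 2 + g x ^ 2)) + B l x * (f x * g x) with hA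
  set q : E3 → ℝ := fun x => 1 / 2 * (f x ^ 2 + g x ^ 2) with hq
  have hqs : ContDiffOn ℝ ∞ q V := contDiffOn_const.mul ((hf.pow 2).add (hg.pow 2))
  have hAs : ∀ l, ContDiffOn ℝ ∞ (A l) V := fun l =>
    (((hf.mul (hf.pdx hV l)).add (hg.mul (hg.pdx hV l))).sub ((hU l).mul hqs)).add
      ((hB l).mul (hf.mul hg))
  have hd : ∀ {h : E3 → ℝ}, ContDiffOn ℝ ∞ h V → ∀ {x}, x ∈ V → DifferentiableAt ℝ h x :=
    fun hh _ hx => differentiableAt_of_smoothOn hV hh hx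
  have p1 : ∀ l, ∫ x, ψ x * pdx l (A l) x = - ∫ x, pdx l ψ x * A l x := fun l =>
    integral_cutoff_mul_pdx hV hψ hc hs (hAs l) l
  have cψ : ∀ l, HasCompactSupport (pdx l ψ) := fun l => hc.fderiv_apply ℝ (e l)
  have sψ : ∀ l, tsupport (pdx l ψ) ⊆ V := fun l => (tsupport_pdx_subset l).trans hs
  have p2 : ∀ l, ∫ x, pdx l ψ x * pdx l q x = - ∫ x, pdx l (pdx l ψ) x * q x := fun l =>
    integral_cutoff_mul_pdx hV (hψ.pdx l) (cψ l) (sψ l) hqs l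
  have hqd : ∀ l, ∀ x ∈ V, pdx l q x = f x * pdx l f x + g x * pdx l g x := by
    intro l x hx
    have e1 : q = fun x => 1 / 2 * (f x * f x + g x * g x) := by ext x; rw [hq]; ring
    rw [e1, pdx_const_mul l _
      (((hd hf hx).fun_mul (hd hf hx)).fun_add ((hd hg hx).fun_mul (hd hg hx))),
      pdx_add l ((hd hf hx).fun_mul (hd hf hx)) ((hd hg hx).fun_mul (hd hg hx)),
      pdx_mul l (hd hf hx) (hd hf hx), pdx_mul l (hd hg hx) (hd hg hx)]
    ring
  have hAd : ∀ l, ∀ x ∈ V, pdx l (A l) x = (pdx l f x ^ 2 + pdx l g x ^ 2)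
      + f x * (pdx l (pdx l f) x - U l x * pdx l f x + B l x * pdx l g x)
      + g x * (pdx l (pdx l g) x - U l x * pdx l g x + B l x * pdx l f x)
      - q x * pdx l (U l) x + f x * g x * pdx l (B l) x := by
    intro l x hx
    have df := hd hf hx
    have dg := hd hg hx
    have df' := hd (hf.pdx hV l) hx
    have dg' := hd (hg.pdx hV l) hx
    have dU := hd (hU l) hx
    have dB := hd (hB l) hx
    have dq := hd hqs hx
    have e1 : pdx l (A l) x = _ := pdx_add l (((df.mul df').add (dg.mul dg')).sub (dU.mul dq))
      (dB.mul (df.mul dg))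
    have e2 : pdx l (fun y => f y * pdx l f y + g y * pdx l g y - U l y * q y) x = _ :=
      pdx_sub l ((df.mul df').add (dg.mul dg')) (dU.mul dq)
    have e3 : pdx l (fun y => f y * pdx l f y + g y * pdx l g y) x = _ :=
      pdx_add l (df.mul df') (dg.mul dg')
    have e4 : pdx l (fun y => B l y * (f y * g y)) x = _ := pdx_mul l dB (df.mul dg)
    rw [e1]
    refine (congrArg₂ (· + ·) (e2.trans (congrArg₂ (· - ·) (e3.trans (congrArg₂ (· + ·)
      (pdx_mul l df df') (pdx_mul l dg dg'))) (pdx_mul l dU dq)))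
      (e4.trans (congrArg₂ (· + ·) (congrArg (_ * ·) (pdx_mul l df dg)) rfl))).trans ?_
    simp only [hqd l x hx]
    ring
  have ic : ∀ h : E3 → ℝ, ContinuousOn h V → Integrable fun x => ψ x * h x := fun h hh =>
    integrable_cutoff_mul hV hψ.continuous hc hs hh
  have icd : ∀ l, ∀ h : E3 → ℝ, ContinuousOn h V → Integrable fun x => pdx l ψ x * h x :=
    fun l h hh => integrable_cutoff_mul hV (hψ.pdx l).continuous (cψ l) (sψ l) hh
  have icdd : ∀ l, ∀ h : E3 → ℝ, ContinuousOn h V → Integrable fun x => pdx l (pdx l ψ) x * h x :=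
    fun l h hh => integrable_cutoff_mul hV ((hψ.pdx l).pdx l).continuous
      ((cψ l).fderiv_apply ℝ (e l)) ((tsupport_pdx_subset l).trans (sψ l)) hh
  have hSc : ContinuousOn (fun x => f x * s₁ x + g x * s₂ x) V :=
    (hf.continuousOn.mul hs₁).add (hg.continuousOn.mul hs₂)
  have hDc : ContinuousOn (fun x => ∑ l, (pdx l f x ^ 2 + pdx l g x ^ 2)) V :=
    continuousOn_finsetSum _ fun l _ =>
      ((hf.pdx hV l).continuousOn.pow 2).add ((hg.pdx hV l).continuousOn.pow 2)
  have hAdc : ∀ l, ContinuousOn (pdx l (A l)) V := fun l => ((hAs l).pdx hV l).continuousOn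
  have cfg : ContinuousOn (fun x => f x * g x) V := hf.continuousOn.mul hg.continuousOn
  have iU : ∀ l, Integrable fun x => pdx l ψ x * (U l x * q x) := fun l =>
    icd l _ ((hU l).continuousOn.mul hqs.continuousOn)
  have iB : ∀ l, Integrable fun x => pdx l ψ x * (B l x * (f x * g x)) := fun l =>
    icd l _ ((hB l).continuousOn.mul cfg)
  have iq : ∀ l, Integrable fun x => pdx l ψ x * pdx l q x := fun l =>
    icd l _ (hqs.pdx hV l).continuousOn
  have step1 : ∫ x, ψ x * (f x * ft x + g x * gt x)
      = (∑ l, ∫ x, ψ x * pdx l (A l) x) - (∫ x, ψ x * ∑ l, (pdx l f x ^ 2 + pdx l g x ^ 2))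
        + ∫ x, ψ x * (f x * s₁ x + g x * s₂ x) := by
    have i1 : Integrable fun x => ∑ l, ψ x * pdx l (A l) x :=
      integrable_finsetSum _ fun l _ => ic _ (hAdc l)
    have i2 : Integrable fun x => ∑ l, ψ x * pdx l (A l) x
        - ψ x * ∑ l, (pdx l f x ^ 2 + pdx l g x ^ 2) := i1.sub (ic _ hDc)
    rw [← integral_finsetSum _ fun l _ => ic _ (hAdc l), ← integral_sub i1 (ic _ hDc),
      ← integral_add i2 (ic _ hSc)]
    congr 1 with x
    by_cases hx : x ∈ V
    · have dU := divU x hx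
      have dB := divB x hx
      rw [eqf x hx, eqg x hx]
      simp only [hAd _ x hx]
      simp only [Fin.sum_univ_three] at dU dB ⊢
      linear_combination ψ x * q x * dU - ψ x * f x * g x * dB
    · simp [image_eq_zero_of_notMem_tsupport fun h => hx (hs h)]
  have step2 : ∀ l, ∫ x, pdx l ψ x * A l x = (∫ x, pdx l ψ x * pdx l q x)
      - (∫ x, pdx l ψ x * (U l x * q x)) + ∫ x, pdx l ψ x * (B l x * (f x * g x)) := by
    intro l
    have i1 : Integrable fun x => pdx l ψ x * pdx l q x - pdx l ψ x * (U l x * q x) :=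
      (iq l).sub (iU l)
    rw [← integral_sub (iq l) (iU l), ← integral_add i1 (iB l)]
    congr 1 with x
    by_cases hx : x ∈ V
    · rw [hqd l x hx, hA]
      ring
    · simp [image_eq_zero_of_notMem_tsupport fun h => hx (sψ l h)]
  have step3 : ∫ x, (∑ l, pdx l (pdx l ψ) x) * q x = ∑ l, ∫ x, pdx l (pdx l ψ) x * q x := by
    simp only [Finset.sum_mul]
    exact integral_finsetSum _ fun l _ => icdd l _ hqs.continuousOn
  rw [step1, step3, integral_finsetSum _ fun l _ => iU l, integral_finsetSum _ fun l _ => iB l]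
  simp only [p1, step2, p2, Fin.sum_univ_three]
  ring

end

/-! ### Dilations of a radial kernel -/

/-- A radial potential `H` supported in the unit ball whose gradient is `y ↦ g y • y`. The dilations
`s ↦ s⁻³ g (·/s)` then move by Laplacians of dilations of `H`. -/
theorem exists_radial_kernel : ∃ H g : E3 → ℝ, ContDiff ℝ ∞ H ∧ ContDiff ℝ ∞ g ∧
    (∀ y, 1 ≤ ‖y‖ → H y = 0) ∧ (∀ y, 1 ≤ ‖y‖ → g y = 0) ∧
    (∀ k y, pdx k H y = y k * g y) ∧ 0 < ∫ y, g y := by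
  have hst : ContDiff ℝ ∞ Real.smoothTransition := Real.smoothTransition.contDiff
  have hst' : ContDiff ℝ ∞ (deriv Real.smoothTransition) :=
    hst.iterate_deriv 1
  have hn : ContDiff ℝ ∞ fun y : E3 => ‖y‖ ^ 2 := contDiff_norm_sq ℝ
  set g : E3 → ℝ := fun y => 2 * deriv Real.smoothTransition (‖y‖ ^ 2) with hg
  have hgs : ContDiff ℝ ∞ g := contDiff_const.mul (hst'.comp hn)
  have hg0 : ∀ y, 1 ≤ ‖y‖ → g y = 0 := by
    intro y hy
    have h1 : (1 : ℝ) ≤ ‖y‖ ^ 2 := one_le_pow₀ hy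
    have h2 : IsLocalMax Real.smoothTransition (‖y‖ ^ 2) :=
      Filter.Eventually.of_forall fun z => by
        rw [Real.smoothTransition.one_of_one_le h1]
        exact Real.smoothTransition.le_one z
    simp [hg, h2.deriv_eq_zero]
  have hgnn : 0 ≤ g := fun y =>
    mul_nonneg zero_le_two Real.smoothTransition.monotone.deriv_nonneg
  refine ⟨fun y => Real.smoothTransition (‖y‖ ^ 2) - 1, g, (hst.comp hn).sub contDiff_const, hgs,
    fun y hy => by simp [Real.smoothTransition.one_of_one_le (one_le_pow₀ hy)], hg0, ?_, ?_⟩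
  · intro k y
    have h1 : HasFDerivAt (fun y : E3 => ‖y‖ ^ 2) (2 • innerSL ℝ y) y :=
      (hasStrictFDerivAt_norm_sq y).hasFDerivAt
    have h2 := ((hst.differentiable (by simp) (‖y‖ ^ 2)).hasDerivAt.comp_hasFDerivAt y h1).sub_const
      (1 : ℝ)
    rw [pdx]
    have h3 : fderiv ℝ (fun y : E3 => Real.smoothTransition (‖y‖ ^ 2) - 1) y = _ := h2.fderiv
    rw [h3, hg]
    have h4 : inner ℝ y (e k) = y k := by simp [e, EuclideanSpace.inner_single_right]
    simp [h4]
    ring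
  · obtain ⟨s, hs, hds⟩ := exists_deriv_eq_slope Real.smoothTransition zero_lt_one
      hst.continuous.continuousOn (hst.differentiable (by simp)).differentiableOn
    rw [Real.smoothTransition.one_of_one_le le_rfl, Real.smoothTransition.zero_of_nonpos le_rfl]
      at hds
    refine hgs.continuous.integral_pos_of_hasCompactSupport_nonneg_nonzero
      (x := EuclideanSpace.single 0 (√s)) ?_ hgnn ?_
    · refine HasCompactSupport.intro (isCompact_closedBall (0 : E3) 1) fun y hy => hg0 y ?_
      simp only [mem_closedBall, dist_zero_right, not_le] at hy
      exact hy.le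
    · simp [hg, Real.sq_sqrt hs.1.le, hds]

/-- The function `f` transported to the ball of centre `x` and radius `s`. -/
def resc (f : E3 → ℝ) (x : E3) (s : ℝ) (y : E3) : ℝ := f (s⁻¹ • (y - x))

section Resc

variable {f : E3 → ℝ} {x : E3} {s : ℝ}

theorem contDiff_resc (hf : ContDiff ℝ ∞ f) : ContDiff ℝ ∞ (resc f x s) :=
  hf.comp ((contDiff_id.sub contDiff_const).const_smul s⁻¹)

theorem pdx_resc (hf : ContDiff ℝ ∞ f) (k : Fin 3) (y : E3) :
    pdx k (resc f x s) y = s⁻¹ * resc (pdx k f) x s y := by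
  have h1 : HasFDerivAt (fun y : E3 => s⁻¹ • (y - x)) (s⁻¹ • ContinuousLinearMap.id ℝ E3) y :=
    ((hasFDerivAt_id y).sub_const x).const_smul s⁻¹
  have h2 := ((hf.differentiable (by simp) (s⁻¹ • (y - x))).hasFDerivAt.comp y h1).fderiv
  rw [pdx]
  refine (congrArg (fun L : E3 →L[ℝ] ℝ => L (e k)) h2).trans ?_
  simp [resc, pdx]

theorem resc_eq_zero (hf : ∀ y, 1 ≤ ‖y‖ → f y = 0) (hs : 0 < s) {y : E3}
    (hy : y ∉ closedBall x s) : resc f x s y = 0 := by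
  refine hf _ ?_
  rw [mem_closedBall, not_le, dist_eq_norm] at hy
  rw [norm_smul, norm_inv, Real.norm_of_nonneg hs.le, ← div_eq_inv_mul, one_le_div hs]
  exact hy.le

theorem hasCompactSupport_resc (hf : ∀ y, 1 ≤ ‖y‖ → f y = 0) (hs : 0 < s) :
    HasCompactSupport (resc f x s) :=
  HasCompactSupport.intro (isCompact_closedBall x s) fun _ hy => resc_eq_zero hf hs hy

theorem integral_resc (hs : 0 < s) : ∫ y, resc f x s y = s ^ 3 * ∫ y, f y := by
  have h1 := integral_sub_right_eq_self (μ := (volume : Measure E3)) (fun y => f (s⁻¹ • y)) x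
  have h2 := Measure.integral_comp_inv_smul_of_nonneg (volume : Measure E3) f hs.le
  simp only [finrank_euclideanSpace, Fintype.card_fin, smul_eq_mul] at h2
  exact h1.trans h2

/-- Derivatives of functions vanishing outside the open unit ball do so too. -/
theorem pdx_eq_zero_of_one_le (hf : ContDiff ℝ ∞ f) (h : ∀ y, 1 ≤ ‖y‖ → f y = 0) (k : Fin 3)
    (y : E3) (hy : 1 ≤ ‖y‖) : pdx k f y = 0 := by
  have hc : IsClosed {z : E3 | pdx k f z = 0} :=
    isClosed_eq (hf.pdx k).continuous continuous_const
  have hsub : {z : E3 | 1 < ‖z‖} ⊆ {z : E3 | pdx k f z = 0} := by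
    intro z hz
    have hO : IsOpen {z : E3 | 1 < ‖z‖} := isOpen_lt continuous_const continuous_norm
    have : pdx k f z = pdx k (fun _ => 0) z :=
      pdx_congr k hO (fun w (hw : 1 < ‖w‖) => h w hw.le) hz
    simpa [pdx] using this
  refine closure_minimal hsub hc ?_
  rw [mem_closure_iff_seq_limit]
  refine ⟨fun n : ℕ => (1 + 1 / ((n : ℝ) + 1)) • y, fun n => ?_, ?_⟩
  · have : (0 : ℝ) < 1 / ((n : ℝ) + 1) := by positivity
    rw [mem_ofPred_eq, norm_smul, Real.norm_of_nonneg (by positivity)]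
    nlinarith
  · have h1 := (tendsto_one_div_add_atTop_nhds_zero_nat (𝕜 := ℝ)).const_add 1
    simpa using h1.smul_const y

end Resc

theorem exists_bound_of_vanishing {f : E3 → ℝ} (hf : Continuous f) (h : ∀ y, 1 ≤ ‖y‖ → f y = 0) :
    ∃ C : ℝ, 0 < C ∧ ∀ y, |f y| ≤ C := by
  obtain ⟨C, hC⟩ := (isCompact_closedBall (0 : E3) 1).exists_bound_of_continuousOn hf.continuousOn
  refine ⟨max C 1, by positivity, fun y => ?_⟩
  by_cases hy : 1 ≤ ‖y‖
  · simp [h y hy]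
  · exact (hC y (by simpa using (not_le.1 hy).le)).trans (le_max_left _ _)

theorem integral_closedBall_le {w : E3 → ℝ} (hw : MemLp w 2 volume) (x : E3) {s : ℝ} (hs : 0 ≤ s) :
    ∫ y in closedBall x s, |w y|
      ≤ √(s ^ 3 * volume.real (ball (0 : E3) 1)) * √(∫ y, w y ^ 2) := by
  have hm : MeasurableSet (closedBall x s) := isClosed_closedBall.measurableSet
  have hi : MemLp ((closedBall x s).indicator fun _ => (1 : ℝ)) 2 volume :=
    memLp_indicator_const 2 hm 1 (Or.inr measure_closedBall_lt_top.ne)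
  have h := integral_abs_mul_le_sqrt hi hw
  have e1 : ∀ y, |(closedBall x s).indicator (fun _ => (1 : ℝ)) y| * |w y|
      = (closedBall x s).indicator (fun y => |w y|) y := by
    intro y; by_cases hy : y ∈ closedBall x s <;> simp [hy]
  have e2 : ∀ y, (closedBall x s).indicator (fun _ => (1 : ℝ)) y ^ 2
      = (closedBall x s).indicator (fun _ => (1 : ℝ)) y := by
    intro y; by_cases hy : y ∈ closedBall x s <;> simp [hy]
  simp only [e1, e2] at h
  rw [integral_indicator hm, integral_indicator hm] at h
  have e3 := Measure.addHaar_real_closedBall (volume : Measure E3) x hs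
  simp only [finrank_euclideanSpace, Fintype.card_fin] at e3
  simpa [e3] using h

/-- Integrating a bound `s^{-1/2}` at small scales and `s^{-5/2}` at large ones. -/
theorem abs_limit_le_of_deriv_scale_bound {f f' : ℝ → ℝ} {α γ r c : ℝ} (hr : 0 < r)
    (hf : ∀ s, 0 < s → HasDerivAt f (f' s) s)
    (h1 : ∀ s, 0 < s → s < r → |f' s| ≤ α * s ^ (-1 / 2 : ℝ))
    (h2 : ∀ s, r ≤ s → |f' s| ≤ γ * s ^ (-5 / 2 : ℝ))
    (hα : 0 ≤ α) (hγ : 0 ≤ γ)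
    (hinf : Filter.Tendsto f Filter.atTop (nhds 0))
    (h0 : Filter.Tendsto f (nhdsWithin 0 (Ioi 0)) (nhds c)) :
    |c| ≤ 2 * α * r ^ (1 / 2 : ℝ) + γ * r ^ (-3 / 2 : ℝ) := by
  have cont : ∀ a b, 0 < a → ContinuousOn f (Icc a b) := fun a b ha x hx =>
    (hf x (ha.trans_le hx.1)).continuousAt.continuousWithinAt
  have near : ∀ ε, 0 < ε → ε < r → |f r - f ε| ≤ 2 * α * r ^ (1 / 2 : ℝ) := by
    intro ε hε hεr
    have key := image_norm_le_of_norm_deriv_right_le_deriv_boundary' (f := fun s => f s - f ε)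
      (f' := f') (a := ε) (b := r) ((cont ε r hε).sub continuousOn_const)
      (fun s hs => ((hf s (hε.trans_le hs.1)).sub_const _).hasDerivWithinAt)
      (B := fun s => 2 * α * (s ^ (1 / 2 : ℝ) - ε ^ (1 / 2 : ℝ)))
      (B' := fun s => 2 * α * (1 / 2 * s ^ (1 / 2 - 1 : ℝ)))
      (by simp) ?_ ?_ ?_ (right_mem_Icc.2 hεr.le)
    · have : 0 ≤ 2 * α * ε ^ (1 / 2 : ℝ) := by positivity
      simp only [Real.norm_eq_abs, mul_sub] at key
      linarith
    · exact continuousOn_const.mul ((continuousOn_id.rpow_const fun s _ =>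
        Or.inr (by norm_num)).sub continuousOn_const)
    · intro s hs
      exact (((Real.hasDerivAt_rpow_const (Or.inl (hε.trans_le hs.1).ne')).sub_const
        _).const_mul _).hasDerivWithinAt
    · intro s hs
      refine (h1 s (hε.trans_le hs.1) hs.2).trans (le_of_eq ?_)
      norm_num
      ring
  have far : ∀ N, r ≤ N → |f N - f r| ≤ γ * r ^ (-3 / 2 : ℝ) := by
    intro N hN
    have key := image_norm_le_of_norm_deriv_right_le_deriv_boundary' (f := fun s => f s - f r)
      (f' := f') (a := r) (b := N) ((cont r N hr).sub continuousOn_const)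
      (fun s hs => ((hf s (hr.trans_le hs.1)).sub_const _).hasDerivWithinAt)
      (B := fun s => γ * (r ^ (-3 / 2 : ℝ) - s ^ (-3 / 2 : ℝ)))
      (B' := fun s => γ * (- ((-3 / 2) * s ^ (-3 / 2 - 1 : ℝ))))
      (by simp) ?_ ?_ ?_ (right_mem_Icc.2 hN)
    · have : 0 ≤ γ * N ^ (-3 / 2 : ℝ) := mul_nonneg hγ (Real.rpow_nonneg (hr.le.trans hN) _)
      simp only [Real.norm_eq_abs, mul_sub] at key
      linarith
    · exact continuousOn_const.mul (continuousOn_const.sub (continuousOn_id.rpow_const fun s hs =>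
        Or.inl (hr.trans_le hs.1).ne'))
    · intro s hs
      exact (((Real.hasDerivAt_rpow_const (Or.inl (hr.trans_le hs.1).ne')).const_sub
        _).const_mul _).hasDerivWithinAt
    · intro s hs
      refine (h2 s hs.1).trans ?_
      have h3 : 0 ≤ γ * s ^ (-5 / 2 : ℝ) := mul_nonneg hγ (Real.rpow_nonneg (hr.le.trans hs.1) _)
      have e : (-3 / 2 - 1 : ℝ) = -5 / 2 := by norm_num
      rw [e]
      linarith
  have A1 : |f r| ≤ γ * r ^ (-3 / 2 : ℝ) := by
    have t1 : Filter.Tendsto (fun N => |f N - f r|) Filter.atTop (nhds |0 - f r|) :=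
      (hinf.sub_const _).abs
    have := le_of_tendsto t1 (Filter.eventually_atTop.2 ⟨r, far⟩)
    simpa using this
  have A2 : |f r - c| ≤ 2 * α * r ^ (1 / 2 : ℝ) := by
    have t1 : Filter.Tendsto (fun ε => |f r - f ε|) (nhdsWithin 0 (Ioi 0)) (nhds |f r - c|) :=
      (h0.const_sub _).abs
    refine le_of_tendsto t1 ?_
    filter_upwards [Ioo_mem_nhdsGT hr] with ε hε using near ε hε.1 hε.2
  have := abs_sub_abs_le_abs_sub c (f r)
  rw [abs_sub_comm] at this
  linarith

/-- Twice the antisymmetric part of a gradient, `∂_l f_i - ∂_i f_l`. -/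
def asy (L : E3 →L[ℝ] E3) (l i : Fin 3) : ℝ := (L (e l)) i - (L (e i)) l

theorem abs_asy_le (L : E3 →L[ℝ] E3) (l i : Fin 3) : |asy L l i| ≤ ‖curlL L‖ := by
  have h0 := PiLp.norm_apply_le (curlL L) 0
  have h1 := PiLp.norm_apply_le (curlL L) 1
  have h2 := PiLp.norm_apply_le (curlL L) 2
  have hn := norm_nonneg (curlL L)
  simp only [curlL, Real.norm_eq_abs, PiLp.toLp_apply, Matrix.cons_val] at h0 h1 h2
  fin_cases l <;> fin_cases i <;> simp only [asy, Fin.mk_zero, Fin.mk_one,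
    Fin.reduceFinMk, sub_self, abs_zero, hn] <;> first | exact h0 | exact h1 | exact h2 | skip
  all_goals rw [abs_sub_comm]; first | exact h0 | exact h1 | exact h2

theorem curlL_sub (L K : E3 →L[ℝ] E3) : curlL (L - K) = curlL L - curlL K := by
  ext i
  fin_cases i <;> simp [curlL] <;> ring

theorem asy_sub (L K : E3 →L[ℝ] E3) (l i : Fin 3) : asy (L - K) l i = asy L l i - asy K l i := by
  simp only [asy, sub_apply, PiLp.sub_apply]
  ring

theorem continuous_curlL : Continuous curlL := by
  refine (PiLp.continuous_toLp 2 _).comp (continuous_pi fun i => ?_)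
  have h : ∀ l k : Fin 3, Continuous fun L : E3 →L[ℝ] E3 => (L (e l)) k := fun l k => by fun_prop
  fin_cases i <;> exact (h _ _).sub (h _ _)

theorem norm_e (k : Fin 3) : ‖e k‖ = 1 := by simp [e]

theorem abs_apply_le_norm (L : E3 →L[ℝ] E3) (l k : Fin 3) : |(L (e l)) k| ≤ ‖L‖ := by
  refine (PiLp.norm_apply_le (L (e l)) k).trans ?_
  simpa [norm_e] using L.le_opNorm (e l)

theorem norm_curlL_le (L : E3 →L[ℝ] E3) : ‖curlL L‖ ≤ 6 * ‖L‖ := by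
  have h := abs_apply_le_norm L
  have hb : ∀ a b c d : Fin 3, |(L (e a)) b - (L (e c)) d| ≤ 2 * ‖L‖ := fun a b c d =>
    (abs_sub _ _).trans (by linarith [h a b, h c d])
  have hn : ‖curlL L‖ ^ 2 ≤ (6 * ‖L‖) ^ 2 := by
    rw [EuclideanSpace.norm_sq_eq, Fin.sum_univ_three]
    simp only [curlL, Real.norm_eq_abs, PiLp.toLp_apply, Matrix.cons_val]
    have hs : ∀ a b c d : Fin 3, |(L (e a)) b - (L (e c)) d| ^ 2 ≤ (2 * ‖L‖) ^ 2 :=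
      fun a b c d => pow_le_pow_left₀ (abs_nonneg _) (hb a b c d) 2
    nlinarith [hs 1 2 2 1, hs 2 0 0 2, hs 0 1 1 0, sq_nonneg ‖L‖]
  exact le_of_sq_le_sq hn (by positivity)

theorem memLp_curlL {A : E3 → E3 →L[ℝ] E3} (hA : MemLp A 2 volume) :
    MemLp (fun y => curlL (A y)) 2 volume :=
  (hA.norm.const_mul 6).mono' (continuous_curlL.comp_aestronglyMeasurable hA.1)
    (Filter.Eventually.of_forall fun y => norm_curlL_le (A y))

/-! ### A pointwise bound on a gradient by the curl -/

section

variable {v : E3 → E3} {A : E3 → E3 →L[ℝ] E3}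

theorem memLp_coord (hv : MemLp v 2 volume) (i : Fin 3) : MemLp (fun y => v y i) 2 volume :=
  hv.norm.mono' ((by fun_prop : Continuous fun w : E3 => w i).comp_aestronglyMeasurable hv.1)
    (Filter.Eventually.of_forall fun y => PiLp.norm_apply_le (v y) i)

theorem memLp_gradient_coord (hA : MemLp A 2 volume) (l i : Fin 3) :
    MemLp (fun y => (A y (e l)) i) 2 volume :=
  hA.norm.mono' ((by fun_prop : Continuous fun L : E3 →L[ℝ] E3 => (L (e l)) i)
    |>.comp_aestronglyMeasurable hA.1)
    (Filter.Eventually.of_forall fun y => abs_apply_le_norm (A y) l i)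

theorem integrable_test_mul {χ w : E3 → ℝ} (hχ : Continuous χ) (hc : HasCompactSupport χ)
    (hw : MemLp w 2 volume) : Integrable fun y => χ y * w y := by
  have h : MemLp χ 2 volume := hχ.memLp_of_hasCompactSupport hc
  exact h.integrable_mul hw

/-- The weak gradient in components. -/
theorem HasWeakGradient.coord (h : HasWeakGradient v A) (hv : MemLp v 2 volume)
    (hA : MemLp A 2 volume) {χ : E3 → ℝ} (hχ : ContDiff ℝ ∞ χ) (hc : HasCompactSupport χ)
    (l i : Fin 3) : ∫ y, pdx l χ y * v y i = - ∫ y, χ y * (A y (e l)) i := by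
  have hi1 : Integrable fun y => pdx l χ y • v y := by
    have h2 : MemLp (pdx l χ) 2 volume := (hχ.pdx l).continuous.memLp_of_hasCompactSupport
      (hc.fderiv_apply ℝ (e l))
    exact memLp_one_iff_integrable.1 (hv.smul h2)
  have hi2 : Integrable fun y => χ y • A y (e l) := by
    have h2 : MemLp χ 2 volume := hχ.continuous.memLp_of_hasCompactSupport hc
    have h3 : MemLp (fun y => A y (e l)) 2 volume :=
      hA.norm.mono' ((by fun_prop : Continuous fun L : E3 →L[ℝ] E3 => L (e l))
        |>.comp_aestronglyMeasurable hA.1) (Filter.Eventually.of_forall fun y => by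
          simpa [norm_e] using (A y).le_opNorm (e l))
    exact memLp_one_iff_integrable.1 (h3.smul h2)
  have h0 := congrArg (EuclideanSpace.proj (𝕜 := ℝ) i) (h χ hχ hc (e l))
  rw [map_neg, ← ContinuousLinearMap.integral_comp_comm _ hi2] at h0
  change (EuclideanSpace.proj (𝕜 := ℝ) i) (∫ y, pdx l χ y • v y) = _ at h0
  rw [← ContinuousLinearMap.integral_comp_comm _ hi1] at h0
  simpa using h0

/-- For a weakly divergence-free field, `Δ v_i = ∂_l (∂_l v_i - ∂_i v_l)`, tested against a
derivative. -/
theorem HasWeakGradient.integral_laplacian (h : HasWeakGradient v A) (hv : MemLp v 2 volume)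
    (hA : MemLp A 2 volume) (hdiv : ∀ χ : E3 → ℝ, ContDiff ℝ ∞ χ → HasCompactSupport χ →
      ∫ y, ∑ l, pdx l χ y * v y l = 0)
    {χ : E3 → ℝ} (hχ : ContDiff ℝ ∞ χ) (hc : HasCompactSupport χ) (k i : Fin 3) :
    ∑ l, ∫ y, pdx l (pdx l (pdx k χ)) y * v y i
      = - ∑ l, ∫ y, pdx l (pdx k χ) y * asy (A y) l i := by
  have hcd : ∀ {f : E3 → ℝ}, HasCompactSupport f → ∀ l, HasCompactSupport (pdx l f) :=
    fun hf l => hf.fderiv_apply ℝ (e l)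
  have i1 : ∀ l a b, Integrable fun y => pdx l (pdx k χ) y * (A y (e a)) b := fun l a b =>
    integrable_test_mul ((hχ.pdx k).pdx l).continuous (hcd (hcd hc k) l)
      (memLp_gradient_coord hA a b)
  have h1 : ∀ l, ∫ y, pdx l (pdx k χ) y * asy (A y) l i
      = (∫ y, pdx l (pdx k χ) y * (A y (e l)) i) - ∫ y, pdx l (pdx k χ) y * (A y (e i)) l := by
    intro l
    rw [← integral_sub (i1 l l i) (i1 l i l)]
    congr 1 with y
    rw [asy]; ring
  have h2 : ∀ l, ∫ y, pdx l (pdx k χ) y * (A y (e l)) i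
      = - ∫ y, pdx l (pdx l (pdx k χ)) y * v y i := fun l => by
    rw [h.coord hv hA ((hχ.pdx k).pdx l) (hcd (hcd hc k) l), neg_neg]
  have hcomm : ∀ l y, pdx i (pdx l (pdx k χ)) y = pdx l (pdx i (pdx k χ)) y := fun l y =>
    pdx_comm isOpen_univ (hχ.pdx k).contDiffOn (mem_univ y) i l
  have h3 : ∀ l, ∫ y, pdx l (pdx k χ) y * (A y (e i)) l
      = - ∫ y, pdx l (pdx i (pdx k χ)) y * v y l := fun l => by
    simp only [← hcomm]
    rw [h.coord hv hA ((hχ.pdx k).pdx l) (hcd (hcd hc k) l), neg_neg]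
  have h4 : ∑ l, ∫ y, pdx l (pdx i (pdx k χ)) y * v y l = 0 := by
    rw [← hdiv _ ((hχ.pdx k).pdx i) (hcd (hcd hc k) i)]
    refine (integral_finsetSum _ fun l _ => ?_).symm
    exact integrable_test_mul (((hχ.pdx k).pdx i).pdx l).continuous
      (hcd (hcd (hcd hc k) i) l) (memLp_coord hv l)
  simp only [h1, h2, h3, Finset.sum_sub_distrib, Finset.sum_neg_distrib, h4]
  ring

/-- The derivative in the scale of the rescaled kernel `s⁻⁴ p((y-x)/s)` tested against an `L²`
function. -/
theorem hasDerivAt_scale {p : E3 → ℝ} (hp : ContDiff ℝ ∞ p) (hp0 : ∀ y, 1 ≤ ‖y‖ → p y = 0)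
    {w : E3 → ℝ} (hw : MemLp w 2 volume) (x : E3) {s : ℝ} (hs : 0 < s) :
    HasDerivAt (fun s => ∫ y, (s ^ 4)⁻¹ * resc p x s y * w y)
      (∫ y, -((s ^ 5)⁻¹ * resc (fun z => 4 * p z + ∑ l, z l * pdx l p z) x s y * w y)) s := by
  set q : E3 → ℝ := fun z => 4 * p z + ∑ l, z l * pdx l p z with hq
  have hzc : ∀ l : Fin 3, ContDiff ℝ ∞ fun z : E3 => z l := fun l =>
    (EuclideanSpace.proj (𝕜 := ℝ) l).contDiff
  have hqs : ContDiff ℝ ∞ q :=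
    (contDiff_const.mul hp).add (ContDiff.sum fun l _ => (hzc l).mul (hp.pdx l))
  have hq0 : ∀ y, 1 ≤ ‖y‖ → q y = 0 := fun y hy => by
    simp [hq, hp0 y hy, pdx_eq_zero_of_one_le hp hp0 _ y hy]
  obtain ⟨C, hC0, hC⟩ := exists_bound_of_vanishing hqs.continuous hq0
  have hint : ∀ f : E3 → ℝ, ContDiff ℝ ∞ f → (∀ y, 1 ≤ ‖y‖ → f y = 0) → ∀ c τ : ℝ, 0 < τ →
      Integrable fun y => c * resc f x τ y * w y := fun f hf hf0 c τ hτ => by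
    simp only [mul_assoc]
    exact (integrable_test_mul (contDiff_resc hf).continuous (hasCompactSupport_resc hf0 hτ)
      hw).const_mul c
  have hbi : Integrable fun y => (((s / 2) ^ 5)⁻¹ * C) *
      (closedBall x (2 * s)).indicator (fun y => |w y|) y := by
    refine Integrable.const_mul ?_ _
    rw [integrable_indicator_iff isClosed_closedBall.measurableSet]
    have : IsFiniteMeasure (volume.restrict (closedBall x (2 * s))) :=
      ⟨by rw [Measure.restrict_apply_univ]; exact measure_closedBall_lt_top⟩
    exact ((hw.restrict _).integrable (by norm_num)).abs
  refine (hasDerivAt_integral_of_dominated_loc_of_deriv_le (s := Ioo (s / 2) (2 * s))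
    (F := fun s y => (s ^ 4)⁻¹ * resc p x s y * w y)
    (F' := fun s y => -((s ^ 5)⁻¹ * resc q x s y * w y))
    (Ioo_mem_nhds (by linarith) (by linarith)) ?_ (hint p hp hp0 _ s hs)
    (hint q hqs hq0 _ s hs).neg.aestronglyMeasurable ?_ hbi ?_).2
  · filter_upwards [isOpen_Ioi.mem_nhds hs] with τ hτ
    exact (hint p hp hp0 _ τ hτ).aestronglyMeasurable
  · refine Filter.Eventually.of_forall fun y τ hτ => ?_
    have hτ0 : 0 < τ := by linarith [hτ.1]
    by_cases hy : y ∈ closedBall x (2 * s)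
    · rw [norm_neg, norm_mul, norm_mul, indicator_of_mem hy, norm_inv, norm_pow,
        Real.norm_of_nonneg hτ0.le]
      refine mul_le_mul_of_nonneg_right ?_ (abs_nonneg _)
      refine mul_le_mul ?_ (hC _) (abs_nonneg _) (by positivity)
      exact inv_anti₀ (by positivity) (pow_le_pow_left₀ (by positivity) hτ.1.le 5)
    · rw [resc_eq_zero hq0 hτ0 fun h => hy (closedBall_subset_closedBall hτ.2.le h),
        indicator_of_notMem hy]
      simp
  · refine Filter.Eventually.of_forall fun y τ hτ => ?_
    have hτ0 : τ ≠ 0 := by linarith [hτ.1]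
    have d1 : HasDerivAt (fun τ : ℝ => τ⁻¹ • (y - x)) (-(τ ^ 2)⁻¹ • (y - x)) τ :=
      (hasDerivAt_inv hτ0).smul_const (y - x)
    have d2 := (hp.differentiable (by simp) (τ⁻¹ • (y - x))).hasFDerivAt.comp_hasDerivAt τ d1
    have d3 : HasDerivAt (fun τ : ℝ => (τ ^ 4)⁻¹) (-(4 * τ ^ 3) / (τ ^ 4) ^ 2) τ := by
      simpa using (hasDerivAt_pow 4 τ).fun_inv (pow_ne_zero 4 hτ0)
    have d4 := (d3.mul d2).mul_const (w y)
    refine d4.congr_deriv ?_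
    have e1 : fderiv ℝ p (τ⁻¹ • (y - x)) (-(τ ^ 2)⁻¹ • (y - x))
        = -τ⁻¹ * ∑ l, (τ⁻¹ • (y - x)) l * pdx l p (τ⁻¹ • (y - x)) := by
      rw [← fderiv_eq_sum_pdx, ← smul_eq_mul, ← map_smul]
      congr 1
      rw [smul_smul]
      congr 1
      field_simp
    simp only [e1, resc, hq]
    simp only [Function.comp_apply]
    field_simp
    ring

/-- The pointwise value of the gradient of an `L²` divergence-free field is controlled by its curl:
near the point through a Hölder-type modulus, away from it through the `L²` norm. -/
theorem exists_gradient_bound : ∃ C : ℝ, 0 < C ∧ ∀ (v : E3 → E3) (A : E3 → E3 →L[ℝ] E3) (x : E3)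
    (r a : ℝ), 0 < r → 0 ≤ a → MemLp v 2 volume → MemLp A 2 volume → HasWeakGradient v A →
    (∀ χ : E3 → ℝ, ContDiff ℝ ∞ χ → HasCompactSupport χ → ∫ y, ∑ l, pdx l χ y * v y l = 0) →
    ContinuousAt A x →
    (∀ᵐ y, y ∈ ball x r → ‖curlL (A y) - curlL (A x)‖ ≤ a * ‖y - x‖ ^ (1 / 2 : ℝ)) →
    ∀ k i, |(A x (e k)) i|
      ≤ C * (a * r ^ (1 / 2 : ℝ) + r ^ (-3 / 2 : ℝ) * √(∫ y, ‖curlL (A y)‖ ^ 2)) := by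
  obtain ⟨H, g, hH, hg, hH0, hg0, hHg, hpos⟩ := exists_radial_kernel
  have hgH0 := fun k => pdx_eq_zero_of_one_le hH hH0 k
  have hlk0 := fun l k => pdx_eq_zero_of_one_le (hH.pdx k) (hgH0 k) l
  have hp0 := fun k => pdx_eq_zero_of_one_le hg hg0 k
  choose Cp hCp0 hCp using fun k => exists_bound_of_vanishing (hg.pdx k).continuous (hp0 k)
  obtain ⟨Cg, hCg0, hCg⟩ := exists_bound_of_vanishing hg.continuous hg0
  choose D hD0 hD using fun l k => exists_bound_of_vanishing ((hH.pdx k).pdx l).continuous (hlk0 l k)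
  set V := volume.real (ball (0 : E3) 1) with hV
  have hVpos : 0 ≤ V := measureReal_nonneg
  set cg := ∫ y, g y with hcg
  set K := ∑ k, ∑ l, D l k with hK
  have hKk : ∀ k, ∑ l, D l k ≤ K := fun k =>
    Finset.single_le_sum (f := fun k => ∑ l, D l k)
      (fun k _ => Finset.sum_nonneg fun l _ => (hD0 l k).le) (Finset.mem_univ k)
  have hK0 : 0 ≤ K := Finset.sum_nonneg fun k _ => Finset.sum_nonneg fun l _ => (hD0 l k).le
  refine ⟨(2 * K * V + K * √V + 1) / cg, by positivity, ?_⟩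
  intro v A x r a hr ha hv hA hw hdiv hcont hnear k i
  set W := √(∫ y, ‖curlL (A y)‖ ^ 2) with hW
  have hW0 : 0 ≤ W := Real.sqrt_nonneg _
  have hcurl := memLp_curlL hA
  -- the Laplacian of the gradient of `H` is the scale derivative of the kernel
  have hkey : ∀ z, 4 * pdx k g z + ∑ l, z l * pdx l (pdx k g) z
      = ∑ l, pdx l (pdx l (pdx k H)) z := by
    intro z
    have hzl : ∀ l : Fin 3, ContDiff ℝ ∞ fun z : E3 => z l := fun l =>
      (EuclideanSpace.proj (𝕜 := ℝ) l).contDiff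
    have hdz : ∀ m l : Fin 3, ∀ z : E3, pdx m (fun z : E3 => z l) z = if m = l then 1 else 0 := by
      intro m l z
      have : fderiv ℝ (fun z : E3 => z l) z = EuclideanSpace.proj (𝕜 := ℝ) l :=
        (EuclideanSpace.proj (𝕜 := ℝ) l).hasFDerivAt.fderiv
      rw [pdx, this]
      simp [e, eq_comm]
    have hU := isOpen_univ (X := E3)
    have dg : ∀ z, DifferentiableAt ℝ g z := fun z => hg.differentiable (by simp) z
    have dgl : ∀ l z, DifferentiableAt ℝ (pdx l g) z := fun l z =>
      (hg.pdx l).differentiable (by simp) z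
    have dz : ∀ l : Fin 3, ∀ z : E3, DifferentiableAt ℝ (fun z : E3 => z l) z := fun l z =>
      (hzl l).differentiable (by simp) z
    have e1 : ∀ l z, pdx l (pdx l H) z = g z + z l * pdx l g z := by
      intro l z
      rw [show pdx l H = fun z => z l * g z from funext (hHg l), pdx_mul l (dz l z) (dg z), hdz]
      simp; ring
    have e2 : ∀ l, pdx l (pdx l (pdx k H)) z = pdx k (fun z => g z + z l * pdx l g z) z := by
      intro l
      rw [pdx_congr l hU (fun y _ => pdx_comm hU hH.contDiffOn (mem_univ y) l k) (mem_univ z),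
        pdx_comm hU (hH.pdx l).contDiffOn (mem_univ z) l k]
      exact pdx_congr k hU (fun y _ => e1 l y) (mem_univ z)
    have e3 : ∀ l, pdx l (pdx l (pdx k H)) z = pdx k g z + (z l * pdx l (pdx k g) z
        + pdx l g z * if k = l then 1 else 0) := by
      intro l
      rw [e2 l, pdx_add k (dg z) ((dz l z).fun_mul (dgl l z)), pdx_mul k (dz l z) (dgl l z), hdz,
        pdx_comm hU hg.contDiffOn (mem_univ z) k l]
    simp only [e3, Finset.sum_add_distrib]
    simp
    ring
  set f : ℝ → ℝ := fun s => - ∫ y, (s ^ 4)⁻¹ * resc (pdx k g) x s y * v y i with hf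
  set f' : ℝ → ℝ := fun s => (s ^ 5)⁻¹ * ∑ l, ∫ y, resc (pdx l (pdx l (pdx k H))) x s y * v y i
    with hf'
  have hHint : ∀ s, 0 < s → ∀ l, Integrable fun y =>
      resc (pdx l (pdx l (pdx k H))) x s y * v y i := fun s hs l =>
    integrable_test_mul (contDiff_resc (((hH.pdx k).pdx l).pdx l)).continuous
      (hasCompactSupport_resc (pdx_eq_zero_of_one_le ((hH.pdx k).pdx l) (hlk0 l k) l) hs)
      (memLp_coord hv i)
  have hderiv : ∀ s, 0 < s → HasDerivAt f (f' s) s := by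
    intro s hs
    have h1 := (hasDerivAt_scale (hg.pdx k) (hp0 k) (memLp_coord hv i) x hs).neg
    refine h1.congr_deriv ?_
    simp only [hf']
    rw [integral_neg, neg_neg, ← integral_finsetSum _ fun l _ => hHint s hs l,
      ← integral_const_mul]
    congr 1 with y
    simp only [hkey, resc, Finset.sum_mul, mul_assoc]
  -- the derivative in terms of the curl
  have hasyint : ∀ s, 0 < s → ∀ l, ∀ c : ℝ, Integrable fun y =>
      resc (pdx l (pdx k H)) x s y * (asy (A y) l i - c) := by
    intro s hs l c
    have hc1 := (contDiff_resc (x := x) (s := s) ((hH.pdx k).pdx l)).continuous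
    have hc2 : HasCompactSupport (resc (pdx l (pdx k H)) x s) := hasCompactSupport_resc (hlk0 l k) hs
    simp only [mul_sub]
    refine Integrable.sub ?_ ((hc1.integrable_of_hasCompactSupport hc2).mul_const c)
    exact integrable_test_mul hc1 hc2 ((memLp_gradient_coord hA l i).sub
      (memLp_gradient_coord hA i l))
  have hrepr : ∀ s, 0 < s → ∀ L : E3 →L[ℝ] E3, f' s = - ((s ^ 4)⁻¹ * ∑ l,
      ∫ y, resc (pdx l (pdx k H)) x s y * (asy (A y) l i - asy L l i)) := by
    intro s hs L
    have hχ : ContDiff ℝ ∞ (resc H x s) := contDiff_resc hH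
    have hχc : HasCompactSupport (resc H x s) := hasCompactSupport_resc hH0 hs
    have h1 := hw.integral_laplacian hv hA hdiv hχ hχc k i
    have e1 : ∀ y, pdx k (resc H x s) y = s⁻¹ * resc (pdx k H) x s y := pdx_resc hH k
    have e2 : ∀ l y, pdx l (pdx k (resc H x s)) y = s⁻¹ ^ 2 * resc (pdx l (pdx k H)) x s y := by
      intro l y
      rw [show pdx k (resc H x s) = fun y => s⁻¹ * resc (pdx k H) x s y from funext e1,
        pdx_const_mul l _ ((contDiff_resc (hH.pdx k)).differentiable (by simp) y),
        pdx_resc (hH.pdx k)]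
      ring
    have e3 : ∀ l y, pdx l (pdx l (pdx k (resc H x s))) y
        = s⁻¹ ^ 3 * resc (pdx l (pdx l (pdx k H))) x s y := by
      intro l y
      rw [show pdx l (pdx k (resc H x s)) = fun y => s⁻¹ ^ 2 * resc (pdx l (pdx k H)) x s y from
        funext (e2 l),
        pdx_const_mul l _ ((contDiff_resc ((hH.pdx k).pdx l)).differentiable (by simp) y),
        pdx_resc ((hH.pdx k).pdx l)]
      ring
    simp only [e3, e2, mul_assoc, integral_const_mul, ← Finset.mul_sum] at h1
    have e4 : ∀ l, ∫ y, resc (pdx l (pdx k H)) x s y * (asy (A y) l i - asy L l i)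
        = ∫ y, resc (pdx l (pdx k H)) x s y * asy (A y) l i := by
      intro l
      have i1 := hasyint s hs l 0
      have i2 : Integrable fun y => resc (pdx l (pdx k H)) x s y * asy L l i :=
        ((contDiff_resc ((hH.pdx k).pdx l)).continuous.integrable_of_hasCompactSupport
          (hasCompactSupport_resc (hlk0 l k) hs)).mul_const _
      simp only [sub_zero] at i1
      simp only [mul_sub]
      -- second derivatives of the kernel have mean zero
      rw [integral_sub i1 i2, integral_mul_const, integral_resc hs,
        integral_pdx_eq_zero (hH.pdx k) (HasCompactSupport.intro (isCompact_closedBall (0 : E3) 1)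
          fun y hy => hgH0 k y (by simpa using (not_le.1 (by simpa using hy)).le)) l]
      simp
    simp only [e4, hf']
    have hs0 := hs.ne'
    field_simp at h1 ⊢
    linear_combination h1
  have hbound : ∀ s, 0 < s → ∀ L : E3 →L[ℝ] E3, ∀ I : ℝ, 0 ≤ I →
      (∫ y in closedBall x s, ‖curlL (A y) - curlL L‖) ≤ I → |f' s| ≤ (s ^ 4)⁻¹ * (K * I) := by
    intro s hs L I hI0 hI
    rw [hrepr s hs L, abs_neg, abs_mul, abs_of_pos (by positivity)]
    refine mul_le_mul_of_nonneg_left ?_ (by positivity)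
    refine (Finset.abs_sum_le_sum_abs _ _).trans ?_
    refine le_trans ?_ (mul_le_mul_of_nonneg_right (hKk k) hI0)
    rw [Finset.sum_mul]
    refine Finset.sum_le_sum fun l _ => ?_
    have hm : MeasurableSet (closedBall x s) := isClosed_closedBall.measurableSet
    have hfin : IsFiniteMeasure (volume.restrict (closedBall x s)) :=
      ⟨by rw [Measure.restrict_apply_univ]; exact measure_closedBall_lt_top⟩
    have hci : IntegrableOn (fun y => ‖curlL (A y) - curlL L‖) (closedBall x s) :=
      (((hcurl.restrict _).integrable (by norm_num)).sub (integrable_const _)).norm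
    refine (abs_integral_le_integral_abs).trans ?_
    refine le_trans ?_ (mul_le_mul_of_nonneg_left hI (hD0 l k).le)
    rw [← integral_const_mul, ← integral_indicator hm]
    have hci' : IntegrableOn (fun y => D l k * ‖curlL (A y) - curlL L‖) (closedBall x s) :=
      Integrable.const_mul hci _
    refine integral_mono (hasyint s hs l _).abs (hci'.integrable_indicator hm) fun y => ?_
    by_cases hy : y ∈ closedBall x s
    · simp only [indicator_of_mem hy, abs_mul]
      refine mul_le_mul (hD l k _) ?_ (abs_nonneg _) (hD0 l k).le
      rw [← asy_sub, ← curlL_sub]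
      exact abs_asy_le _ l i
    · simp only [indicator_of_notMem hy, resc_eq_zero (hlk0 l k) hs hy, zero_mul, abs_zero, le_refl]
  have vol : ∀ s, 0 ≤ s → volume.real (closedBall x s) = s ^ 3 * V := fun s hs => by
    simpa using Measure.addHaar_real_closedBall (volume : Measure E3) x hs
  have hsmall : ∀ s, 0 < s → s < r → |f' s| ≤ (K * V * a) * s ^ (-1 / 2 : ℝ) := by
    intro s hs hsr
    have h1 : (∫ y in closedBall x s, ‖curlL (A y) - curlL (A x)‖)
        ≤ a * s ^ (1 / 2 : ℝ) * (s ^ 3 * V) := by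
      rw [← vol s hs.le]
      refine (le_abs_self _).trans ?_
      rw [← Real.norm_eq_abs]
      refine norm_setIntegral_le_of_norm_le_const_ae measure_closedBall_lt_top ?_
      filter_upwards [ae_restrict_of_ae hnear,
        ae_restrict_mem isClosed_closedBall.measurableSet] with y hy hys
      rw [norm_norm]
      refine (hy (closedBall_subset_ball hsr hys)).trans (mul_le_mul_of_nonneg_left ?_ ha)
      exact Real.rpow_le_rpow (norm_nonneg _) (by simpa [dist_eq_norm] using hys) (by norm_num)
    refine (hbound s hs (A x) _ (by positivity) h1).trans (le_of_eq ?_)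
    have e1 : s ^ (-1 / 2 : ℝ) = s ^ (1 / 2 : ℝ) * s⁻¹ := by
      rw [← Real.rpow_neg_one s, ← Real.rpow_add hs]; norm_num
    rw [e1]
    field_simp
  have hlarge : ∀ s, r ≤ s → |f' s| ≤ (K * √V * W) * s ^ (-5 / 2 : ℝ) := by
    intro s hrs
    have hs := hr.trans_le hrs
    have h1 : (∫ y in closedBall x s, ‖curlL (A y) - curlL (0 : E3 →L[ℝ] E3)‖)
        ≤ √(s ^ 3 * V) * W := by
      have h0 : curlL (0 : E3 →L[ℝ] E3) = 0 := by
        simpa using curlL_sub (0 : E3 →L[ℝ] E3) 0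
      have h2 := integral_closedBall_le hcurl.norm x hs.le
      simp only [abs_norm] at h2
      simpa only [h0, sub_zero] using h2
    refine (hbound s hs 0 _ (by positivity) h1).trans (le_of_eq ?_)
    have e1 : √(s ^ 3 * V) = s ^ (3 / 2 : ℝ) * √V := by
      rw [Real.sqrt_mul (by positivity), Real.sqrt_eq_rpow (s ^ 3), ← Real.rpow_natCast s 3,
        ← Real.rpow_mul hs.le]
      norm_num
    have e2 : s ^ (-5 / 2 : ℝ) = s ^ (3 / 2 : ℝ) * (s ^ 4)⁻¹ := by
      rw [← Real.rpow_natCast s 4, ← Real.rpow_neg hs.le, ← Real.rpow_add hs]; norm_num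
    rw [e1, e2]
    ring
  have hinf : Filter.Tendsto f Filter.atTop (nhds 0) := by
    set N := √(∫ y, v y i ^ 2)
    have hN : ∀ s, 0 < s → ‖f s‖ ≤ Cp k * √V * N * s ^ (-(5 / 2) : ℝ) := by
      intro s hs
      have hm : MeasurableSet (closedBall x s) := isClosed_closedBall.measurableSet
      have hfin : IsFiniteMeasure (volume.restrict (closedBall x s)) :=
        ⟨by rw [Measure.restrict_apply_univ]; exact measure_closedBall_lt_top⟩
      have hvi : IntegrableOn (fun y => |v y i|) (closedBall x s) :=
        (((memLp_coord hv i).restrict _).integrable (by norm_num)).abs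
      have h1 : |∫ y, resc (pdx k g) x s y * v y i| ≤ Cp k * ∫ y in closedBall x s, |v y i| := by
        refine (abs_integral_le_integral_abs).trans ?_
        rw [← integral_const_mul, ← integral_indicator hm]
        have hvi' : IntegrableOn (fun y => Cp k * |v y i|) (closedBall x s) :=
          Integrable.const_mul hvi _
        refine integral_mono (integrable_test_mul (contDiff_resc (hg.pdx k)).continuous
          (hasCompactSupport_resc (hp0 k) hs) (memLp_coord hv i)).abs
          (hvi'.integrable_indicator hm) fun y => ?_
        by_cases hy : y ∈ closedBall x s
        · simp only [indicator_of_mem hy, abs_mul]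
          exact mul_le_mul_of_nonneg_right (hCp k _) (abs_nonneg _)
        · simp only [indicator_of_notMem hy, resc_eq_zero (hp0 k) hs hy, zero_mul, abs_zero,
            le_refl]
      have h2 := integral_closedBall_le (memLp_coord hv i) x hs.le
      have e1 : √(s ^ 3 * V) = s ^ (3 / 2 : ℝ) * √V := by
        rw [Real.sqrt_mul (by positivity), Real.sqrt_eq_rpow (s ^ 3), ← Real.rpow_natCast s 3,
          ← Real.rpow_mul hs.le]
        norm_num
      have e2 : s ^ (-(5 / 2) : ℝ) = s ^ (3 / 2 : ℝ) * (s ^ 4)⁻¹ := by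
        rw [← Real.rpow_natCast s 4, ← Real.rpow_neg hs.le, ← Real.rpow_add hs]; norm_num
      rw [hf]
      simp only [mul_assoc, integral_const_mul, norm_neg, norm_mul, norm_inv, norm_pow,
        Real.norm_of_nonneg hs.le]
      rw [e2]
      rw [e1] at h2
      have h3 := h1.trans (mul_le_mul_of_nonneg_left h2 (hCp0 k).le)
      refine (mul_le_mul_of_nonneg_left h3 (by positivity)).trans (le_of_eq ?_)
      ring
    refine squeeze_zero_norm' (Filter.eventually_atTop.2 ⟨1, fun s hs => hN s (by linarith)⟩) ?_
    simpa using (tendsto_rpow_neg_atTop (by norm_num : (0 : ℝ) < 5 / 2)).const_mul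
      (Cp k * √V * N)
  have hzero : Filter.Tendsto f (nhdsWithin 0 (Ioi 0)) (nhds ((A x (e k)) i * cg)) := by
    have hrep : ∀ s, 0 < s → f s - (A x (e k)) i * cg
        = (s ^ 3)⁻¹ * ∫ y, resc g x s y * ((A y (e k)) i - (A x (e k)) i) := by
      intro s hs
      have hc1 : Continuous (resc g x s) := (contDiff_resc hg).continuous
      have hc2 : HasCompactSupport (resc g x s) := hasCompactSupport_resc hg0 hs
      have h1 := hw.coord hv hA (contDiff_resc (x := x) (s := s) hg) hc2 k i
      simp only [pdx_resc hg, mul_assoc, integral_const_mul] at h1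
      simp only [mul_sub]
      rw [integral_sub (integrable_test_mul hc1 hc2 (memLp_gradient_coord hA k i))
        ((hc1.integrable_of_hasCompactSupport hc2).mul_const _), integral_mul_const,
        integral_resc hs, hf]
      simp only [mul_assoc, integral_const_mul]
      have hs0 := hs.ne'
      field_simp at h1 ⊢
      rw [mul_comm, h1]
      ring
    rw [Metric.tendsto_nhds]
    intro ε hε
    have hca : ContinuousAt (fun y => (A y (e k)) i) x :=
      (by fun_prop : Continuous fun L : E3 →L[ℝ] E3 => (L (e k)) i).continuousAt.comp hcont
    obtain ⟨d, hd0, hd⟩ := Metric.continuousAt_iff.1 hca (ε / (Cg * V + 1)) (by positivity)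
    filter_upwards [Ioo_mem_nhdsGT hd0] with s hs
    rw [Real.dist_eq, hrep s hs.1, abs_mul, abs_of_pos (by have := hs.1; positivity)]
    have h1 : |∫ y, resc g x s y * ((A y (e k)) i - (A x (e k)) i)|
        ≤ Cg * (ε / (Cg * V + 1)) * (s ^ 3 * V) := by
      rw [← vol s hs.1.le]
      have e1 : ∫ y, resc g x s y * ((A y (e k)) i - (A x (e k)) i)
          = ∫ y in closedBall x s, resc g x s y * ((A y (e k)) i - (A x (e k)) i) := by
        refine (setIntegral_eq_integral_of_forall_compl_eq_zero fun y hy => ?_).symm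
        rw [resc_eq_zero hg0 hs.1 hy, zero_mul]
      rw [e1, ← Real.norm_eq_abs]
      refine norm_setIntegral_le_of_norm_le_const measure_closedBall_lt_top fun y hy => ?_
      rw [norm_mul]
      refine mul_le_mul (hCg _) ?_ (norm_nonneg _) hCg0.le
      exact (hd (lt_of_le_of_lt hy hs.2)).le
    have hs3 : 0 < s ^ 3 := pow_pos hs.1 3
    have hs0 := hs.1.ne'
    refine (mul_le_mul_of_nonneg_left h1 (inv_nonneg.2 hs3.le)).trans_lt ?_
    have e2 : (s ^ 3)⁻¹ * (Cg * (ε / (Cg * V + 1)) * (s ^ 3 * V)) = ε * (Cg * V) / (Cg * V + 1) := by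
      field_simp
    rw [e2, div_lt_iff₀ (by positivity)]
    nlinarith
  have hfinal := abs_limit_le_of_deriv_scale_bound hr hderiv hsmall hlarge (by positivity)
    (by positivity) hinf hzero
  rw [abs_mul, abs_of_pos hpos] at hfinal
  rw [div_mul_eq_mul_div, le_div_iff₀ hpos]
  refine hfinal.trans ?_
  have p1 : 0 ≤ a * r ^ (1 / 2 : ℝ) := by positivity
  have p2 : 0 ≤ r ^ (-3 / 2 : ℝ) * W := by positivity
  have p3 : 0 ≤ K * √V := by positivity
  have p4 : 0 ≤ K * V := by positivity
  nlinarith [mul_nonneg p1 p3, mul_nonneg p2 p4, mul_nonneg p2 p3]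

end

/-! ### The velocity gradient under the relative Hölder condition -/

theorem gradSq_nonneg (L : E3 →L[ℝ] E3) : 0 ≤ gradSq L :=
  Finset.sum_nonneg fun _ _ => by positivity

theorem gradSq_eq_sum (L : E3 →L[ℝ] E3) : gradSq L = ∑ l, ∑ i, (L (e l)) i ^ 2 := by
  simp only [gradSq, EuclideanSpace.norm_sq_eq, Real.norm_eq_abs, sq_abs]

theorem sqrt_gradSq_le {L : E3 →L[ℝ] E3} {K : ℝ} (h : ∀ l i, |(L (e l)) i| ≤ K) :
    √(gradSq L) ≤ 3 * K := by
  have hK : 0 ≤ K := (abs_nonneg _).trans (h 0 0)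
  rw [Real.sqrt_le_left (by positivity), gradSq_eq_sum]
  have h2 : ∀ l i, (L (e l)) i ^ 2 ≤ K ^ 2 := fun l i => sq_le_sq' (by linarith [abs_le.1 (h l i)])
    (abs_le.1 (h l i)).2
  refine (Finset.sum_le_sum fun l _ => Finset.sum_le_sum fun i _ => h2 l i).trans ?_
  simp
  nlinarith

/-- A relative Hölder bound `|c(y) - c(x)| ≤ |c(y)| |y - x|^{1/2}`, required only almost everywhere
on `{c ≠ 0}`, forces a Harnack-type comparison on balls of radius at most `1/4`: by connectedness,
`c` has no zeros there unless `c(x) = 0`, in which case it vanishes identically. -/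
theorem harnack_of_relative_holder {c : E3 → E3} {x : E3} {r : ℝ} (hr4 : r ≤ 1 / 4)
    (hc : ContinuousOn c (ball x r))
    (h : ∀ᵐ y, y ∈ ball x r → c y ≠ 0 → ‖c y - c x‖ ≤ ‖c y‖ * ‖y - x‖ ^ (1 / 2 : ℝ)) :
    ∀ y ∈ ball x r, ‖c y - c x‖ ≤ 2 * ‖c x‖ * ‖y - x‖ ^ (1 / 2 : ℝ) ∧ ‖c x‖ ≤ 2 * ‖c y‖ := by
  have hall : ∀ y ∈ ball x r, c y ≠ 0 → ‖c y - c x‖ ≤ ‖c y‖ * ‖y - x‖ ^ (1 / 2 : ℝ) := by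
    set N : Set E3 := {y ∈ ball x r | 0 < ‖c y‖} ∩
      {y ∈ ball x r | 0 < ‖c y - c x‖ - ‖c y‖ * ‖y - x‖ ^ (1 / 2 : ℝ)} with hN
    have hpow : Continuous fun y : E3 => ‖y - x‖ ^ (1 / 2 : ℝ) :=
      (by fun_prop : Continuous fun y : E3 => ‖y - x‖).rpow_const fun _ => Or.inr (by norm_num)
    have hNo : IsOpen N := by
      refine IsOpen.inter ?_ ?_
      · exact hc.norm.isOpen_inter_preimage isOpen_ball isOpen_Ioi
      · exact ((hc.sub continuousOn_const).norm.sub (hc.norm.mul hpow.continuousOn))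
          |>.isOpen_inter_preimage isOpen_ball isOpen_Ioi
    have hN0 : volume N = 0 := by
      refine measure_mono_null (fun y hy => ?_) (ae_iff.1 h)
      simp only [mem_ofPred_eq, Classical.not_imp, not_le]
      exact ⟨hy.1.1, norm_pos_iff.1 hy.1.2, by linarith [hy.2.2]⟩
    have hNe := hNo.eq_empty_of_measure_zero hN0
    intro y hy hcy
    by_contra hlt
    have : y ∈ N := ⟨⟨hy, norm_pos_iff.2 hcy⟩, ⟨hy, by linarith [not_le.1 hlt]⟩⟩
    rw [hNe] at this
    exact this
  have hhalf : ∀ y ∈ ball x r, ‖y - x‖ ^ (1 / 2 : ℝ) ≤ 1 / 2 := by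
    intro y hy
    rw [mem_ball, dist_eq_norm] at hy
    have h1 : ‖y - x‖ ^ (1 / 2 : ℝ) ≤ (1 / 4 : ℝ) ^ (1 / 2 : ℝ) :=
      Real.rpow_le_rpow (norm_nonneg _) (hy.le.trans hr4) (by norm_num)
    refine h1.trans (le_of_eq ?_)
    rw [← Real.sqrt_eq_rpow, show (1 / 4 : ℝ) = (1 / 2) ^ 2 by norm_num,
      Real.sqrt_sq (by norm_num)]
  have hall2 : ∀ y ∈ ball x r, c y ≠ 0 → ‖c y - c x‖ ≤ 1 / 2 * ‖c y‖ := fun y hy hcy =>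
    (hall y hy hcy).trans (by nlinarith [hhalf y hy, norm_nonneg (c y)])
  intro y hy
  have hp : 0 ≤ ‖y - x‖ ^ (1 / 2 : ℝ) := by positivity
  by_cases hx : c x = 0
  · have hy0 : c y = 0 := by
      by_contra hcy
      have := hall2 y hy hcy
      rw [hx, sub_zero] at this
      have h2 := norm_pos_iff.2 hcy
      linarith
    simp [hx, hy0]
  · have hxpos := norm_pos_iff.2 hx
    have hy0 : c y ≠ 0 := by
      intro hcy
      have hxm : x ∈ ball x r := mem_ball_self (dist_nonneg.trans_lt hy)
      obtain ⟨z, hz, hcz⟩ := (convex_ball x r).isPreconnected.intermediate_value hy hxm hc.norm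
        (show ‖c x‖ / 2 ∈ Icc ‖c y‖ ‖c x‖ by rw [hcy, norm_zero]; constructor <;> linarith)
      have hcz' : ‖c z‖ = ‖c x‖ / 2 := hcz
      have h1 := hall2 z hz (norm_pos_iff.1 (by rw [hcz']; linarith))
      have h2 := norm_sub_norm_le (c x) (c z)
      rw [norm_sub_rev] at h2
      linarith
    have h1 := hall2 y hy hy0
    have h2 := norm_sub_norm_le (c y) (c x)
    have h3 := norm_sub_norm_le (c x) (c y)
    rw [norm_sub_rev] at h3
    refine ⟨(hall y hy hy0).trans (mul_le_mul_of_nonneg_right (by linarith) hp), by linarith⟩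

/-- Where the relative Hölder bound on the vorticity holds at a point, the full velocity gradient
there is controlled by the global `L²` norm of the vorticity. -/
theorem exists_gradient_bound_of_relative_holder : ∃ C : ℝ, 0 < C ∧
    ∀ (v : E3 → E3) (A : E3 → E3 →L[ℝ] E3) (x : E3) (r : ℝ), 0 < r → r ≤ 1 / 4 →
    MemLp v 2 volume → MemLp A 2 volume → HasWeakGradient v A →
    (∀ χ : E3 → ℝ, ContDiff ℝ ∞ χ → HasCompactSupport χ → ∫ y, ∑ l, pdx l χ y * v y l = 0) →
    ContinuousOn A (ball x r) →
    (∀ᵐ y, y ∈ ball x r → curlL (A y) ≠ 0 →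
      ‖curlL (A y) - curlL (A x)‖ ≤ ‖curlL (A y)‖ * ‖y - x‖ ^ (1 / 2 : ℝ)) →
    √(gradSq (A x)) ≤ C * r ^ (-3 / 2 : ℝ) * √(∫ y, ‖curlL (A y)‖ ^ 2) := by
  obtain ⟨C, hC, hbound⟩ := exists_gradient_bound
  set V := volume.real (ball (0 : E3) 1) with hV
  have hV0 : 0 < V :=
    ENNReal.toReal_pos (measure_ball_pos _ _ one_pos).ne' measure_ball_lt_top.ne
  refine ⟨3 * (C * (4 / √V + 1)), by positivity, ?_⟩
  intro v A x r hr hr4 hv hA hw hdiv hcont hhol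
  set W := √(∫ y, ‖curlL (A y)‖ ^ 2) with hW
  have hcurl := memLp_curlL hA
  have hcc : ContinuousOn (fun y => curlL (A y)) (ball x r) :=
    continuous_curlL.comp_continuousOn hcont
  have hH := harnack_of_relative_holder hr4 hcc hhol
  have hx : ‖curlL (A x)‖ ≤ 2 / √V * r ^ (-3 / 2 : ℝ) * W := by
    have hvol : volume.real (ball x r) = r ^ 3 * V := by
      rw [measureReal_def, Measure.addHaar_ball _ _ hr.le, ENNReal.toReal_mul,
        ENNReal.toReal_ofReal (by positivity), finrank_euclideanSpace, Fintype.card_fin]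
      rfl
    have hi : Integrable fun y => ‖curlL (A y)‖ ^ 2 := hcurl.integrable_norm_pow two_ne_zero
    have h1 : ‖curlL (A x)‖ ^ 2 * (r ^ 3 * V) ≤ 4 * ∫ y, ‖curlL (A y)‖ ^ 2 := by
      rw [← hvol, mul_comm, ← smul_eq_mul, ← setIntegral_const, ← integral_const_mul]
      refine le_trans ?_ (setIntegral_le_integral (s := ball x r) (hi.const_mul 4)
        (Filter.Eventually.of_forall fun y => by positivity))
      refine setIntegral_mono_on (integrableOn_const measure_ball_lt_top.ne)
        (hi.const_mul 4).integrableOn measurableSet_ball fun y hy => ?_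
      have := (hH y hy).2
      nlinarith [norm_nonneg (curlL (A x)), norm_nonneg (curlL (A y))]
    have h2 : (∫ y, ‖curlL (A y)‖ ^ 2) = W ^ 2 := by
      rw [hW, Real.sq_sqrt (integral_nonneg fun y => by positivity)]
    have e1 : (r ^ (-3 / 2 : ℝ)) ^ 2 = (r ^ 3)⁻¹ := by
      rw [← Real.rpow_natCast, ← Real.rpow_mul hr.le, ← Real.rpow_natCast r 3, ← Real.rpow_neg hr.le]
      norm_num
    refine le_of_sq_le_sq ?_ (by positivity)
    rw [mul_pow, mul_pow, div_pow, Real.sq_sqrt hV0.le, e1]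
    rw [h2] at h1
    rw [show 2 ^ 2 / V * (r ^ 3)⁻¹ * W ^ 2 = (4 * W ^ 2) / (r ^ 3 * V) by field_simp; ring,
      le_div_iff₀ (by positivity)]
    exact h1
  have hrp : r ^ (1 / 2 : ℝ) ≤ 1 := Real.rpow_le_one hr.le (by linarith) (by norm_num)
  rw [show 3 * (C * (4 / √V + 1)) * r ^ (-3 / 2 : ℝ) * W
    = 3 * (C * ((4 / √V + 1) * r ^ (-3 / 2 : ℝ) * W)) by ring]
  refine sqrt_gradSq_le fun k i => ?_
  refine (hbound v A x r (2 * ‖curlL (A x)‖) hr (by positivity) hv hA hw hdiv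
    (hcont.continuousAt (isOpen_ball.mem_nhds (mem_ball_self hr)))
    (Filter.Eventually.of_forall fun y hy => (hH y hy).1) k i).trans ?_
  refine mul_le_mul_of_nonneg_left ?_ hC.le
  have h3 : 2 * ‖curlL (A x)‖ * r ^ (1 / 2 : ℝ) ≤ 2 * (2 / √V * r ^ (-3 / 2 : ℝ) * W) * 1 :=
    mul_le_mul (by linarith) hrp (by positivity) (by positivity)
  refine (add_le_add_left h3 _).trans (le_of_eq ?_)
  ring

theorem SmoothIn.continuousOn_gradient {T ϱ : ℝ} {f : ℝ → E3 → E3} {Df : ℝ → E3 → E3 →L[ℝ] E3}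
    (h : SmoothIn T ϱ f Df) {t : ℝ} (ht : t ∈ Ioc 0 T) : ContinuousOn (Df t) (ball 0 ϱ) := by
  have h2 : ContDiffOn ℝ ∞ (f t) (ball 0 ϱ) := contDiffOn_euclidean.2 fun k => (h.sm k).slice ht
  exact (h2.continuousOn_fderiv_of_isOpen isOpen_ball (by simp)).congr fun x hx => h.2 t ht x hx

theorem EnergyClass.memLp_gradient {T : ℝ} {f : ℝ → E3 → E3} {Df : ℝ → E3 → E3 →L[ℝ] E3}
    (h : EnergyClass T f Df) : ∀ᵐ t ∂(volume.restrict (Ioo 0 T)), MemLp (Df t) 2 volume := by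
  have h1 := h.gradL2.1.prodMk_left
  have h2 : Integrable (fun z : ℝ × E3 => ‖Df z.1 z.2‖ ^ 2) (slab T) :=
    h.gradL2.integrable_norm_pow two_ne_zero
  filter_upwards [h1, Integrable.prod_right_ae h2] with t ht1 ht2
  exact (memLp_two_iff_integrable_sq_norm ht1).2 ht2

theorem EnergyClass.integrable_curlSq {T : ℝ} {f : ℝ → E3 → E3} {Df : ℝ → E3 → E3 →L[ℝ] E3}
    (h : EnergyClass T f Df) :
    Integrable (fun t => ∫ x, ‖curl Df t x‖ ^ 2) (volume.restrict (Ioo 0 T)) := by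
  have h1 : MemLp (fun z : ℝ × E3 => curl Df z.1 z.2) 2 (slab T) :=
    (h.gradL2.norm.const_mul 6).mono' (continuous_curlL.comp_aestronglyMeasurable h.gradL2.1)
      (Filter.Eventually.of_forall fun z => norm_curlL_le (Df z.1 z.2))
  have h2 : Integrable (fun z : ℝ × E3 => ‖curl Df z.1 z.2‖ ^ 2) (slab T) :=
    h1.integrable_norm_pow two_ne_zero
  exact h2.integral_prod_left

/-- The velocity gradient in the integral domain is bounded, at almost every time, by the threshold
`M` plus a multiple of the global `L²` norm of the vorticity, which is square integrable in time. The
factor `(1 + 8κ)/R₀` bounds `r^{-3/2}` for `r = min (R₀^{2/3}) (1/4)`, the radius on which the relative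
Hölder bound is used. -/
theorem exists_velocity_gradient_bound : ∃ C : ℝ, 0 < C ∧ ∀ (T R₀ M κ : ℝ), 0 < R₀ → R₀ ≤ κ →
    0 < M → ∀ (u : ℝ → E3 → E3) (Du : ℝ → E3 → E3 →L[ℝ] E3), EnergyClass T u Du →
    SmoothIn T (2 * R₀ + R₀ ^ (2 / 3 : ℝ)) u Du → HybridAssumption T R₀ M Du →
    ∀ᵐ t ∂(volume.restrict (Ioo 0 T)), ∀ x ∈ ball (0 : E3) (2 * R₀),
      √(gradSq (Du t x)) ≤ M + C * (1 + 8 * κ) / R₀ * √(∫ y, ‖curl Du t y‖ ^ 2) := by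
  obtain ⟨C, hC, hbound⟩ := exists_gradient_bound_of_relative_holder
  refine ⟨C, hC, ?_⟩
  intro T R₀ M κ hR hRκ hM u Du hu hs hA1
  filter_upwards [hu.inH, hu.grad, hu.memLp_gradient, ae_restrict_mem measurableSet_Ioo] with
    t hH hw hL2 ht x hx
  have hκ : 0 < κ := hR.trans_le hRκ
  by_cases hle : √(gradSq (Du t x)) ≤ M
  · have : 0 ≤ C * (1 + 8 * κ) / R₀ * √(∫ y, ‖curl Du t y‖ ^ 2) := by positivity
    linarith
  set r : ℝ := min (R₀ ^ (2 / 3 : ℝ)) (1 / 4) with hr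
  have hr0 : 0 < r := lt_min (by positivity) (by norm_num)
  have hsub : ball x r ⊆ ball 0 (2 * R₀ + R₀ ^ (2 / 3 : ℝ)) := by
    refine ball_subset_ball' ?_
    have := min_le_left (R₀ ^ (2 / 3 : ℝ)) (1 / 4)
    have := (mem_ball.1 hx).le
    linarith
  have hae : ∀ᵐ y, y ∈ ball x r → curlL (Du t y) ≠ 0 →
      ‖curlL (Du t y) - curlL (Du t x)‖ ≤ ‖curlL (Du t y)‖ * ‖y - x‖ ^ (1 / 2 : ℝ) := by
    have h1 := (measurePreserving_sub_right (volume : Measure E3) x).quasiMeasurePreserving.ae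
      (hA1 t ht x hx (not_le.1 hle))
    filter_upwards [h1] with y hy hyr hc
    rw [mem_ball, dist_eq_norm] at hyr
    have := min_le_left (R₀ ^ (2 / 3 : ℝ)) (1 / 4)
    simp only [curl, add_sub_cancel] at hy
    exact hy (by linarith) hc
  have h1 := hbound (u t) (Du t) x r hr0 (min_le_right _ _) hH.1 hL2 hw
    (fun χ hχ hc => hH.integral_grad_eq_zero hχ hc)
    ((hs.continuousOn_gradient (Ioo_subset_Ioc_self ht)).mono hsub) hae
  have h2 : r ^ (-3 / 2 : ℝ) ≤ (1 + 8 * κ) / R₀ := by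
    rcases le_total (R₀ ^ (2 / 3 : ℝ)) (1 / 4) with h | h
    · rw [hr, min_eq_left h, ← Real.rpow_mul hR.le]
      norm_num
      rw [Real.rpow_neg_one, le_div_iff₀ hR, inv_mul_cancel₀ hR.ne']
      linarith
    · rw [hr, min_eq_right h]
      have e1 : ((1 / 4 : ℝ)) ^ (-3 / 2 : ℝ) = 8 := by
        rw [show (1 / 4 : ℝ) = (2 : ℝ) ^ (-2 : ℝ) by
          rw [Real.rpow_neg (by norm_num), Real.rpow_two]; norm_num,
          ← Real.rpow_mul (by norm_num)]
        norm_num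
      rw [e1, le_div_iff₀ hR]
      linarith
  have h3 : C * r ^ (-3 / 2 : ℝ) * √(∫ y, ‖curlL (Du t y)‖ ^ 2)
      ≤ C * (1 + 8 * κ) / R₀ * √(∫ y, ‖curl Du t y‖ ^ 2) := by
    rw [mul_div_assoc]
    exact mul_le_mul_of_nonneg_right (mul_le_mul_of_nonneg_left h2 hC.le) (Real.sqrt_nonneg _)
  linarith

/-! ### The localized enstrophy balance -/

/-- The `i`-th component of the curl of a field with components `F`. -/
abbrev crlc (F : Fin 3 → ℝ → E3 → ℝ) (i : Fin 3) : ℝ → E3 → ℝ := crl F (i + 1) (i + 2)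

/-- The enstrophy density `½(|ω|² + |j|²)`. -/
def enst (U B : Fin 3 → ℝ → E3 → ℝ) (t : ℝ) (x : E3) : ℝ :=
  ∑ i, 1 / 2 * (crlc U i t x ^ 2 + crlc B i t x ^ 2)

/-- The palenstrophy density `|∇ω|² + |∇j|²`. -/
def palin (U B : Fin 3 → ℝ → E3 → ℝ) (t : ℝ) (x : E3) : ℝ :=
  ∑ i, ∑ l, (pd l (crlc U i) t x ^ 2 + pd l (crlc B i) t x ^ 2)

/-- The cross enstrophy density `ω · j`. -/
def cross (U B : Fin 3 → ℝ → E3 → ℝ) (t : ℝ) (x : E3) : ℝ :=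
  ∑ i, crlc U i t x * crlc B i t x

/-- The work of the vortex-stretching terms of the vorticity and current equations. -/
def stretch (U B : Fin 3 → ℝ → E3 → ℝ) (t : ℝ) (x : E3) : ℝ :=
  ∑ i, (crlc U i t x * (quad B B (i + 1) (i + 2) t x - quad U U (i + 1) (i + 2) t x)
    + crlc B i t x * (quad B U (i + 1) (i + 2) t x - quad U B (i + 1) (i + 2) t x))

section

variable {T ϱ : ℝ} {U B : Fin 3 → ℝ → E3 → ℝ} {t : ℝ} {Φ : E3 → ℝ}

theorem Sm.const (c : ℝ) : Sm T ϱ fun _ _ => c := contDiffOn_const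

theorem Sm.quad {F G : Fin 3 → ℝ → E3 → ℝ} (hF : ∀ k, Sm T ϱ (F k)) (hG : ∀ k, Sm T ϱ (G k))
    (j k : Fin 3) : Sm T ϱ (quad F G j k) :=
  Sm.sum fun l _ => (((hF l).pd j).mul ((hG k).pd l)).sub (((hF l).pd k).mul ((hG j).pd l))

theorem Sm.enst (hU : ∀ k, Sm T ϱ (U k)) (hB : ∀ k, Sm T ϱ (B k)) : Sm T ϱ (enst U B) :=
  Sm.sum fun _ _ => (Sm.const _).mul (((Sm.crl hU _ _).pow 2).add ((Sm.crl hB _ _).pow 2))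

theorem Sm.palin (hU : ∀ k, Sm T ϱ (U k)) (hB : ∀ k, Sm T ϱ (B k)) : Sm T ϱ (palin U B) :=
  Sm.sum fun _ _ => Sm.sum fun l _ =>
    (((Sm.crl hU _ _).pd l).pow 2).add (((Sm.crl hB _ _).pd l).pow 2)

theorem Sm.cross (hU : ∀ k, Sm T ϱ (U k)) (hB : ∀ k, Sm T ϱ (B k)) : Sm T ϱ (cross U B) :=
  Sm.sum fun _ _ => (Sm.crl hU _ _).mul (Sm.crl hB _ _)

theorem Sm.stretch (hU : ∀ k, Sm T ϱ (U k)) (hB : ∀ k, Sm T ϱ (B k)) : Sm T ϱ (stretch U B) :=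
  Sm.sum fun _ _ => ((Sm.crl hU _ _).mul ((Sm.quad hB hB _ _).sub (Sm.quad hU hU _ _))).add
    ((Sm.crl hB _ _).mul ((Sm.quad hB hU _ _).sub (Sm.quad hU hB _ _)))

/-- The rate of change of the localized enstrophy. -/
def enstRate (U B : Fin 3 → ℝ → E3 → ℝ) (Φ : E3 → ℝ) (t : ℝ) : ℝ :=
  - (∫ x, Φ x * palin U B t x) + (∑ l, ∫ x, pdx l (pdx l Φ) x * enst U B t x)
    + (∑ l, ∫ x, pdx l Φ x * (U l t x * enst U B t x))
    - (∑ l, ∫ x, pdx l Φ x * (B l t x * cross U B t x)) + ∫ x, Φ x * stretch U B t x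

theorem SmoothMHD.hasDerivAt_enstrophy (h : SmoothMHD T ϱ U B) (hΦ : ContDiff ℝ ∞ Φ)
    (hc : HasCompactSupport Φ) (hs : tsupport Φ ⊆ ball 0 ϱ) (ht : t ∈ Ioo 0 T) :
    HasDerivAt (fun t => ∫ x, Φ x * enst U B t x) (enstRate U B Φ t) t := by
  have ht' := Ioo_subset_Ioc_self ht
  have hE := Sm.enst h.smU h.smB
  refine (hasDerivAt_integral_cutoff hΦ.continuous hc hs hE ht).congr_deriv ?_
  have hsW := fun i : Fin 3 => Sm.crl h.smU (i + 1) (i + 2)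
  have hsJ := fun i : Fin 3 => Sm.crl h.smB (i + 1) (i + 2)
  have htd : ∀ x ∈ ball (0 : E3) ϱ, td T (enst U B) t x
      = ∑ i, (crlc U i t x * td T (crlc U i) t x + crlc B i t x * td T (crlc B i) t x) := by
    intro x hx
    refine (hE.hasDerivAt ht hx).unique ?_
    refine HasDerivAt.fun_sum fun i _ => ?_
    have d1 := ((hsW i).hasDerivAt ht hx).fun_pow 2
    have d2 := ((hsJ i).hasDerivAt ht hx).fun_pow 2
    refine ((d1.fun_add d2).const_mul (1 / 2)).congr_deriv ?_
    simp only [crlc]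
    ring
  have ic : ∀ {ψ : E3 → ℝ} {k : E3 → ℝ}, Continuous ψ → HasCompactSupport ψ →
      tsupport ψ ⊆ ball 0 ϱ → ContinuousOn k (ball 0 ϱ) → Integrable fun x => ψ x * k x :=
    fun h1 h2 h3 h4 => integrable_cutoff_mul isOpen_ball h1 h2 h3 h4
  have sl : ∀ {k : ℝ → E3 → ℝ}, Sm T ϱ k → ContinuousOn (k t) (ball 0 ϱ) :=
    fun hk => (hk.slice ht').continuousOn
  have cd : ∀ l, HasCompactSupport (pdx l Φ) := fun l => hc.fderiv_apply ℝ (e l)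
  have sd : ∀ l, tsupport (pdx l Φ) ⊆ ball 0 ϱ := fun l => (tsupport_pdx_subset l).trans hs
  have cdd : ∀ l, HasCompactSupport (pdx l (pdx l Φ)) := fun l => (cd l).fderiv_apply ℝ (e l)
  have sdd : ∀ l, tsupport (pdx l (pdx l Φ)) ⊆ ball 0 ϱ := fun l =>
    (tsupport_pdx_subset l).trans (sd l)
  have kd := fun l => (hΦ.pdx l).continuous
  have kdd := fun l => ((hΦ.pdx l).pdx l).continuous
  -- the energy identity for each component of the curls
  have key := fun i : Fin 3 => integral_energy_identity isOpen_ball hΦ hc hs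
    ((hsW i).slice ht') ((hsJ i).slice ht') (fun l => (h.smU l).slice ht')
    (fun l => (h.smB l).slice ht')
    (sl ((Sm.quad h.smB h.smB (i + 1) (i + 2)).sub (Sm.quad h.smU h.smU (i + 1) (i + 2))))
    (sl ((Sm.quad h.smB h.smU (i + 1) (i + 2)).sub (Sm.quad h.smU h.smB (i + 1) (i + 2))))
    (h.divU t ht) (h.divB t ht)
    (fun x hx => (h.vorticity (i + 1) (i + 2) ht hx).trans (by simp only [pd]; ring))
    (fun x hx => (h.current (i + 1) (i + 2) ht hx).trans (by simp only [pd]; ring))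
  have s0 : ∫ x, Φ x * td T (enst U B) t x = ∑ i, ∫ x, Φ x *
      (crlc U i t x * td T (crlc U i) t x + crlc B i t x * td T (crlc B i) t x) := by
    rw [← integral_finsetSum _ fun i _ => ic hΦ.continuous hc hs
      (sl (((hsW i).mul (hsW i).td).add ((hsJ i).mul (hsJ i).td)))]
    congr 1 with x
    by_cases hx : x ∈ ball (0 : E3) ϱ
    · rw [htd x hx, Finset.mul_sum]
    · simp [image_eq_zero_of_notMem_tsupport fun h => hx (hs h)]
  have s1 : ∫ x, Φ x * palin U B t x = ∑ i, ∫ x, Φ x *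
      ∑ l, (pdx l (crlc U i t) x ^ 2 + pdx l (crlc B i t) x ^ 2) := by
    have i1 : ∀ i, Integrable fun x => Φ x *
        ∑ l, (pdx l (crlc U i t) x ^ 2 + pdx l (crlc B i t) x ^ 2) := fun i =>
      ic hΦ.continuous hc hs
        (sl (Sm.sum fun l _ => (((hsW i).pd l).pow 2).add (((hsJ i).pd l).pow 2)))
    rw [← integral_finsetSum _ fun i _ => i1 i]
    simp only [palin, Finset.mul_sum]
    rfl
  have s2 : ∑ l, ∫ x, pdx l (pdx l Φ) x * enst U B t x = ∑ i, ∫ x, (∑ l, pdx l (pdx l Φ) x) *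
      (1 / 2 * (crlc U i t x ^ 2 + crlc B i t x ^ 2)) := by
    have i1 : ∀ i l, Integrable fun x => pdx l (pdx l Φ) x *
        (1 / 2 * (crlc U i t x ^ 2 + crlc B i t x ^ 2)) := fun i l =>
      ic (kdd l) (cdd l) (sdd l)
        (sl ((Sm.const _).mul (((hsW i).pow 2).add ((hsJ i).pow 2))))
    simp only [enst, Finset.mul_sum, Finset.sum_mul]
    simp only [integral_finsetSum _ fun l _ => i1 _ l, integral_finsetSum _ fun i _ => i1 i _]
    exact Finset.sum_comm
  have s3 : ∑ l, ∫ x, pdx l Φ x * (U l t x * enst U B t x) = ∑ i, ∫ x, ∑ l, pdx l Φ x *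
      (U l t x * (1 / 2 * (crlc U i t x ^ 2 + crlc B i t x ^ 2))) := by
    have i1 : ∀ i l, Integrable fun x => pdx l Φ x *
        (U l t x * (1 / 2 * (crlc U i t x ^ 2 + crlc B i t x ^ 2))) := fun i l =>
      ic (kd l) (cd l) (sd l)
        (sl ((h.smU l).mul ((Sm.const _).mul (((hsW i).pow 2).add ((hsJ i).pow 2)))))
    simp only [enst, Finset.mul_sum]
    simp only [integral_finsetSum _ fun l _ => i1 _ l, integral_finsetSum _ fun i _ => i1 i _]
    exact Finset.sum_comm
  have s4 : ∑ l, ∫ x, pdx l Φ x * (B l t x * cross U B t x) = ∑ i, ∫ x, ∑ l, pdx l Φ x *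
      (B l t x * (crlc U i t x * crlc B i t x)) := by
    have i1 : ∀ i l, Integrable fun x => pdx l Φ x *
        (B l t x * (crlc U i t x * crlc B i t x)) := fun i l =>
      ic (kd l) (cd l) (sd l) (sl ((h.smB l).mul ((hsW i).mul (hsJ i))))
    simp only [cross, Finset.mul_sum]
    simp only [integral_finsetSum _ fun l _ => i1 _ l, integral_finsetSum _ fun i _ => i1 i _]
    exact Finset.sum_comm
  have s5 : ∫ x, Φ x * stretch U B t x = ∑ i, ∫ x, Φ x *
      (crlc U i t x * (quad B B (i + 1) (i + 2) t x - quad U U (i + 1) (i + 2) t x)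
    + crlc B i t x * (quad B U (i + 1) (i + 2) t x - quad U B (i + 1) (i + 2) t x)) := by
    rw [← integral_finsetSum _ fun i _ => ic hΦ.continuous hc hs (sl
      (((hsW i).mul ((Sm.quad h.smB h.smB _ _).sub (Sm.quad h.smU h.smU _ _))).add
      ((hsJ i).mul ((Sm.quad h.smB h.smU _ _).sub (Sm.quad h.smU h.smB _ _)))))]
    simp only [stretch, Finset.mul_sum]
  rw [enstRate, s0, s1, s2, s3, s4, s5, Finset.sum_congr rfl fun i _ => key i]
  simp only [Finset.sum_add_distrib, Finset.sum_sub_distrib, Finset.sum_neg_distrib]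

theorem continuousOn_enstRate (h : SmoothMHD T ϱ U B) (hΦ : ContDiff ℝ ∞ Φ)
    (hc : HasCompactSupport Φ) (hs : tsupport Φ ⊆ ball 0 ϱ) :
    ContinuousOn (enstRate U B Φ) (Ioc 0 T) := by
  have cd : ∀ l, HasCompactSupport (pdx l Φ) := fun l => hc.fderiv_apply ℝ (e l)
  have sd : ∀ l, tsupport (pdx l Φ) ⊆ ball 0 ϱ := fun l => (tsupport_pdx_subset l).trans hs
  have hE := Sm.enst h.smU h.smB
  refine ((((continuousOn_integral_cutoff hΦ.continuous hc hs
    (Sm.palin h.smU h.smB).continuousOn).neg.add ?_).add ?_).sub ?_).add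
    (continuousOn_integral_cutoff hΦ.continuous hc hs (Sm.stretch h.smU h.smB).continuousOn)
  · exact continuousOn_finsetSum _ fun l _ => continuousOn_integral_cutoff
      ((hΦ.pdx l).pdx l).continuous ((cd l).fderiv_apply ℝ (e l))
      ((tsupport_pdx_subset l).trans (sd l)) hE.continuousOn
  · exact continuousOn_finsetSum _ fun l _ => continuousOn_integral_cutoff
      (hΦ.pdx l).continuous (cd l) (sd l) ((h.smU l).mul hE).continuousOn
  · exact continuousOn_finsetSum _ fun l _ => continuousOn_integral_cutoff
      (hΦ.pdx l).continuous (cd l) (sd l) ((h.smB l).mul (Sm.cross h.smU h.smB)).continuousOn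

end

/-! ### Integration in time against the temporal cut-off -/

theorem integrableOn_time_cutoff_mul {ζ h : ℝ → ℝ} {K T : ℝ} (hT : 0 < T)
    (hζ : ContinuousOn ζ (Ioo 0 T)) (hb : ∀ t ∈ Ioo 0 T, |ζ t| ≤ K)
    (h0 : ∀ t ∈ Ioo 0 (T / 3), ζ t = 0) (hh : ContinuousOn h (Ioc 0 T)) :
    IntegrableOn (fun t => ζ t * h t) (Ioo 0 T) := by
  obtain ⟨C, hC⟩ := (isCompact_Icc (a := T / 3) (b := T)).exists_bound_of_continuousOn
    (hh.mono fun t ht => ⟨by linarith [ht.1], ht.2⟩)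
  have hK : 0 ≤ K := (abs_nonneg _).trans (hb (T / 2) ⟨by linarith, by linarith⟩)
  have hC0 : 0 ≤ C := (norm_nonneg _).trans (hC T ⟨by linarith, le_rfl⟩)
  have hm := (hζ.mul (hh.mono Ioo_subset_Ioc_self)).aestronglyMeasurable
    (μ := volume) measurableSet_Ioo
  refine (integrable_const (K * C)).mono' hm ?_
  filter_upwards [ae_restrict_mem measurableSet_Ioo] with t ht
  rcases lt_or_ge t (T / 3) with h | h
  · simp only [h0 t ⟨ht.1, h⟩, zero_mul, norm_zero]
    positivity
  · rw [norm_mul]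
    exact mul_le_mul (hb t ht) (hC t ⟨h, ht.2.le⟩) (norm_nonneg _) hK

namespace IsTimeCutoff

variable {C₀ δ T : ℝ} {η : ℝ → ℝ}

theorem abs_le_one (h : IsTimeCutoff C₀ δ T η) : ∀ t ∈ Ioo 0 T, |η t| ≤ 1 := fun t ht => by
  rw [abs_of_nonneg (h.nonneg t ht)]; exact h.le_one t ht

theorem continuousOn_deriv (h : IsTimeCutoff C₀ δ T η) : ContinuousOn (deriv η) (Ioo 0 T) :=
  h.smooth.continuousOn_deriv_of_isOpen isOpen_Ioo (by simp)

theorem deriv_eq_zero (h : IsTimeCutoff C₀ δ T η) : ∀ t ∈ Ioo 0 (T / 3), deriv η t = 0 := by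
  intro t ht
  have : η =ᶠ[nhds t] fun _ => 0 := by
    filter_upwards [isOpen_Ioo.mem_nhds ht] with s hs using h.eq_zero s hs
  rw [this.deriv_eq, deriv_const]

theorem abs_deriv_le (h : IsTimeCutoff C₀ δ T η) (hC₀ : 0 < C₀) (hT : 0 < T) (hδ : 0 < δ) :
    ∀ t ∈ Ioo 0 T, |deriv η t| ≤ C₀ / T := fun t ht =>
  (h.deriv_le t ht).trans (mul_le_of_le_one_right (by positivity)
    (Real.rpow_le_one (h.nonneg t ht) (h.le_one t ht) hδ.le))

theorem integrableOn_mul (h : IsTimeCutoff C₀ δ T η) (hT : 0 < T) {k : ℝ → ℝ}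
    (hk : ContinuousOn k (Ioc 0 T)) : IntegrableOn (fun t => η t * k t) (Ioo 0 T) :=
  integrableOn_time_cutoff_mul hT h.smooth.continuousOn h.abs_le_one h.eq_zero hk

theorem integrableOn_deriv_mul (h : IsTimeCutoff C₀ δ T η) (hC₀ : 0 < C₀) (hT : 0 < T) (hδ : 0 < δ)
    {k : ℝ → ℝ} (hk : ContinuousOn k (Ioc 0 T)) :
    IntegrableOn (fun t => deriv η t * k t) (Ioo 0 T) :=
  integrableOn_time_cutoff_mul hT h.continuousOn_deriv (h.abs_deriv_le hC₀ hT hδ) h.deriv_eq_zero hk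

/-- The temporal cut-off removes the contribution of the initial time and keeps the final one. -/
theorem eval_eq_integral (h : IsTimeCutoff C₀ δ T η) (hC₀ : 0 < C₀) (hT : 0 < T) (hδ : 0 < δ)
    {k k' : ℝ → ℝ} (hk : ContinuousOn k (Ioc 0 T)) (hk' : ContinuousOn k' (Ioc 0 T))
    (hd : ∀ t ∈ Ioo 0 T, HasDerivAt k (k' t) t) :
    k T = (∫ t in Ioo 0 T, deriv η t * k t) + ∫ t in Ioo 0 T, η t * k' t := by
  have i1 := h.integrableOn_deriv_mul hC₀ hT hδ hk
  have i2 := h.integrableOn_mul hT hk'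
  set a := T / 4 with ha
  set F : ℝ → ℝ := fun t => (if t < T then η t else 1) * k t with hF
  have hsub : Ioo a T ⊆ Ioo 0 T := fun t ht => ⟨by linarith [ht.1], ht.2⟩
  have hi : IntegrableOn (fun t => deriv η t * k t + η t * k' t) (Ioo 0 T) := i1.add i2
  have hcont : ContinuousOn F (Icc a T) := by
    intro t ht
    have ht0 : 0 < t := by linarith [ht.1]
    have hkt : ContinuousWithinAt k (Icc a T) t :=
      (hk t ⟨ht0, ht.2⟩).mono fun s hs => ⟨by linarith [hs.1], hs.2⟩
    refine ContinuousWithinAt.mul ?_ hkt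
    rcases ht.2.lt_or_eq with hlt | rfl
    · have e1 : (fun t => if t < T then η t else 1) =ᶠ[nhds t] η := by
        filter_upwards [isOpen_Iio.mem_nhds hlt] with s hs
        exact if_pos hs
      exact ((h.smooth.continuousOn.continuousAt (isOpen_Ioo.mem_nhds ⟨ht0, hlt⟩)).congr
        e1.symm).continuousWithinAt
    · have e1 : (fun s => if s < t then η s else 1) =ᶠ[nhdsWithin t (Icc a t)] fun _ => 1 := by
        have hm : Ioi (2 * t / 3) ∈ nhds t := isOpen_Ioi.mem_nhds (by
          simp only [mem_Ioi]; linarith)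
        filter_upwards [mem_nhdsWithin_of_mem_nhds hm] with s hs
        split_ifs with hst
        · exact h.eq_one s ⟨hs, hst⟩
        · rfl
      exact continuousWithinAt_const.congr_of_eventuallyEq e1 (by simp)
  have hder : ∀ t ∈ Ioo a T, HasDerivAt F (deriv η t * k t + η t * k' t) t := by
    intro t ht
    have ht' := hsub ht
    have d1 : HasDerivAt η (deriv η t) t :=
      ((h.smooth.contDiffAt (isOpen_Ioo.mem_nhds ht')).differentiableAt (by simp)).hasDerivAt
    refine (d1.mul (hd t ht')).congr_of_eventuallyEq ?_
    filter_upwards [isOpen_Iio.mem_nhds ht.2] with s hs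
    simp only [hF, Pi.mul_apply]
    rw [if_pos (show s < T from hs)]
  have haT : a ≤ T := by linarith
  have hftc := intervalIntegral.integral_eq_sub_of_hasDerivAt_of_le haT hcont hder
    ((intervalIntegrable_iff_integrableOn_Ioo_of_le haT).2 (hi.mono_set hsub))
  rw [intervalIntegral.integral_of_le haT, integral_Ioc_eq_integral_Ioo] at hftc
  have hz : ∫ t in Ioo 0 T, (deriv η t * k t + η t * k' t)
      = ∫ t in Ioo a T, (deriv η t * k t + η t * k' t) := by
    refine setIntegral_eq_of_subset_of_forall_sdiff_eq_zero measurableSet_Ioo hsub fun t ht => ?_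
    have ht3 : t ∈ Ioo 0 (T / 3) := by
      refine ⟨ht.1.1, ?_⟩
      by_contra hle
      exact ht.2 ⟨by linarith, ht.1.2⟩
    rw [h.eq_zero t ht3, h.deriv_eq_zero t ht3]
    ring
  have hFT : F T = k T := by simp [hF]
  have hFa : F a = 0 := by
    rw [hF]
    simp only
    rw [if_pos (by linarith), h.eq_zero a ⟨by linarith, by linarith⟩, zero_mul]
  rw [← integral_add i1 i2, hz, hftc, hFT, hFa, sub_zero]

end IsTimeCutoff

/-! ### Estimates at a fixed time -/

/-- For a solenoidal field the stretching term is the curl acting on the gradient. -/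
theorem quad_self {F : Fin 3 → ℝ → E3 → ℝ} {t : ℝ} {x : E3} (h : ∑ l, pd l (F l) t x = 0)
    (i : Fin 3) : quad F F (i + 1) (i + 2) t x = - ∑ m, crlc F m t x * pd m (F i) t x := by
  have h2 : quad F F (i + 1) (i + 2) t x = - ∑ m, crlc F m t x * pd m (F i) t x
      + crlc F i t x * ∑ l, pd l (F l) t x := by
    simp only [quad, crlc, crl, Fin.sum_univ_three]
    fin_cases i <;> simp <;> ring
  rw [h2, h, mul_zero, add_zero]

/-- The kinetic plus magnetic energy density `½(|u|² + |b|²)`. -/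
def kin (U B : Fin 3 → ℝ → E3 → ℝ) (t : ℝ) (x : E3) : ℝ :=
  ∑ i, 1 / 2 * (U i t x ^ 2 + B i t x ^ 2)

/-- The squared size `|∇u|² + |∇b|²` of the two gradients. -/
def grd (U B : Fin 3 → ℝ → E3 → ℝ) (t : ℝ) (x : E3) : ℝ :=
  ∑ k, ∑ l, (pd l (U k) t x ^ 2 + pd l (B k) t x ^ 2)

theorem kin_nonneg (U B : Fin 3 → ℝ → E3 → ℝ) (t : ℝ) (x : E3) : 0 ≤ kin U B t x :=
  Finset.sum_nonneg fun _ _ => by positivity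

theorem enst_nonneg (U B : Fin 3 → ℝ → E3 → ℝ) (t : ℝ) (x : E3) : 0 ≤ enst U B t x :=
  Finset.sum_nonneg fun _ _ => by positivity

theorem palin_nonneg (U B : Fin 3 → ℝ → E3 → ℝ) (t : ℝ) (x : E3) : 0 ≤ palin U B t x :=
  Finset.sum_nonneg fun _ _ => Finset.sum_nonneg fun _ _ => by positivity

theorem Sm.kin {T ϱ : ℝ} {U B : Fin 3 → ℝ → E3 → ℝ} (hU : ∀ k, Sm T ϱ (U k))
    (hB : ∀ k, Sm T ϱ (B k)) : Sm T ϱ (kin U B) :=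
  Sm.sum fun i _ => (Sm.const _).mul (((hU i).pow 2).add ((hB i).pow 2))

theorem Sm.grd {T ϱ : ℝ} {U B : Fin 3 → ℝ → E3 → ℝ} (hU : ∀ k, Sm T ϱ (U k))
    (hB : ∀ k, Sm T ϱ (B k)) : Sm T ϱ (grd U B) :=
  Sm.sum fun k _ => Sm.sum fun l _ => (((hU k).pd l).pow 2).add (((hB k).pd l).pow 2)

theorem abs_mul_le_weighted {x y a : ℝ} (ha : 0 < a) :
    |x * y| ≤ (a * x ^ 2 + a⁻¹ * y ^ 2) / 2 := by
  have h1 : 0 ≤ a⁻¹ * (a * |x| - |y|) ^ 2 := by positivity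
  have h2 : a⁻¹ * (a * |x| - |y|) ^ 2 = a * |x| ^ 2 - 2 * (|x| * |y|) + a⁻¹ * |y| ^ 2 := by
    field_simp
    ring
  rw [sq_abs, sq_abs] at h2
  rw [abs_mul]
  linarith

theorem abs_mul_mul_le_weighted {p x y V a : ℝ} (ha : 0 < a) (hp : p ^ 2 ≤ V) :
    |p * (x * y)| ≤ (a * V * x ^ 2 + a⁻¹ * y ^ 2) / 2 := by
  have h := abs_mul_le_weighted (x := p * x) (y := y) ha
  rw [← mul_assoc]
  have : a * (p * x) ^ 2 ≤ a * V * x ^ 2 := by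
    rw [mul_pow, mul_assoc]
    gcongr
  linarith

section Pointwise

variable {V a : ℝ}

theorem abs_sub_mul_sum_le (ha : 0 < a) {p₁ p₂ : ℝ} (h₁ : p₁ ^ 2 ≤ V) (h₂ : p₂ ^ 2 ≤ V)
    (X q : Fin 3 → ℝ) :
    |(p₁ - p₂) * ∑ m, X m * q m| ≤ a * V * (∑ m, X m ^ 2) + a⁻¹ * ∑ m, q m ^ 2 := by
  rw [Finset.mul_sum, Finset.mul_sum, Finset.mul_sum, ← Finset.sum_add_distrib]
  refine (Finset.abs_sum_le_sum_abs _ _).trans (Finset.sum_le_sum fun m _ => ?_)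
  rw [sub_mul]
  refine (abs_sub _ _).trans ?_
  have := abs_mul_mul_le_weighted (x := X m) (y := q m) ha h₁
  have := abs_mul_mul_le_weighted (x := X m) (y := q m) ha h₂
  linarith

theorem abs_mul_sum_sub_le (ha : 0 < a) {p₁ p₂ : Fin 3 → ℝ} (h₁ : ∀ l, p₁ l ^ 2 ≤ V)
    (h₂ : ∀ l, p₂ l ^ 2 ≤ V) (J : ℝ) (q₁ q₂ : Fin 3 → ℝ) :
    |J * ∑ l, (p₁ l * q₁ l - p₂ l * q₂ l)|
      ≤ 3 * (a * V * J ^ 2) + a⁻¹ * (∑ l, (q₁ l ^ 2 + q₂ l ^ 2)) / 2 := by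
  have : 3 * (a * V * J ^ 2) + a⁻¹ * (∑ l, (q₁ l ^ 2 + q₂ l ^ 2)) / 2
      = ∑ l : Fin 3, (a * V * J ^ 2 + a⁻¹ * (q₁ l ^ 2 + q₂ l ^ 2) / 2) := by
    simp only [Fin.sum_univ_three]
    ring
  rw [this, Finset.mul_sum]
  refine (Finset.abs_sum_le_sum_abs _ _).trans (Finset.sum_le_sum fun l _ => ?_)
  rw [show J * (p₁ l * q₁ l - p₂ l * q₂ l) = p₁ l * (J * q₁ l) - p₂ l * (J * q₂ l) by ring]
  refine (abs_sub _ _).trans ?_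
  have := abs_mul_mul_le_weighted (x := J) (y := q₁ l) ha (h₁ l)
  have := abs_mul_mul_le_weighted (x := J) (y := q₂ l) ha (h₂ l)
  linarith

variable {U B : Fin 3 → ℝ → E3 → ℝ} {t : ℝ} {x : E3}

/-- Every stretching term contains one velocity gradient, one curl and one further gradient; for the
Lorentz contribution this uses `∇ · b = 0`, and the velocity gradient is the one in `ω`. -/
theorem abs_stretch_le (ha : 0 < a) (hU : ∑ l, pd l (U l) t x = 0) (hB : ∑ l, pd l (B l) t x = 0)
    (hV : ∀ l k, pd l (U k) t x ^ 2 ≤ V) :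
    |stretch U B t x| ≤ 18 * (a * V * enst U B t x) + 3 * (a⁻¹ * grd U B t x) := by
  have key : ∀ i, |crlc U i t x * (quad B B (i + 1) (i + 2) t x - quad U U (i + 1) (i + 2) t x)
      + crlc B i t x * (quad B U (i + 1) (i + 2) t x - quad U B (i + 1) (i + 2) t x)|
      ≤ (a * V * (∑ m, crlc B m t x ^ 2) + a⁻¹ * ∑ m, pd m (B i) t x ^ 2)
        + (a * V * (∑ m, crlc U m t x ^ 2) + a⁻¹ * ∑ m, pd m (U i) t x ^ 2)
        + (3 * (a * V * crlc B i t x ^ 2)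
          + a⁻¹ * (∑ l, (pd (i + 1) (B l) t x ^ 2 + pd (i + 2) (B l) t x ^ 2)) / 2)
        + (3 * (a * V * crlc B i t x ^ 2)
          + a⁻¹ * (∑ l, (pd l (B (i + 2)) t x ^ 2 + pd l (B (i + 1)) t x ^ 2)) / 2) := by
    intro i
    rw [quad_self hU, quad_self hB]
    have h1 := abs_sub_mul_sum_le ha (hV (i + 1) (i + 2)) (hV (i + 2) (i + 1))
      (fun m => crlc B m t x) fun m => pd m (B i) t x
    have h2 := abs_sub_mul_sum_le ha (hV (i + 1) (i + 2)) (hV (i + 2) (i + 1))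
      (fun m => crlc U m t x) fun m => pd m (U i) t x
    have h3 := abs_mul_sum_sub_le ha (fun l => hV l (i + 2)) (fun l => hV l (i + 1))
      (crlc B i t x) (fun l => pd (i + 1) (B l) t x) fun l => pd (i + 2) (B l) t x
    have h4 := abs_mul_sum_sub_le ha (fun l => hV (i + 1) l) (fun l => hV (i + 2) l)
      (crlc B i t x) (fun l => pd l (B (i + 2)) t x) fun l => pd l (B (i + 1)) t x
    rw [show quad B U (i + 1) (i + 2) t x = ∑ l, (pd l (U (i + 2)) t x * pd (i + 1) (B l) t x
      - pd l (U (i + 1)) t x * pd (i + 2) (B l) t x) from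
        Finset.sum_congr rfl fun l _ => by ring]
    simp only [quad]
    have e1 : crlc U i t x = pd (i + 1) (U (i + 2)) t x - pd (i + 2) (U (i + 1)) t x := rfl
    rw [← e1] at h1 h2
    rw [abs_le] at h1 h2 h3 h4 ⊢
    constructor <;> linarith [h1.1, h1.2, h2.1, h2.2, h3.1, h3.2, h4.1, h4.2]
  refine ((Finset.abs_sum_le_sum_abs _ _).trans (Finset.sum_le_sum fun i _ => key i)).trans ?_
  have hV0 : 0 ≤ V := (sq_nonneg _).trans (hV 0 0)
  have hpos : 0 ≤ 6 * (a * V * ∑ i, crlc U i t x ^ 2)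
      + 2 * (a⁻¹ * ∑ k, ∑ l, pd l (U k) t x ^ 2) := by
    have h1 : 0 ≤ ∑ i, crlc U i t x ^ 2 := Finset.sum_nonneg fun _ _ => sq_nonneg _
    have h2 : 0 ≤ ∑ k, ∑ l, pd l (U k) t x ^ 2 :=
      Finset.sum_nonneg fun _ _ => Finset.sum_nonneg fun _ _ => sq_nonneg _
    positivity
  rw [← sub_nonneg]
  refine hpos.trans_eq ?_
  simp only [enst, grd, Fin.sum_univ_three, Fin.isValue, Fin.reduceAdd]
  ring

end Pointwise

theorem abs_integral_le_integral_of_abs_le {f g : E3 → ℝ} (hg : Integrable g)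
    (h : ∀ x, |f x| ≤ g x) : |∫ x, f x| ≤ ∫ x, g x :=
  norm_integral_le_of_norm_le (f := f) hg (Filter.Eventually.of_forall h)

theorem rpow_half_split {s ρ : ℝ} (hs : 0 ≤ s) (hρ : 1 / 2 < ρ) :
    s ^ ρ = √s * s ^ (ρ - 1 / 2) ∧ (s ^ (ρ - 1 / 2)) ^ 2 = s ^ (2 * ρ - 1) := by
  constructor
  · rw [Real.sqrt_eq_rpow, ← Real.rpow_add' hs (by linarith)]
    congr 1
    ring
  · rw [← Real.rpow_natCast, ← Real.rpow_mul hs]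
    congr 1
    push_cast
    ring

/-- Weighted Young inequality adapted to the derivative bound of a refined cut-off. -/
theorem rpow_mul_abs_le {s ρ p x y V a : ℝ} (hs : 0 ≤ s) (hρ : 1 / 2 < ρ) (ha : 0 < a)
    (hp : p ^ 2 ≤ V) :
    s ^ ρ * |p * (x * y)| ≤ (a * V * (s * x ^ 2) + a⁻¹ * (s ^ (2 * ρ - 1) * y ^ 2)) / 2 := by
  obtain ⟨h1, h2⟩ := rpow_half_split hs hρ
  have h := abs_mul_mul_le_weighted (x := √s * x) (y := s ^ (ρ - 1 / 2) * y) ha hp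
  rw [mul_pow, mul_pow, h2, Real.sq_sqrt hs] at h
  refine le_trans (le_of_eq ?_) h
  have h3 : 0 ≤ s ^ ρ := Real.rpow_nonneg hs _
  rw [← abs_of_nonneg h3, ← abs_mul, h1]
  congr 1
  ring

section Cutoffs

variable {C₀ ρ R₀ ϱ : ℝ} {ψ₀ : E3 → ℝ}

namespace IsIntegralCutoff

theorem eq_zero (h : IsIntegralCutoff C₀ ρ R₀ ψ₀) {x : E3} (hx : x ∉ ball 0 (2 * R₀)) :
    ψ₀ x = 0 := by
  by_contra hne
  exact hx (h.supp hne)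

theorem tsupport_subset (h : IsIntegralCutoff C₀ ρ R₀ ψ₀) (hϱ : 2 * R₀ < ϱ) :
    tsupport ψ₀ ⊆ ball 0 ϱ :=
  (closure_minimal (h.supp.trans ball_subset_closedBall) isClosed_closedBall).trans
    (closedBall_subset_ball hϱ)

theorem continuous_rpow (h : IsIntegralCutoff C₀ ρ R₀ ψ₀) {s : ℝ} (hs : 0 < s) :
    Continuous fun x => ψ₀ x ^ s :=
  h.refined.smooth.continuous.rpow_const fun _ => Or.inr hs.le

theorem support_rpow (ψ : E3 → ℝ) {s : ℝ} (hs : 0 < s) :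
    (Function.support fun x => ψ x ^ s) ⊆ Function.support ψ := by
  intro x hx h0
  exact hx (by simp only [h0, Real.zero_rpow hs.ne'])

theorem compact_rpow (h : IsIntegralCutoff C₀ ρ R₀ ψ₀) {s : ℝ} (hs : 0 < s) :
    HasCompactSupport fun x => ψ₀ x ^ s :=
  h.refined.compact.mono (support_rpow ψ₀ hs)

theorem tsupport_rpow_subset (h : IsIntegralCutoff C₀ ρ R₀ ψ₀) (hϱ : 2 * R₀ < ϱ) {s : ℝ}
    (hs : 0 < s) : tsupport (fun x => ψ₀ x ^ s) ⊆ ball 0 ϱ :=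
  (closure_mono (support_rpow ψ₀ hs)).trans (h.tsupport_subset hϱ)

theorem integrable_mul (h : IsIntegralCutoff C₀ ρ R₀ ψ₀) (hϱ : 2 * R₀ < ϱ) {f : E3 → ℝ}
    (hf : ContinuousOn f (ball 0 ϱ)) : Integrable fun x => ψ₀ x * f x :=
  integrable_cutoff_mul isOpen_ball h.refined.smooth.continuous h.refined.compact
    (h.tsupport_subset hϱ) hf

theorem integrable_rpow_mul (h : IsIntegralCutoff C₀ ρ R₀ ψ₀) (hϱ : 2 * R₀ < ϱ) {f : E3 → ℝ}
    (hf : ContinuousOn f (ball 0 ϱ)) {s : ℝ} (hs : 0 < s) : Integrable fun x => ψ₀ x ^ s * f x :=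
  integrable_cutoff_mul isOpen_ball (h.continuous_rpow hs) (h.compact_rpow hs)
    (h.tsupport_rpow_subset hϱ hs) hf

theorem rpow_anti (h : IsIntegralCutoff C₀ ρ R₀ ψ₀) {s r : ℝ} (hs : 0 < s) (hsr : s ≤ r) (x : E3) :
    ψ₀ x ^ r ≤ ψ₀ x ^ s := by
  rcases (h.refined.nonneg x).eq_or_lt with h0 | h0
  · rw [← h0, Real.zero_rpow hs.ne', Real.zero_rpow (hs.trans_le hsr).ne']
  · exact Real.rpow_le_rpow_of_exponent_ge h0 (h.refined.le_one x) hsr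

theorem le_rpow (h : IsIntegralCutoff C₀ ρ R₀ ψ₀) {s : ℝ} (hs : 0 < s) (hs1 : s ≤ 1) (x : E3) :
    ψ₀ x ≤ ψ₀ x ^ s := by
  simpa using h.rpow_anti hs hs1 x

end IsIntegralCutoff

/-- A function that looks like a sum of cut-offs at scale `R` of finite multiplicity `K`, adding up
to at least the integral cut-off `ψ₀`. -/
structure IsSumCutoff (C₀ ρ R K : ℝ) (ψ₀ Φ : E3 → ℝ) : Prop where
  smooth : ContDiff ℝ ∞ Φ
  ge : ∀ x, ψ₀ x ≤ Φ x
  le : ∀ x, Φ x ≤ K * ψ₀ x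
  grad : ∀ l x, |pdx l Φ x| ≤ K * (C₀ / R) * ψ₀ x ^ ρ
  hess : ∀ l x, |pdx l (pdx l Φ) x| ≤ K * (C₀ / R ^ 2) * ψ₀ x ^ (2 * ρ - 1)

namespace IsSumCutoff

variable {R K : ℝ} {Φ : E3 → ℝ}

theorem support_subset (h : IsSumCutoff C₀ ρ R K ψ₀ Φ) :
    Function.support Φ ⊆ Function.support ψ₀ := by
  intro x hx h0
  have h1 := h.ge x
  have h2 := h.le x
  rw [h0] at h1 h2
  exact hx (le_antisymm (by simpa using h2) h1)

theorem compact (h : IsSumCutoff C₀ ρ R K ψ₀ Φ) (hψ : IsIntegralCutoff C₀ ρ R₀ ψ₀) :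
    HasCompactSupport Φ :=
  hψ.refined.compact.mono (h.support_subset)

theorem tsupport_subset (h : IsSumCutoff C₀ ρ R K ψ₀ Φ) (hψ : IsIntegralCutoff C₀ ρ R₀ ψ₀)
    (hϱ : 2 * R₀ < ϱ) : tsupport Φ ⊆ ball 0 ϱ :=
  (closure_mono (h.support_subset)).trans (hψ.tsupport_subset hϱ)

theorem nonneg (h : IsSumCutoff C₀ ρ R K ψ₀ Φ) (hψ : IsIntegralCutoff C₀ ρ R₀ ψ₀) (x : E3) :
    0 ≤ Φ x :=
  (hψ.refined.nonneg x).trans (h.ge x)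

theorem integrable_mul (h : IsSumCutoff C₀ ρ R K ψ₀ Φ) (hψ : IsIntegralCutoff C₀ ρ R₀ ψ₀)
    (hϱ : 2 * R₀ < ϱ) {f : E3 → ℝ} (hf : ContinuousOn f (ball 0 ϱ)) :
    Integrable fun x => Φ x * f x :=
  integrable_cutoff_mul isOpen_ball h.smooth.continuous (h.compact hψ) (h.tsupport_subset hψ hϱ) hf

/-- Integrals of nonnegative densities against the summed cut-off and against `ψ₀` are
comparable. -/
theorem integral_bounds (h : IsSumCutoff C₀ ρ R K ψ₀ Φ) (hψ : IsIntegralCutoff C₀ ρ R₀ ψ₀)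
    (hϱ : 2 * R₀ < ϱ) {f : E3 → ℝ} (hf : ContinuousOn f (ball 0 ϱ)) (h0 : ∀ x, 0 ≤ f x) :
    ∫ x, ψ₀ x * f x ≤ ∫ x, Φ x * f x ∧ ∫ x, Φ x * f x ≤ K * ∫ x, ψ₀ x * f x := by
  have i1 := hψ.integrable_mul hϱ hf
  have i2 := h.integrable_mul hψ hϱ hf
  refine ⟨integral_mono i1 i2 fun x => mul_le_mul_of_nonneg_right (h.ge x) (h0 x), ?_⟩
  rw [← integral_const_mul]
  refine integral_mono i2 (i1.const_mul K) fun x => ?_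
  rw [← mul_assoc]
  exact mul_le_mul_of_nonneg_right (h.le x) (h0 x)

end IsSumCutoff

section Slices

variable {T R K V a t : ℝ} {U B : Fin 3 → ℝ → E3 → ℝ} {Φ : E3 → ℝ}

theorem SmoothMHD.abs_integral_stretch_le (h : SmoothMHD T ϱ U B)
    (hψ : IsIntegralCutoff C₀ ρ R₀ ψ₀) (hϱ : 2 * R₀ < ϱ) (hΦ : IsSumCutoff C₀ ρ R K ψ₀ Φ)
    (ha : 0 < a) (ht : t ∈ Ioo 0 T)
    (hV : ∀ x ∈ ball (0 : E3) (2 * R₀), ∀ l k, pd l (U k) t x ^ 2 ≤ V) :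
    |∫ x, Φ x * stretch U B t x| ≤ K * (18 * (a * V * ∫ x, ψ₀ x * enst U B t x)
      + 3 * (a⁻¹ * ∫ x, ψ₀ x * grd U B t x)) := by
  have ht' := Ioo_subset_Ioc_self ht
  have i1 := hψ.integrable_mul hϱ ((Sm.enst h.smU h.smB).slice ht').continuousOn
  have i2 := hψ.integrable_mul hϱ ((Sm.grd h.smU h.smB).slice ht').continuousOn
  simp only [← integral_const_mul]
  rw [← integral_add ((i1.const_mul _).const_mul _) ((i2.const_mul _).const_mul _),
    ← integral_const_mul]
  refine abs_integral_le_integral_of_abs_le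
    ((((i1.const_mul _).const_mul _).add ((i2.const_mul _).const_mul _)).const_mul _) fun x => ?_
  by_cases hx : x ∈ ball (0 : E3) (2 * R₀)
  · have hx' : x ∈ ball (0 : E3) ϱ := ball_subset_ball hϱ.le hx
    have h1 := abs_stretch_le ha (h.divU t ht x hx') (h.divB t ht x hx') (hV x hx)
    rw [abs_mul, abs_of_nonneg (hΦ.nonneg hψ x)]
    refine (mul_le_mul (hΦ.le x) h1 (abs_nonneg _)
      ((hΦ.nonneg hψ x).trans (hΦ.le x))).trans (le_of_eq ?_)
    ring
  · have h0 := hψ.eq_zero hx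
    have h1 : Φ x = 0 := by
      by_contra hne
      exact hΦ.support_subset hne h0
    simp [h0, h1]

theorem SmoothMHD.abs_integral_hess_le (h : SmoothMHD T ϱ U B)
    (hψ : IsIntegralCutoff C₀ ρ R₀ ψ₀) (hϱ : 2 * R₀ < ϱ) (hρ : 3 / 4 < ρ)
    (hΦ : IsSumCutoff C₀ ρ R K ψ₀ Φ) (ht : t ∈ Ioo 0 T) :
    |∑ l, ∫ x, pdx l (pdx l Φ) x * enst U B t x|
      ≤ 3 * (K * (C₀ / R ^ 2) * ∫ x, ψ₀ x ^ (2 * ρ - 1) * enst U B t x) := by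
  have i1 := hψ.integrable_rpow_mul hϱ
    ((Sm.enst h.smU h.smB).slice (Ioo_subset_Ioc_self ht)).continuousOn
    (show 0 < 2 * ρ - 1 by linarith)
  refine (Finset.abs_sum_le_sum_abs _ _).trans
    ((Finset.sum_le_card_nsmul _ _ _ fun l _ => ?_).trans_eq (by rw [nsmul_eq_mul]; rfl))
  rw [← integral_const_mul]
  refine abs_integral_le_integral_of_abs_le (i1.const_mul _) fun x => ?_
  rw [abs_mul, abs_of_nonneg (enst_nonneg U B t x), ← mul_assoc]
  exact mul_le_mul_of_nonneg_right (hΦ.hess l x) (enst_nonneg U B t x)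

theorem SmoothMHD.abs_integral_cross_le (h : SmoothMHD T ϱ U B)
    (hψ : IsIntegralCutoff C₀ ρ R₀ ψ₀) (hϱ : 2 * R₀ < ϱ) (hρ : 3 / 4 < ρ) (hρ' : ρ < 1)
    (hC₀ : 0 < C₀) (hR : 0 < R) (hK : 0 ≤ K) (hΦ : IsSumCutoff C₀ ρ R K ψ₀ Φ) (ha : 0 < a)
    (ht : t ∈ Ioo 0 T)
    (hV : ∀ x ∈ ball (0 : E3) (2 * R₀), ∀ l k, pd l (U k) t x ^ 2 ≤ V) :
    |∑ l, ∫ x, pdx l Φ x * (B l t x * cross U B t x)|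
      ≤ K * (C₀ / R) * (12 * (a * V * ∫ x, ψ₀ x * enst U B t x)
        + 3 * (a⁻¹ * ∫ x, ψ₀ x ^ (4 * ρ - 3) * kin U B t x)) := by
  have ht' := Ioo_subset_Ioc_self ht
  have i1 := hψ.integrable_mul hϱ ((Sm.enst h.smU h.smB).slice ht').continuousOn
  have i2 := hψ.integrable_rpow_mul hϱ ((Sm.kin h.smU h.smB).slice ht').continuousOn
    (show 0 < 4 * ρ - 3 by linarith)
  have i3 : ∀ l, Integrable fun x => pdx l Φ x * (B l t x * cross U B t x) := fun l =>
    integrable_cutoff_mul isOpen_ball (hΦ.smooth.pdx l).continuous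
      ((hΦ.compact hψ).fderiv_apply ℝ (e l)) ((tsupport_pdx_subset l).trans
        (hΦ.tsupport_subset hψ hϱ))
      (((h.smB l).mul (Sm.cross h.smU h.smB)).slice ht').continuousOn
  rw [← integral_finsetSum _ fun l _ => i3 l]
  simp only [← integral_const_mul]
  rw [← integral_add ((i1.const_mul _).const_mul _) ((i2.const_mul _).const_mul _),
    ← integral_const_mul]
  refine abs_integral_le_integral_of_abs_le
    ((((i1.const_mul _).const_mul _).add ((i2.const_mul _).const_mul _)).const_mul _) fun x => ?_
  have hs := hψ.refined.nonneg x
  have hD : 0 ≤ K * (C₀ / R) := by positivity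
  by_cases hx : x ∈ ball (0 : E3) (2 * R₀)
  · have hW : ∀ i, crlc U i t x ^ 2 ≤ 4 * V := by
      intro i
      have h1 := hV x hx (i + 1) (i + 2)
      have h2 := hV x hx (i + 2) (i + 1)
      have h3 : crlc U i t x = pd (i + 1) (U (i + 2)) t x - pd (i + 2) (U (i + 1)) t x := rfl
      rw [h3]
      nlinarith [sq_nonneg (pd (i + 1) (U (i + 2)) t x + pd (i + 2) (U (i + 1)) t x)]
    have key : ∀ l i, |pdx l Φ x * (crlc U i t x * (crlc B i t x * B l t x))|
        ≤ K * (C₀ / R) * ((a * (4 * V) * (ψ₀ x * crlc B i t x ^ 2)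
          + a⁻¹ * (ψ₀ x ^ (4 * ρ - 3) * B l t x ^ 2)) / 2) := by
      intro l i
      rw [abs_mul]
      refine (mul_le_mul_of_nonneg_right (hΦ.grad l x) (abs_nonneg _)).trans ?_
      rw [mul_assoc]
      refine mul_le_mul_of_nonneg_left ?_ hD
      refine (rpow_mul_abs_le hs (by linarith) ha (hW i)).trans ?_
      have := hψ.rpow_anti (s := 4 * ρ - 3) (r := 2 * ρ - 1) (by linarith) (by linarith) x
      gcongr
    rw [show ∑ l, pdx l Φ x * (B l t x * cross U B t x)
      = ∑ l, ∑ i, pdx l Φ x * (crlc U i t x * (crlc B i t x * B l t x)) from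
        Finset.sum_congr rfl fun l _ => by
          rw [cross, Finset.mul_sum, Finset.mul_sum]
          exact Finset.sum_congr rfl fun i _ => by ring]
    refine (Finset.abs_sum_le_sum_abs _ _).trans ((Finset.sum_le_sum fun l _ =>
      (Finset.abs_sum_le_sum_abs _ _).trans (Finset.sum_le_sum fun i _ => key l i)).trans ?_)
    simp only [← Finset.mul_sum]
    refine mul_le_mul_of_nonneg_left ?_ hD
    have hV0 : 0 ≤ V := (sq_nonneg _).trans (hV x hx 0 0)
    have hpos : 0 ≤ 6 * (a * V * (ψ₀ x * ∑ i, crlc U i t x ^ 2))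
        + 3 / 2 * (a⁻¹ * (ψ₀ x ^ (4 * ρ - 3) * ∑ i, U i t x ^ 2)) := by
      have h1 : 0 ≤ ∑ i, crlc U i t x ^ 2 := Finset.sum_nonneg fun _ _ => sq_nonneg _
      have h2 : 0 ≤ ∑ i, U i t x ^ 2 := Finset.sum_nonneg fun _ _ => sq_nonneg _
      have h3 := Real.rpow_nonneg hs (4 * ρ - 3)
      positivity
    rw [← sub_nonneg]
    refine hpos.trans_eq ?_
    simp only [enst, kin, Fin.sum_univ_three]
    ring
  · have h0 := hψ.eq_zero hx
    have h1 : ∀ l, pdx l Φ x = 0 := fun l => by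
      have := hΦ.grad l x
      rw [h0, Real.zero_rpow (by linarith), mul_zero] at this
      exact abs_nonpos_iff.1 this
    simp [h0, h1, Real.zero_rpow (show 4 * ρ - 3 ≠ 0 by linarith)]

/-- The gradient of a solenoidal field is controlled by its curl, up to a term of lower order. -/
theorem integral_gradient_le_curl {F : Fin 3 → ℝ → E3 → ℝ} (hF : ∀ k, Sm T ϱ (F k))
    (hdiv : ∀ x ∈ ball (0 : E3) ϱ, ∑ l, pd l (F l) t x = 0)
    (hψ : IsIntegralCutoff C₀ ρ R₀ ψ₀) (hϱ : 2 * R₀ < ϱ) (hρ : 3 / 4 < ρ) (hρ' : ρ < 1)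
    (hC₀ : 0 < C₀) (hR₀ : 0 < R₀) (ht : t ∈ Ioo 0 T) :
    ∫ x, ψ₀ x * ∑ k, ∑ l, pd l (F k) t x ^ 2 ≤ 2 * (∫ x, ψ₀ x * ∑ i, crlc F i t x ^ 2)
      + 3 * ((C₀ / R₀) ^ 2 * ∫ x, ψ₀ x ^ (4 * ρ - 3) * ∑ k, F k t x ^ 2) := by
  have ht' := Ioo_subset_Ioc_self ht
  have hsm := hψ.refined.smooth
  have ic : ∀ {k : ℝ → E3 → ℝ}, Sm T ϱ k → Integrable fun x => ψ₀ x * k t x :=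
    fun hk => hψ.integrable_mul hϱ (hk.slice ht').continuousOn
  have id : ∀ l, ∀ {k : ℝ → E3 → ℝ}, Sm T ϱ k → Integrable fun x => pdx l ψ₀ x * k t x :=
    fun l k hk => integrable_cutoff_mul isOpen_ball (hsm.pdx l).continuous
      (hψ.refined.compact.fderiv_apply ℝ (e l)) ((tsupport_pdx_subset l).trans
        (hψ.tsupport_subset hϱ)) (hk.slice ht').continuousOn
  have i1 := ic (Sm.sum (s := Finset.univ) fun k _ => Sm.sum (s := Finset.univ) fun l _ =>
    ((hF k).pd l).pow 2)
  have i2 := ic (Sm.sum (s := Finset.univ) fun i _ => (Sm.crl hF (i + 1) (i + 2)).pow 2)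
  have i3 := hψ.integrable_rpow_mul hϱ
    ((Sm.sum (s := Finset.univ) fun k _ => (hF k).pow 2).slice ht').continuousOn
    (show 0 < 4 * ρ - 3 by linarith)
  -- the mixed products integrate to a term without second derivatives, as the field is solenoidal
  have mixed : ∫ x, ψ₀ x * ∑ k, ∑ l, pd l (F k) t x * pd k (F l) t x
      = - ∫ x, ∑ l, ∑ k, pdx l ψ₀ x * (F k t x * pd k (F l) t x) := by
    have h1 : ∀ l k, ∫ x, ψ₀ x * pdx l (fun y => F k t y * pd k (F l) t y) x
        = - ∫ x, pdx l ψ₀ x * (F k t x * pd k (F l) t x) := fun l k =>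
      integral_cutoff_mul_pdx isOpen_ball hsm hψ.refined.compact (hψ.tsupport_subset hϱ)
        (((hF k).mul ((hF l).pd k)).slice ht') l
    have h2 : ∀ l k, Integrable fun x => ψ₀ x * pdx l (fun y => F k t y * pd k (F l) t y) x :=
      fun l k => ic (((hF k).mul ((hF l).pd k)).pd l)
    have h3 : ∀ l k, Integrable fun x => pdx l ψ₀ x * (F k t x * pd k (F l) t x) :=
      fun l k => id l ((hF k).mul ((hF l).pd k))
    have h4 : ∫ x, ψ₀ x * ∑ k, ∑ l, pd l (F k) t x * pd k (F l) t x
        = ∫ x, ∑ l, ∑ k, ψ₀ x * pdx l (fun y => F k t y * pd k (F l) t y) x := by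
      congr 1 with x
      by_cases hx : x ∈ ball (0 : E3) ϱ
      · have e1 : ∀ l k, pdx l (fun y => F k t y * pd k (F l) t y) x
            = pd l (F k) t x * pd k (F l) t x + F k t x * pd l (pd k (F l)) t x := fun l k =>
          (pdx_mul l ((hF k).differentiableAt ht' hx)
            (((hF l).pd k).differentiableAt ht' hx)).trans (by simp only [pd]; ring)
        have e2 : ∀ k, ∑ l, pd l (pd k (F l)) t x = 0 := fun k => by
          have s1 : pdx k (fun y => ∑ l, pd l (F l) t y) x = 0 := by
            rw [pdx_congr k (g := fun _ => 0) isOpen_ball (fun y hy => hdiv y hy) hx]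
            simp [pdx]
          rw [pdx_sum _ k fun l _ => ((hF l).pd l).differentiableAt ht' hx] at s1
          rw [← s1]
          exact Finset.sum_congr rfl fun l _ => (hF l).pd_comm ht' hx l k
        have e3 : ∑ k, F k t x * ∑ l, pd l (pd k (F l)) t x = 0 :=
          Finset.sum_eq_zero fun k _ => by rw [e2 k, mul_zero]
        simp only [e1, ← Finset.mul_sum, Finset.sum_add_distrib]
        simp only [Finset.mul_sum] at e3
        rw [Finset.sum_comm (f := fun l k => F k t x * pd l (pd k (F l)) t x), e3, add_zero,
          Finset.sum_comm]
      · have : x ∉ tsupport ψ₀ := fun h => hx (hψ.tsupport_subset hϱ h)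
        simp [image_eq_zero_of_notMem_tsupport this]
    rw [h4, integral_finsetSum _ fun l _ => integrable_finsetSum _ fun k _ => h2 l k,
      integral_finsetSum _ fun l _ => integrable_finsetSum _ fun k _ => h3 l k,
      ← Finset.sum_neg_distrib]
    refine Finset.sum_congr rfl fun l _ => ?_
    rw [integral_finsetSum _ fun k _ => h2 l k, integral_finsetSum _ fun k _ => h3 l k,
      ← Finset.sum_neg_distrib]
    exact Finset.sum_congr rfl fun k _ => h1 l k
  have i4 := ic (Sm.sum (s := Finset.univ) fun k _ => Sm.sum (s := Finset.univ) fun l _ =>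
    ((hF k).pd l).mul ((hF l).pd k))
  have split : ∫ x, ψ₀ x * ∑ k, ∑ l, pd l (F k) t x ^ 2
      = (∫ x, ψ₀ x * ∑ i, crlc F i t x ^ 2)
        + ∫ x, ψ₀ x * ∑ k, ∑ l, pd l (F k) t x * pd k (F l) t x := by
    rw [← integral_add i2 i4]
    congr 1 with x
    simp only [crl, Fin.sum_univ_three, Fin.isValue, Fin.reduceAdd]
    ring
  have bound : |∫ x, ∑ l, ∑ k, pdx l ψ₀ x * (F k t x * pd k (F l) t x)|
      ≤ (∫ x, ψ₀ x * ∑ k, ∑ l, pd l (F k) t x ^ 2) / 2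
        + 3 / 2 * ((C₀ / R₀) ^ 2 * ∫ x, ψ₀ x ^ (4 * ρ - 3) * ∑ k, F k t x ^ 2) := by
    rw [← integral_div, ← integral_const_mul, ← integral_const_mul,
      ← integral_add (i1.div_const _) ((i3.const_mul _).const_mul _)]
    refine abs_integral_le_integral_of_abs_le
      ((i1.div_const _).add ((i3.const_mul _).const_mul _)) fun x => ?_
    have hs := hψ.refined.nonneg x
    have hD : 0 < C₀ / R₀ := by positivity
    have key : ∀ l k, |pdx l ψ₀ x * (F k t x * pd k (F l) t x)|
        ≤ (ψ₀ x * pd k (F l) t x ^ 2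
          + (C₀ / R₀) ^ 2 * (ψ₀ x ^ (4 * ρ - 3) * F k t x ^ 2)) / 2 := by
      intro l k
      rw [abs_mul]
      refine (mul_le_mul_of_nonneg_right (hψ.refined.grad_le x l) (abs_nonneg _)).trans ?_
      have h1 := rpow_mul_abs_le (x := pd k (F l) t x) (y := F k t x) hs
        (show 1 / 2 < ρ by linarith) (inv_pos.2 hD) (show (1 : ℝ) ^ 2 ≤ 1 by norm_num)
      rw [one_mul, mul_one, inv_inv] at h1
      have h2 := hψ.rpow_anti (s := 4 * ρ - 3) (r := 2 * ρ - 1) (by linarith) (by linarith) x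
      rw [mul_assoc, mul_comm (F k t x)]
      refine (mul_le_mul_of_nonneg_left h1 hD.le).trans ?_
      have h3 : C₀ / R₀ * (((C₀ / R₀)⁻¹ * (ψ₀ x * pd k (F l) t x ^ 2)
          + C₀ / R₀ * (ψ₀ x ^ (2 * ρ - 1) * F k t x ^ 2)) / 2)
          = (ψ₀ x * pd k (F l) t x ^ 2
            + (C₀ / R₀) ^ 2 * (ψ₀ x ^ (2 * ρ - 1) * F k t x ^ 2)) / 2 := by
        field_simp
      rw [h3]
      gcongr
    refine (Finset.abs_sum_le_sum_abs _ _).trans ((Finset.sum_le_sum fun l _ =>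
      (Finset.abs_sum_le_sum_abs _ _).trans (Finset.sum_le_sum fun k _ => key l k)).trans_eq ?_)
    simp only [Fin.sum_univ_three]
    ring
  have := (abs_le.1 bound).1
  rw [mixed] at split
  linarith

theorem SmoothMHD.integral_grd_le (h : SmoothMHD T ϱ U B)
    (hψ : IsIntegralCutoff C₀ ρ R₀ ψ₀) (hϱ : 2 * R₀ < ϱ) (hρ : 3 / 4 < ρ) (hρ' : ρ < 1)
    (hC₀ : 0 < C₀) (hR₀ : 0 < R₀) (ht : t ∈ Ioo 0 T) :
    ∫ x, ψ₀ x * grd U B t x ≤ 4 * (∫ x, ψ₀ x * enst U B t x)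
      + 6 * ((C₀ / R₀) ^ 2 * ∫ x, ψ₀ x ^ (4 * ρ - 3) * kin U B t x) := by
  have ht' := Ioo_subset_Ioc_self ht
  have ic : ∀ {k : ℝ → E3 → ℝ}, Sm T ϱ k → Integrable fun x => ψ₀ x * k t x :=
    fun hk => hψ.integrable_mul hϱ (hk.slice ht').continuousOn
  have iK : ∀ {F : Fin 3 → ℝ → E3 → ℝ}, (∀ k, Sm T ϱ (F k)) →
      Integrable fun x => ψ₀ x ^ (4 * ρ - 3) * ∑ k, F k t x ^ 2 := fun hF =>
    hψ.integrable_rpow_mul hϱ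
      ((Sm.sum (s := Finset.univ) fun k _ => (hF k).pow 2).slice ht').continuousOn (by linarith)
  have iG : ∀ {F : Fin 3 → ℝ → E3 → ℝ}, (∀ k, Sm T ϱ (F k)) →
      Integrable fun x => ψ₀ x * ∑ k, ∑ l, pd l (F k) t x ^ 2 := fun hF =>
    ic (Sm.sum (s := Finset.univ) fun k _ => Sm.sum (s := Finset.univ) fun l _ =>
      ((hF k).pd l).pow 2)
  have iC : ∀ {F : Fin 3 → ℝ → E3 → ℝ}, (∀ k, Sm T ϱ (F k)) →
      Integrable fun x => ψ₀ x * ∑ i, crlc F i t x ^ 2 := fun hF =>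
    ic (Sm.sum (s := Finset.univ) fun i _ => (Sm.crl hF (i + 1) (i + 2)).pow 2)
  have h1 := integral_gradient_le_curl h.smU (h.divU t ht) hψ hϱ hρ hρ' hC₀ hR₀ ht
  have h2 := integral_gradient_le_curl h.smB (h.divB t ht) hψ hϱ hρ hρ' hC₀ hR₀ ht
  have e1 : ∫ x, ψ₀ x * grd U B t x = (∫ x, ψ₀ x * ∑ k, ∑ l, pd l (U k) t x ^ 2)
      + ∫ x, ψ₀ x * ∑ k, ∑ l, pd l (B k) t x ^ 2 := by
    rw [← integral_add (iG h.smU) (iG h.smB)]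
    congr 1 with x
    simp only [grd, Finset.sum_add_distrib]
    ring
  have e2 : 2 * ∫ x, ψ₀ x * enst U B t x = (∫ x, ψ₀ x * ∑ i, crlc U i t x ^ 2)
      + ∫ x, ψ₀ x * ∑ i, crlc B i t x ^ 2 := by
    rw [← integral_add (iC h.smU) (iC h.smB), ← integral_const_mul]
    congr 1 with x
    simp only [enst, ← Finset.mul_sum, Finset.sum_add_distrib]
    ring
  have e3 : 2 * ∫ x, ψ₀ x ^ (4 * ρ - 3) * kin U B t x
      = (∫ x, ψ₀ x ^ (4 * ρ - 3) * ∑ k, U k t x ^ 2)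
        + ∫ x, ψ₀ x ^ (4 * ρ - 3) * ∑ k, B k t x ^ 2 := by
    rw [← integral_add (iK h.smU) (iK h.smB), ← integral_const_mul]
    congr 1 with x
    simp only [kin, ← Finset.mul_sum, Finset.sum_add_distrib]
    ring
  have e4 : 6 * ((C₀ / R₀) ^ 2 * ∫ x, ψ₀ x ^ (4 * ρ - 3) * kin U B t x)
      = 3 * ((C₀ / R₀) ^ 2 * (2 * ∫ x, ψ₀ x ^ (4 * ρ - 3) * kin U B t x)) := by ring
  rw [e4, e3]
  linarith

end Slices

end Cutoffs

/-! ### The flux through a summed cut-off -/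

theorem abs_setIntegral_le_of_abs_le {T : ℝ} {f g : ℝ → ℝ} (hg : IntegrableOn g (Ioo 0 T))
    (h : ∀ᵐ t ∂(volume.restrict (Ioo 0 T)), |f t| ≤ g t) :
    |∫ t in Ioo 0 T, f t| ≤ ∫ t in Ioo 0 T, g t :=
  norm_integral_le_of_norm_le (f := f) hg h

/-- The dissipation plus the final enstrophy, localized by `Φ`: the quantity that the flux through
`Φ` has to balance. -/
def dissip (T : ℝ) (η : ℝ → ℝ) (U B : Fin 3 → ℝ → E3 → ℝ) (Φ : E3 → ℝ) : ℝ :=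
  (∫ t in Ioo 0 T, η t * ∫ x, Φ x * palin U B t x) + ∫ x, Φ x * enst U B T x

/-- The inward flux of the enstrophy through `Φ`, integrated in time. -/
def flux (T : ℝ) (η : ℝ → ℝ) (U B : Fin 3 → ℝ → E3 → ℝ) (Φ : E3 → ℝ) : ℝ :=
  ∫ t in Ioo 0 T, η t * ∑ l, ∫ x, pdx l Φ x * (U l t x * enst U B t x)

/-- The constant in the estimate of `dissip - flux`. -/
def errConst (C₀ κ Q : ℝ) : ℝ :=
  C₀ * (κ / 4 + 6 + 12 * Q) + 18 * Q + 6 + 18 * C₀ ^ 2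

section

variable {C₀ ρ R₀ ϱ T R K δ : ℝ} {ψ₀ : E3 → ℝ} {U B : Fin 3 → ℝ → E3 → ℝ} {Φ : E3 → ℝ}
  {η V : ℝ → ℝ}

theorem IsTimeCutoff.setIntegral_mono (hη : IsTimeCutoff C₀ δ T η) (hT : 0 < T) {k k' : ℝ → ℝ}
    (hk : ContinuousOn k (Ioc 0 T)) (hk' : ContinuousOn k' (Ioc 0 T))
    (h : ∀ t ∈ Ioo 0 T, k t ≤ k' t) :
    ∫ t in Ioo 0 T, η t * k t ≤ ∫ t in Ioo 0 T, η t * k' t :=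
  setIntegral_mono_on (hη.integrableOn_mul hT hk) (hη.integrableOn_mul hT hk') measurableSet_Ioo
    fun t ht => mul_le_mul_of_nonneg_left (h t ht) (hη.nonneg t ht)

theorem SmoothMHD.dissip_bounds (h : SmoothMHD T ϱ U B) (hT : 0 < T)
    (hη : IsTimeCutoff C₀ δ T η) (hψ : IsIntegralCutoff C₀ ρ R₀ ψ₀) (hϱ : 2 * R₀ < ϱ)
    (hΦ : IsSumCutoff C₀ ρ R K ψ₀ Φ) :
    dissip T η U B ψ₀ ≤ dissip T η U B Φ ∧ dissip T η U B Φ ≤ K * dissip T η U B ψ₀ := by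
  have hP := Sm.palin h.smU h.smB
  have hE := Sm.enst h.smU h.smB
  have hTm : T ∈ Ioc 0 T := ⟨hT, le_rfl⟩
  have c1 := continuousOn_integral_cutoff hψ.refined.smooth.continuous hψ.refined.compact
    (hψ.tsupport_subset hϱ) hP.continuousOn
  have c2 := continuousOn_integral_cutoff hΦ.smooth.continuous (hΦ.compact hψ)
    (hΦ.tsupport_subset hψ hϱ) hP.continuousOn
  have b1 := fun t ht => hΦ.integral_bounds hψ hϱ (hP.slice (Ioo_subset_Ioc_self ht)).continuousOn
    (palin_nonneg U B t)
  have b2 := hΦ.integral_bounds hψ hϱ (hE.slice hTm).continuousOn (enst_nonneg U B T)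
  have m1 := hη.setIntegral_mono hT c1 c2 fun t ht => (b1 t ht).1
  have m2 := hη.setIntegral_mono hT c2 (c1.const_mul K) fun t ht => (b1 t ht).2
  have e : ∫ t in Ioo 0 T, η t * (K * ∫ x, ψ₀ x * palin U B t x)
      = K * ∫ t in Ioo 0 T, η t * ∫ x, ψ₀ x * palin U B t x := by
    rw [← integral_const_mul]
    congr 1 with t
    ring
  rw [e] at m2
  simp only [dissip]
  constructor
  · linarith [b2.1]
  · rw [mul_add]
    linarith [b2.2]

theorem integral_neg_add_add_sub_add {μ : Measure ℝ} {p q r s w : ℝ → ℝ} (hp : Integrable p μ)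
    (hq : Integrable q μ) (hr : Integrable r μ) (hs : Integrable s μ) (hw : Integrable w μ) :
    ∫ t, (-p t + q t + r t - s t + w t) ∂μ
      = -(∫ t, p t ∂μ) + (∫ t, q t ∂μ) + (∫ t, r t ∂μ) - (∫ t, s t ∂μ) + ∫ t, w t ∂μ := by
  have j0 : Integrable (fun t => -p t) μ := hp.neg
  have j1 : Integrable (fun t => -p t + q t) μ := j0.add hq
  have j2 : Integrable (fun t => -p t + q t + r t) μ := j1.add hr
  have j3 : Integrable (fun t => -p t + q t + r t - s t) μ := j2.sub hs
  rw [integral_add j3 hw, integral_sub j2 hs, integral_add j1 hr, integral_add j0 hq, integral_neg]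

/-- The localized enstrophy balance, integrated in time, up to the error terms. -/
theorem SmoothMHD.dissip_sub_flux (h : SmoothMHD T ϱ U B) (hT : 0 < T) (hC₀ : 0 < C₀) (hδ : 0 < δ)
    (hη : IsTimeCutoff C₀ δ T η) (hψ : IsIntegralCutoff C₀ ρ R₀ ψ₀) (hϱ : 2 * R₀ < ϱ)
    (hΦ : IsSumCutoff C₀ ρ R K ψ₀ Φ) :
    dissip T η U B Φ - flux T η U B Φ = (∫ t in Ioo 0 T, deriv η t * ∫ x, Φ x * enst U B t x)
      + (∫ t in Ioo 0 T, η t * ∑ l, ∫ x, pdx l (pdx l Φ) x * enst U B t x)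
      - (∫ t in Ioo 0 T, η t * ∑ l, ∫ x, pdx l Φ x * (B l t x * cross U B t x))
      + ∫ t in Ioo 0 T, η t * ∫ x, Φ x * stretch U B t x := by
  have hc := hΦ.compact hψ
  have hs := hΦ.tsupport_subset hψ hϱ
  have hE := Sm.enst h.smU h.smB
  have cd : ∀ l, HasCompactSupport (pdx l Φ) := fun l => hc.fderiv_apply ℝ (e l)
  have sd : ∀ l, tsupport (pdx l Φ) ⊆ ball 0 ϱ := fun l => (tsupport_pdx_subset l).trans hs
  have c0 := continuousOn_integral_cutoff hΦ.smooth.continuous hc hs hE.continuousOn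
  have key := hη.eval_eq_integral hC₀ hT hδ c0 (continuousOn_enstRate h hΦ.smooth hc hs)
    fun t ht => h.hasDerivAt_enstrophy hΦ.smooth hc hs ht
  have c1 := continuousOn_integral_cutoff hΦ.smooth.continuous hc hs
    (Sm.palin h.smU h.smB).continuousOn
  have c2 : ContinuousOn (fun t => ∑ l, ∫ x, pdx l (pdx l Φ) x * enst U B t x) (Ioc 0 T) :=
    continuousOn_finsetSum _ fun l _ => continuousOn_integral_cutoff
      ((hΦ.smooth.pdx l).pdx l).continuous ((cd l).fderiv_apply ℝ (e l))
      ((tsupport_pdx_subset l).trans (sd l)) hE.continuousOn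
  have c3 : ContinuousOn (fun t => ∑ l, ∫ x, pdx l Φ x * (U l t x * enst U B t x)) (Ioc 0 T) :=
    continuousOn_finsetSum _ fun l _ => continuousOn_integral_cutoff
      (hΦ.smooth.pdx l).continuous (cd l) (sd l) ((h.smU l).mul hE).continuousOn
  have c4 : ContinuousOn (fun t => ∑ l, ∫ x, pdx l Φ x * (B l t x * cross U B t x)) (Ioc 0 T) :=
    continuousOn_finsetSum _ fun l _ => continuousOn_integral_cutoff
      (hΦ.smooth.pdx l).continuous (cd l) (sd l)
      ((h.smB l).mul (Sm.cross h.smU h.smB)).continuousOn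
  have c5 := continuousOn_integral_cutoff hΦ.smooth.continuous hc hs
    (Sm.stretch h.smU h.smB).continuousOn
  have i1 := hη.integrableOn_mul hT c1
  have i2 := hη.integrableOn_mul hT c2
  have i3 := hη.integrableOn_mul hT c3
  have i4 := hη.integrableOn_mul hT c4
  have i5 := hη.integrableOn_mul hT c5
  have split : ∫ t in Ioo 0 T, η t * enstRate U B Φ t
      = - (∫ t in Ioo 0 T, η t * ∫ x, Φ x * palin U B t x)
        + (∫ t in Ioo 0 T, η t * ∑ l, ∫ x, pdx l (pdx l Φ) x * enst U B t x)
        + (∫ t in Ioo 0 T, η t * ∑ l, ∫ x, pdx l Φ x * (U l t x * enst U B t x))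
        - (∫ t in Ioo 0 T, η t * ∑ l, ∫ x, pdx l Φ x * (B l t x * cross U B t x))
        + ∫ t in Ioo 0 T, η t * ∫ x, Φ x * stretch U B t x := by
    have e : ∀ t, η t * enstRate U B Φ t = -(η t * ∫ x, Φ x * palin U B t x)
        + (η t * ∑ l, ∫ x, pdx l (pdx l Φ) x * enst U B t x)
        + (η t * ∑ l, ∫ x, pdx l Φ x * (U l t x * enst U B t x))
        - (η t * ∑ l, ∫ x, pdx l Φ x * (B l t x * cross U B t x))
        + η t * ∫ x, Φ x * stretch U B t x := fun t => by
      simp only [enstRate]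
      ring
    simp only [e]
    exact integral_neg_add_add_sub_add i1 i2 i3 i4 i5
  rw [split] at key
  simp only [dissip, flux]
  linarith

/-- Under the scale separation `σ ≤ β R` the flux through a summed cut-off agrees with the
dissipation up to a fraction of order `β` of the total dissipation `L`. -/
theorem SmoothMHD.abs_dissip_sub_flux_le (h : SmoothMHD T ϱ U B) (hT : 0 < T) (hC₀ : 0 < C₀)
    (hδ : 1 / 2 ≤ δ) (hη : IsTimeCutoff C₀ δ T η) (hψ : IsIntegralCutoff C₀ ρ R₀ ψ₀)
    (hϱ : 2 * R₀ < ϱ) (hρ : 3 / 4 < ρ) (hρ' : ρ < 1) (hR : 0 < R) (hRR : R ≤ R₀) (hK : 0 ≤ K)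
    (hΦ : IsSumCutoff C₀ ρ R K ψ₀ Φ)
    (hV : ∀ᵐ t ∂(volume.restrict (Ioo 0 T)), ∀ x ∈ ball (0 : E3) (2 * R₀), ∀ l k,
      pd l (U k) t x ^ 2 ≤ V t)
    {σ β κ L Q : ℝ} (hσ : 0 ≤ σ) (hβ : 0 < β) (hβ1 : β ≤ 1) (hσβ : σ ≤ β * R) (hL : 0 ≤ L)
    (hκ : R₀ ^ 2 ≤ κ * T)
    (hmod : ∀ t ∈ Ioo 0 T, ∫ x, ψ₀ x * enst U B t x ≤ 2 * L)
    (hE : ∫ t in Ioo 0 T, η t * ∫ x, ψ₀ x ^ (2 * ρ - 1) * enst U B t x ≤ σ ^ 2 * L / 2)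
    (hkin : ∫ t in Ioo 0 T, η t * ∫ x, ψ₀ x ^ (4 * ρ - 3) * kin U B t x ≤ σ ^ 4 * L)
    (hVi : IntegrableOn (fun t => η t * (V t * ∫ x, ψ₀ x * enst U B t x)) (Ioo 0 T))
    (hVQ : ∫ t in Ioo 0 T, η t * (V t * ∫ x, ψ₀ x * enst U B t x) ≤ Q * L / R₀ ^ 2) :
    |dissip T η U B Φ - flux T η U B Φ| ≤ K * errConst C₀ κ Q * β * L := by
  have hR₀ : 0 < R₀ := hR.trans_le hRR
  have hσβ₀ : σ ≤ β * R₀ := hσβ.trans (by gcongr)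
  set g : ℝ → ℝ := fun t => ∫ x, ψ₀ x * enst U B t x with hg
  set g₁ : ℝ → ℝ := fun t => ∫ x, ψ₀ x ^ (2 * ρ - 1) * enst U B t x with hg₁
  set k : ℝ → ℝ := fun t => ∫ x, ψ₀ x ^ (4 * ρ - 3) * kin U B t x with hk
  have e₁ : 0 < 2 * ρ - 1 := by linarith
  have e₂ : 0 < 4 * ρ - 3 := by linarith
  have smE := Sm.enst h.smU h.smB
  have cg : ContinuousOn g (Ioc 0 T) := continuousOn_integral_cutoff
    hψ.refined.smooth.continuous hψ.refined.compact (hψ.tsupport_subset hϱ) smE.continuousOn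
  have cg₁ : ContinuousOn g₁ (Ioc 0 T) := continuousOn_integral_cutoff
    (hψ.continuous_rpow e₁) (hψ.compact_rpow e₁) (hψ.tsupport_rpow_subset hϱ e₁) smE.continuousOn
  have ck : ContinuousOn k (Ioc 0 T) := continuousOn_integral_cutoff
    (hψ.continuous_rpow e₂) (hψ.compact_rpow e₂) (hψ.tsupport_rpow_subset hϱ e₂)
    (Sm.kin h.smU h.smB).continuousOn
  have ig := hη.integrableOn_mul hT cg
  have ig₁ := hη.integrableOn_mul hT cg₁
  have ik := hη.integrableOn_mul hT ck
  have gg : ∫ t in Ioo 0 T, η t * g t ≤ σ ^ 2 * L / 2 := by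
    refine (hη.setIntegral_mono hT cg cg₁ fun t ht => ?_).trans hE
    have hc := (smE.slice (Ioo_subset_Ioc_self ht)).continuousOn
    exact integral_mono (hψ.integrable_mul hϱ hc) (hψ.integrable_rpow_mul hϱ hc e₁) fun x =>
      mul_le_mul_of_nonneg_right (hψ.le_rpow e₁ (by linarith) x) (enst_nonneg U B t x)
  have g0 : ∀ t, 0 ≤ g t := fun t =>
    integral_nonneg fun x => mul_nonneg (hψ.refined.nonneg x) (enst_nonneg U B t x)
  have hσ2 : σ ^ 2 ≤ β ^ 2 * R ^ 2 := by
    rw [← mul_pow]; gcongr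
  have hσ2' : σ ^ 2 ≤ β ^ 2 * R₀ ^ 2 := by
    rw [← mul_pow]; gcongr
  have hσ4 : σ ^ 4 ≤ β ^ 4 * (R ^ 2 * R₀ ^ 2) := by
    calc σ ^ 4 = σ ^ 2 * σ ^ 2 := by ring
      _ ≤ (β ^ 2 * R ^ 2) * (β ^ 2 * R₀ ^ 2) := by gcongr
      _ = _ := by ring
  have hβ2 : β ^ 2 ≤ β := by nlinarith
  have hβ3 : β ^ 3 ≤ β := by nlinarith
  have aeT := ae_restrict_mem (μ := (volume : Measure ℝ)) (measurableSet_Ioo (a := 0) (b := T))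
  -- the temporal cut-off
  have t1 : |∫ t in Ioo 0 T, deriv η t * ∫ x, Φ x * enst U B t x|
      ≤ K * (C₀ * (κ / 4 + 1)) * β * L := by
    have hi : IntegrableOn (fun t => K * (C₀ / T) / 2 * (β⁻¹ * (η t * g t) + β * (2 * L)))
        (Ioo 0 T) := ((ig.const_mul _).add (integrable_const _)).const_mul _
    refine (abs_setIntegral_le_of_abs_le hi ?_).trans ?_
    · filter_upwards [aeT] with t ht
      have b := hΦ.integral_bounds hψ hϱ (smE.slice (Ioo_subset_Ioc_self ht)).continuousOn
        (enst_nonneg U B t)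
      have hη0 := hη.nonneg t ht
      have hD : |deriv η t| ≤ C₀ / T * ((β⁻¹ * η t + β) / 2) := by
        refine (hη.deriv_le t ht).trans (mul_le_mul_of_nonneg_left ?_ (by positivity))
        have h1 : η t ^ δ ≤ √(η t) := by
          rw [Real.sqrt_eq_rpow]
          rcases hη0.eq_or_lt with h0 | h0
          · rw [← h0, Real.zero_rpow (by linarith), Real.zero_rpow (by norm_num)]
          · exact Real.rpow_le_rpow_of_exponent_ge h0 (hη.le_one t ht) hδ
        have h2 := abs_mul_le_weighted (x := √(η t)) (y := 1) (inv_pos.2 hβ)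
        rw [mul_one, Real.sq_sqrt hη0, inv_inv, one_pow, mul_one] at h2
        exact h1.trans ((le_abs_self _).trans h2)
      have hb0 : 0 ≤ ∫ x, Φ x * enst U B t x := (g0 t).trans b.1
      rw [abs_mul, abs_of_nonneg hb0]
      calc |deriv η t| * ∫ x, Φ x * enst U B t x
          ≤ (C₀ / T * ((β⁻¹ * η t + β) / 2)) * (K * g t) :=
            mul_le_mul hD b.2 hb0 (by positivity)
        _ = K * (C₀ / T) / 2 * (β⁻¹ * (η t * g t) + β * g t) := by ring
        _ ≤ K * (C₀ / T) / 2 * (β⁻¹ * (η t * g t) + β * (2 * L)) := by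
            have := hmod t ht
            gcongr
    · rw [integral_const_mul, integral_add (ig.const_mul _) (integrable_const _),
        integral_const_mul, setIntegral_const, measureReal_def, Real.volume_Ioo,
        ENNReal.toReal_ofReal (by linarith), smul_eq_mul, sub_zero]
      calc K * (C₀ / T) / 2 * (β⁻¹ * (∫ t in Ioo 0 T, η t * g t) + T * (β * (2 * L)))
          ≤ K * (C₀ / T) / 2 * (β⁻¹ * ((β ^ 2 * (κ * T)) * L / 2) + T * (β * (2 * L))) := by
            have : σ ^ 2 * L / 2 ≤ (β ^ 2 * (κ * T)) * L / 2 := by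
              have : σ ^ 2 ≤ β ^ 2 * (κ * T) := hσ2'.trans (by gcongr)
              gcongr
            have := gg.trans this
            gcongr
        _ = K * (C₀ * (κ / 4 + 1)) * β * L := by
            field_simp
            ring
  -- the Laplacian of the cut-off
  have t2 : |∫ t in Ioo 0 T, η t * ∑ l, ∫ x, pdx l (pdx l Φ) x * enst U B t x|
      ≤ K * (2 * C₀) * β * L := by
    have hi : IntegrableOn (fun t => 3 * (K * (C₀ / R ^ 2)) * (η t * g₁ t)) (Ioo 0 T) :=
      ig₁.const_mul _
    refine (abs_setIntegral_le_of_abs_le hi ?_).trans ?_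
    · filter_upwards [aeT] with t ht
      have hη0 := hη.nonneg t ht
      rw [abs_mul, abs_of_nonneg hη0]
      refine (mul_le_mul_of_nonneg_left (h.abs_integral_hess_le hψ hϱ hρ hΦ ht) hη0).trans_eq ?_
      ring
    · rw [integral_const_mul]
      calc 3 * (K * (C₀ / R ^ 2)) * ∫ t in Ioo 0 T, η t * g₁ t
          ≤ 3 * (K * (C₀ / R ^ 2)) * ((β ^ 2 * R ^ 2) * L / 2) := by
            have : σ ^ 2 * L / 2 ≤ (β ^ 2 * R ^ 2) * L / 2 := by gcongr
            have := hE.trans this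
            gcongr
        _ = K * (3 / 2 * C₀) * β ^ 2 * L := by
            field_simp
        _ ≤ K * (2 * C₀) * β * L := by
            gcongr
            norm_num
  -- the magnetic transport across the cut-off
  have t3 : |∫ t in Ioo 0 T, η t * ∑ l, ∫ x, pdx l Φ x * (B l t x * cross U B t x)|
      ≤ K * (C₀ * (12 * Q + 3)) * β * L := by
    have ha : 0 < β * R * R₀ ^ 2 := by positivity
    have hi : IntegrableOn (fun t => K * (C₀ / R) * (12 * (β * R * R₀ ^ 2) * (η t * (V t * g t))
        + 3 * (β * R * R₀ ^ 2)⁻¹ * (η t * k t))) (Ioo 0 T) :=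
      ((hVi.const_mul _).add (ik.const_mul _)).const_mul _
    refine (abs_setIntegral_le_of_abs_le hi ?_).trans ?_
    · filter_upwards [aeT, hV] with t ht hVt
      have hη0 := hη.nonneg t ht
      rw [abs_mul, abs_of_nonneg hη0]
      refine (mul_le_mul_of_nonneg_left (h.abs_integral_cross_le hψ hϱ hρ hρ' hC₀ hR hK hΦ ha ht
        hVt) hη0).trans_eq ?_
      ring
    · rw [integral_const_mul, integral_add (hVi.const_mul _) (ik.const_mul _),
        integral_const_mul, integral_const_mul]
      calc K * (C₀ / R) * (12 * (β * R * R₀ ^ 2) * (∫ t in Ioo 0 T, η t * (V t * g t))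
          + 3 * (β * R * R₀ ^ 2)⁻¹ * ∫ t in Ioo 0 T, η t * k t)
          ≤ K * (C₀ / R) * (12 * (β * R * R₀ ^ 2) * (Q * L / R₀ ^ 2)
            + 3 * (β * R * R₀ ^ 2)⁻¹ * (β ^ 4 * (R ^ 2 * R₀ ^ 2) * L)) := by
            have := hkin.trans (mul_le_mul_of_nonneg_right hσ4 hL)
            gcongr
        _ = K * C₀ * (12 * Q * β + 3 * β ^ 3) * L := by
            field_simp
        _ ≤ K * C₀ * (12 * Q * β + 3 * β) * L := by
            gcongr
        _ = K * (C₀ * (12 * Q + 3)) * β * L := by ring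
  -- the stretching terms
  have t4 : |∫ t in Ioo 0 T, η t * ∫ x, Φ x * stretch U B t x|
      ≤ K * (18 * Q + 6 + 18 * C₀ ^ 2) * β * L := by
    have ha : 0 < β * R₀ ^ 2 := by positivity
    have hj : IntegrableOn (fun t => 4 * (η t * g t) + 6 * (C₀ / R₀) ^ 2 * (η t * k t))
        (Ioo 0 T) := (ig.const_mul _).add (ik.const_mul _)
    have hi : IntegrableOn (fun t => K * (18 * (β * R₀ ^ 2) * (η t * (V t * g t))
        + 3 * (β * R₀ ^ 2)⁻¹ * (4 * (η t * g t) + 6 * (C₀ / R₀) ^ 2 * (η t * k t)))) (Ioo 0 T) :=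
      ((hVi.const_mul _).add (hj.const_mul _)).const_mul _
    refine (abs_setIntegral_le_of_abs_le hi ?_).trans ?_
    · filter_upwards [aeT, hV] with t ht hVt
      have hη0 := hη.nonneg t ht
      rw [abs_mul, abs_of_nonneg hη0]
      have h1 := h.abs_integral_stretch_le hψ hϱ hΦ ha ht hVt
      have h2 := h.integral_grd_le hψ hϱ hρ hρ' hC₀ hR₀ ht
      have h3 : K * (18 * (β * R₀ ^ 2 * V t * g t)
          + 3 * ((β * R₀ ^ 2)⁻¹ * ∫ x, ψ₀ x * grd U B t x))
          ≤ K * (18 * (β * R₀ ^ 2 * V t * g t)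
          + 3 * ((β * R₀ ^ 2)⁻¹ * (4 * g t + 6 * ((C₀ / R₀) ^ 2 * k t)))) := by
        gcongr
      refine (mul_le_mul_of_nonneg_left (h1.trans h3) hη0).trans_eq ?_
      ring
    · rw [integral_const_mul, integral_add (hVi.const_mul _) (hj.const_mul _), integral_const_mul,
        integral_const_mul, integral_add (ig.const_mul _) (ik.const_mul _), integral_const_mul,
        integral_const_mul]
      calc K * (18 * (β * R₀ ^ 2) * (∫ t in Ioo 0 T, η t * (V t * g t))
          + 3 * (β * R₀ ^ 2)⁻¹ * (4 * (∫ t in Ioo 0 T, η t * g t)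
            + 6 * (C₀ / R₀) ^ 2 * ∫ t in Ioo 0 T, η t * k t))
          ≤ K * (18 * (β * R₀ ^ 2) * (Q * L / R₀ ^ 2)
          + 3 * (β * R₀ ^ 2)⁻¹ * (4 * (β ^ 2 * R₀ ^ 2 * L / 2)
            + 6 * (C₀ / R₀) ^ 2 * (β ^ 4 * (R₀ ^ 2 * R₀ ^ 2) * L))) := by
            have hσ4' : σ ^ 4 ≤ β ^ 4 * (R₀ ^ 2 * R₀ ^ 2) := hσ4.trans (by gcongr)
            have h1 := hkin.trans (mul_le_mul_of_nonneg_right hσ4' hL)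
            have h2 : σ ^ 2 * L / 2 ≤ β ^ 2 * R₀ ^ 2 * L / 2 := by gcongr
            have h3 := gg.trans h2
            gcongr
        _ = K * (18 * Q * β + 6 * β + 18 * C₀ ^ 2 * β ^ 3) * L := by
            field_simp
            ring
        _ ≤ K * (18 * Q * β + 6 * β + 18 * C₀ ^ 2 * β) * L := by
            gcongr
        _ = K * (18 * Q + 6 + 18 * C₀ ^ 2) * β * L := by ring
  rw [h.dissip_sub_flux hT hC₀ (by linarith) hη hψ hϱ hΦ]
  have e : K * errConst C₀ κ Q * β * L = K * (C₀ * (κ / 4 + 1)) * β * L + K * (2 * C₀) * β * L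
      + K * (C₀ * (12 * Q + 3)) * β * L + K * (18 * Q + 6 + 18 * C₀ ^ 2) * β * L := by
    rw [errConst]
    ring
  rw [e]
  rw [abs_le] at t1 t2 t3 t4 ⊢
  constructor <;> linarith [t1.1, t1.2, t2.1, t2.2, t3.1, t3.2, t4.1, t4.2]

end

/-! ### Summing the cut-offs of a cover -/

/-- Radial retraction onto the closed ball decreases the distance to the points of that ball. -/
theorem norm_retract_sub_le {R₀ : ℝ} (hR₀ : 0 < R₀) {x c : E3} (hx : R₀ ≤ ‖x‖) (hc : ‖c‖ ≤ R₀) :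
    ‖(R₀ / ‖x‖) • x - c‖ ≤ ‖x - c‖ := by
  have hx0 : 0 < ‖x‖ := hR₀.trans_le hx
  have hy : ‖(R₀ / ‖x‖) • x‖ = R₀ := by
    rw [norm_smul, Real.norm_of_nonneg (by positivity), div_mul_cancel₀ _ hx0.ne']
  set y := (R₀ / ‖x‖) • x with hy'
  have hxy : x = (‖x‖ / R₀) • y := by
    rw [hy', smul_smul, div_mul_div_cancel₀ hR₀.ne', div_self hx0.ne', one_smul]
  have h1 : x - c = (‖x‖ / R₀ - 1) • y + (y - c) := by
    rw [sub_smul, one_smul, ← hxy]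
    abel
  have h2 : 0 ≤ inner ℝ y (y - c) := by
    rw [inner_sub_right, real_inner_self_eq_norm_sq, hy]
    have := real_inner_le_norm y c
    rw [hy] at this
    nlinarith
  have h3 : 0 ≤ ‖x‖ / R₀ - 1 := by
    rw [sub_nonneg, one_le_div hR₀]
    exact hx
  refine le_of_sq_le_sq ?_ (norm_nonneg _)
  rw [h1, norm_add_sq_real, inner_smul_left]
  have : 0 ≤ (‖x‖ / R₀ - 1) * inner ℝ y (y - c) := mul_nonneg h3 h2
  simp only [conj_trivial]
  nlinarith [sq_nonneg ‖(‖x‖ / R₀ - 1) • y‖]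

theorem sum_le_of_ncard_le {n : ℕ} {f : Fin n → ℝ} {S : Set (Fin n)} {K : ℕ} {m : ℝ}
    (hS : S.ncard ≤ K) (hm : 0 ≤ m) (hf : ∀ i, f i ≤ m) (h0 : ∀ i, i ∉ S → f i ≤ 0) :
    ∑ i, f i ≤ K * m := by
  classical
  have h1 : ∑ i, f i ≤ ∑ i ∈ S.toFinset, f i := by
    rw [← Finset.sum_filter_add_sum_filter_not Finset.univ (fun i => i ∈ S)]
    have : ∑ i with i ∉ S, f i ≤ 0 := Finset.sum_nonpos fun i hi => h0 i (by simpa using hi)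
    have e : ({i | i ∈ S} : Finset (Fin n)) = S.toFinset := by ext; simp
    rw [e]
    linarith
  have h2 : ∑ i ∈ S.toFinset, f i ≤ S.toFinset.card • m :=
    Finset.sum_le_card_nsmul _ _ _ fun i _ => hf i
  rw [nsmul_eq_mul, ← Set.ncard_eq_toFinset_card'] at h2
  refine h1.trans (h2.trans ?_)
  gcongr

section

variable {C₀ ρ R₀ R : ℝ} {ψ₀ : E3 → ℝ} {K₁ K₂ n : ℕ} {c : Fin n → E3} {ψ : Fin n → E3 → ℝ}

/-- The multiplicity bound extends to the boundary of the ball. -/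
theorem IsCover.mult_closedBall (hc : IsCover K₁ K₂ R₀ R c) {y : E3}
    (hy : y ∈ closedBall (0 : E3) R₀) : {i | y ∈ ball (c i) (2 * R)}.ncard ≤ K₂ := by
  have hR₀ : 0 < R₀ := hc.pos.trans_le hc.le
  have hmem : (⋂ i ∈ {i | y ∈ ball (c i) (2 * R)}, ball (c i) (2 * R)) ∈ nhds y :=
    (Filter.biInter_mem (toFinite _)).2 fun i hi => isOpen_ball.mem_nhds hi
  rw [← closure_ball (0 : E3) hR₀.ne'] at hy
  obtain ⟨z, hz1, hz2⟩ := mem_closure_iff_nhds.1 hy _ hmem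
  refine (ncard_le_ncard (fun i hi => ?_) (toFinite _)).trans (hc.mult z hz2)
  exact mem_iInter₂.1 hz1 i hi

theorem IsCover.closedBall_subset (hc : IsCover K₁ K₂ R₀ R c) :
    closedBall (0 : E3) R₀ ⊆ ⋃ i, closedBall (c i) R := by
  rw [← closure_ball (0 : E3) (hc.pos.trans_le hc.le).ne']
  exact closure_minimal (hc.covers.trans (iUnion_mono fun i => ball_subset_closedBall))
    (isClosed_iUnion_of_finite fun i => isClosed_closedBall)

/-- At most `K₂` of the cut-offs of a cover are nonzero at a point. -/
theorem IsCover.ncard_ne_zero_le (hc : IsCover K₁ K₂ R₀ R c) (hψ : IsIntegralCutoff C₀ ρ R₀ ψ₀)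
    (hi : ∀ i, IsLocalCutoff C₀ ρ R₀ ψ₀ R (c i) (ψ i)) (x : E3) : {i | ψ i x ≠ 0}.ncard ≤ K₂ := by
  have hR₀ : 0 < R₀ := hc.pos.trans_le hc.le
  rcases lt_or_ge ‖x‖ R₀ with hx | hx
  · have hxb : x ∈ ball (0 : E3) R₀ := by simpa using hx
    refine (ncard_le_ncard (fun i hne => ?_) (toFinite _)).trans (hc.mult x hxb)
    by_cases hin : closedBall (c i) R ⊆ ball 0 R₀
    · exact (hi i).interior_supp hin hne
    · by_contra hout
      exact hne ((hi i).boundary_inner_zero hin x ⟨hxb, hout⟩)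
  · have hx0 : 0 < ‖x‖ := hR₀.trans_le hx
    have hy : (R₀ / ‖x‖) • x ∈ closedBall (0 : E3) R₀ := by
      rw [mem_closedBall_zero_iff, norm_smul, Real.norm_of_nonneg (by positivity),
        div_mul_cancel₀ _ hx0.ne']
    refine (ncard_le_ncard (fun i hne => ?_) (toFinite _)).trans (hc.mult_closedBall hy)
    have hx2 : ‖x‖ ≤ 2 * R₀ := by
      by_contra hlt
      refine hne (le_antisymm (((hi i).le_integral x).trans_eq (hψ.eq_zero fun h => hlt ?_))
        ((hi i).refined.nonneg x))
      exact (mem_ball_zero_iff.1 h).le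
    by_cases hin : closedBall (c i) R ⊆ ball 0 R₀
    · have h1 : x ∈ ball (c i) (2 * R) := (hi i).interior_supp hin hne
      have h2 : c i ∈ ball (0 : E3) R₀ := hin (mem_closedBall_self hc.pos.le)
      rw [mem_ball_zero_iff] at h2
      rw [mem_ball, dist_eq_norm] at h1
      show (R₀ / ‖x‖) • x ∈ ball (c i) (2 * R)
      rw [mem_ball, dist_eq_norm]
      exact (norm_retract_sub_le hR₀ hx h2.le).trans_lt h1
    · by_contra hout
      exact hne ((hi i).boundary_outer_zero hin x hx hx2 hout)

theorem IsCover.le_sum_cutoff (hc : IsCover K₁ K₂ R₀ R c) (hψ : IsIntegralCutoff C₀ ρ R₀ ψ₀)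
    (hi : ∀ i, IsLocalCutoff C₀ ρ R₀ ψ₀ R (c i) (ψ i)) (x : E3) : ψ₀ x ≤ ∑ i, ψ i x := by
  have hR₀ : 0 < R₀ := hc.pos.trans_le hc.le
  have single : ∀ i, ψ i x ≤ ∑ i, ψ i x := fun i =>
    Finset.single_le_sum (fun j _ => (hi j).refined.nonneg x) (Finset.mem_univ i)
  rcases lt_or_ge ‖x‖ R₀ with hx | hx
  · have hxb : x ∈ ball (0 : E3) R₀ := by simpa using hx
    obtain ⟨i, hxi⟩ := mem_iUnion.1 (hc.covers hxb)
    refine ((hψ.refined.le_one x).trans_eq ?_).trans (single i)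
    by_cases hin : closedBall (c i) R ⊆ ball 0 R₀
    · exact ((hi i).interior_one hin x hxi).symm
    · exact ((hi i).boundary_one hin x ⟨hxi, hxb⟩).symm
  · by_cases hx2 : ‖x‖ ≤ 2 * R₀
    · have hx0 : 0 < ‖x‖ := hR₀.trans_le hx
      have hy : ‖(R₀ / ‖x‖) • x‖ = R₀ := by
        rw [norm_smul, Real.norm_of_nonneg (by positivity), div_mul_cancel₀ _ hx0.ne']
      obtain ⟨i, hyi⟩ := mem_iUnion.1 (hc.closedBall_subset (mem_closedBall_zero_iff.2 hy.le))
      refine (Eq.ge ?_).trans (single i)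
      refine (hi i).boundary_cone (fun hin => ?_) x hx hx2 hyi
      have := mem_ball_zero_iff.1 (hin hyi)
      exact this.ne hy
    · rw [hψ.eq_zero fun h => hx2 (mem_ball_zero_iff.1 h).le]
      exact Finset.sum_nonneg fun j _ => (hi j).refined.nonneg x

theorem IsCover.isSumCutoff (hc : IsCover K₁ K₂ R₀ R c) (hψ : IsIntegralCutoff C₀ ρ R₀ ψ₀)
    (hC₀ : 0 < C₀) (hρ : 1 / 2 < ρ)
    (hi : ∀ i, IsLocalCutoff C₀ ρ R₀ ψ₀ R (c i) (ψ i)) :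
    IsSumCutoff C₀ ρ R K₂ ψ₀ (fun x => ∑ i, ψ i x) := by
  have hR := hc.pos
  have hcard := hc.ncard_ne_zero_le hψ hi
  have d1 : ∀ i x, DifferentiableAt ℝ (ψ i) x := fun i x =>
    (hi i).refined.smooth.differentiable (by simp) x
  have e1 : ∀ l x, pdx l (fun x => ∑ i, ψ i x) x = ∑ i, pdx l (ψ i) x := fun l x =>
    pdx_sum _ l fun i _ => d1 i x
  have e2 : ∀ l x, pdx l (pdx l (fun x => ∑ i, ψ i x)) x = ∑ i, pdx l (pdx l (ψ i)) x := by
    intro l x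
    rw [show pdx l (fun x => ∑ i, ψ i x) = fun x => ∑ i, pdx l (ψ i) x from funext (e1 l)]
    exact pdx_sum _ l fun i _ => ((hi i).refined.smooth.pdx l).differentiable (by simp) x
  have hpow : ∀ (s : ℝ) (hs : 0 < s) (i : Fin n) (x : E3), ψ i x ^ s ≤ ψ₀ x ^ s :=
    fun s hs i x => Real.rpow_le_rpow ((hi i).refined.nonneg x) ((hi i).le_integral x) hs.le
  refine ⟨ContDiff.sum fun i _ => (hi i).refined.smooth, hc.le_sum_cutoff hψ hi, fun x => ?_,
    fun l x => ?_, fun l x => ?_⟩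
  · exact sum_le_of_ncard_le (hcard x) (hψ.refined.nonneg x) (fun i => (hi i).le_integral x)
      fun i h => (not_not.1 h).le
  · rw [e1, mul_assoc]
    refine (Finset.abs_sum_le_sum_abs _ _).trans (sum_le_of_ncard_le (hcard x)
      (mul_nonneg (by positivity) (Real.rpow_nonneg (hψ.refined.nonneg x) _)) (fun i => ?_)
      fun i h => ?_)
    · exact ((hi i).refined.grad_le x l).trans
        (mul_le_mul_of_nonneg_left (hpow _ (by linarith) i x) (by positivity))
    · have := (hi i).refined.grad_le x l
      rwa [not_not.1 h, Real.zero_rpow (by linarith), mul_zero] at this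
  · rw [e2, mul_assoc]
    refine (Finset.abs_sum_le_sum_abs _ _).trans (sum_le_of_ncard_le (hcard x)
      (mul_nonneg (by positivity) (Real.rpow_nonneg (hψ.refined.nonneg x) _)) (fun i => ?_)
      fun i h => ?_)
    · exact ((hi i).refined.hess_le x l l).trans
        (mul_le_mul_of_nonneg_left (hpow _ (by linarith) i x) (by positivity))
    · have := (hi i).refined.hess_le x l l
      rwa [not_not.1 h, Real.zero_rpow (by linarith), mul_zero] at this

end

/-! ### The integral-scale quantities in components -/

section

variable {C₀ ρ δ T ϱ R₀ : ℝ} {f : ℝ → E3 → E3} {Df : ℝ → E3 → E3 →L[ℝ] E3} {t : ℝ} {x : E3}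

theorem SmoothIn.curl_apply (h : SmoothIn T ϱ f Df) (ht : t ∈ Ioc 0 T) (hx : x ∈ ball 0 ϱ)
    (i : Fin 3) : curl Df t x i = crlc (cp f) i t x := by
  fin_cases i <;> simp [curl, curlL, crl, h.apply_eq ht hx]

theorem SmoothIn.norm_curl_sq (h : SmoothIn T ϱ f Df) (ht : t ∈ Ioc 0 T) (hx : x ∈ ball 0 ϱ) :
    ‖curl Df t x‖ ^ 2 = ∑ i, crlc (cp f) i t x ^ 2 := by
  simp only [EuclideanSpace.norm_sq_eq, Real.norm_eq_abs, sq_abs, h.curl_apply ht hx]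

theorem SmoothIn.gradSq_fderiv_curl (h : SmoothIn T ϱ f Df) (ht : t ∈ Ioc 0 T)
    (hx : x ∈ ball 0 ϱ) :
    gradSq (fderiv ℝ (curl Df t) x) = ∑ i, ∑ l, pd l (crlc (cp f) i) t x ^ 2 := by
  have hsm : ContDiffOn ℝ ∞ (curl Df t) (ball 0 ϱ) := contDiffOn_euclidean.2 fun i =>
    ((Sm.crl h.sm (i + 1) (i + 2)).slice ht).congr fun y hy => h.curl_apply ht hy i
  have hd : DifferentiableAt ℝ (curl Df t) x :=
    (hsm.contDiffAt (isOpen_ball.mem_nhds hx)).differentiableAt (by simp)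
  rw [gradSq_eq_sum, Finset.sum_comm]
  refine Finset.sum_congr rfl fun i _ => Finset.sum_congr rfl fun l _ => ?_
  rw [fderiv_apply_coord hd]
  have : pdx l (fun y => curl Df t y i) x = pd l (crlc (cp f) i) t x :=
    pdx_congr l isOpen_ball (fun y hy => h.curl_apply ht hy i) hx
  rw [← this]
  rfl

theorem SmoothIn.gradSq_eq (h : SmoothIn T ϱ f Df) (ht : t ∈ Ioc 0 T) (hx : x ∈ ball 0 ϱ) :
    gradSq (Df t x) = ∑ l, ∑ k, pd l (cp f k) t x ^ 2 := by
  simp only [gradSq_eq_sum, h.apply_eq ht hx]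

theorem norm_sq_eq_sum_cp (f : ℝ → E3 → E3) (t : ℝ) (x : E3) :
    ‖f t x‖ ^ 2 = ∑ i, cp f i t x ^ 2 := by
  simp only [EuclideanSpace.norm_sq_eq, Real.norm_eq_abs, sq_abs, cp]

theorem IsTimeCutoff.integrableOn_rpow_mul {η : ℝ → ℝ} (h : IsTimeCutoff C₀ δ T η) (hT : 0 < T)
    {k : ℝ → ℝ} (hk : ContinuousOn k (Ioc 0 T)) {s : ℝ} (hs : 0 < s) :
    IntegrableOn (fun t => η t ^ s * k t) (Ioo 0 T) := by
  refine integrableOn_time_cutoff_mul (K := 1) hT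
    (h.smooth.continuousOn.rpow_const fun _ _ => Or.inr hs.le) (fun t ht => ?_) (fun t ht => ?_) hk
  · rw [abs_of_nonneg (Real.rpow_nonneg (h.nonneg t ht) _)]
    exact Real.rpow_le_one (h.nonneg t ht) (h.le_one t ht) hs.le
  · rw [h.eq_zero t ht, Real.zero_rpow hs.ne']

theorem IsTimeCutoff.setIntegral_mul_le_rpow {η : ℝ → ℝ} (h : IsTimeCutoff C₀ δ T η) (hT : 0 < T)
    {k : ℝ → ℝ} (hk : ContinuousOn k (Ioc 0 T)) (hk0 : ∀ t, 0 ≤ k t) {s : ℝ} (hs : 0 < s)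
    (hs1 : s ≤ 1) :
    ∫ t in Ioo 0 T, η t * k t ≤ ∫ t in Ioo 0 T, η t ^ s * k t := by
  refine setIntegral_mono_on (h.integrableOn_mul hT hk) (h.integrableOn_rpow_mul hT hk hs)
    measurableSet_Ioo fun t ht => mul_le_mul_of_nonneg_right ?_ (hk0 t)
  rcases (h.nonneg t ht).eq_or_lt with h0 | h0
  · rw [← h0, Real.zero_rpow hs.ne']
  · simpa using Real.rpow_le_rpow_of_exponent_ge h0 (h.le_one t ht) hs1

end

section

variable {C₀ ρ δ T ϱ R₀ : ℝ} {u b : ℝ → E3 → E3} {Du Db : ℝ → E3 → E3 →L[ℝ] E3} {η : ℝ → ℝ}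
  {ψ₀ : E3 → ℝ}

theorem palenstrophy₀_eq (hu : SmoothIn T ϱ u Du) (hb : SmoothIn T ϱ b Db) (hT : 0 < T)
    (hR₀ : 0 < R₀) (hψ : IsIntegralCutoff C₀ ρ R₀ ψ₀) (hϱ : 2 * R₀ < ϱ) :
    T * R₀ ^ 3 * palenstrophy₀ T R₀ η ψ₀ Du Db = dissip T η (cp u) (cp b) ψ₀ := by
  have hTm : T ∈ Ioc 0 T := ⟨hT, le_rfl⟩
  have h1 : ∀ t ∈ Ioo 0 T, ∫ x, (η t * ψ₀ x) *
      (gradSq (fderiv ℝ (curl Du t) x) + gradSq (fderiv ℝ (curl Db t) x))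
      = η t * ∫ x, ψ₀ x * palin (cp u) (cp b) t x := by
    intro t ht
    have ht' := Ioo_subset_Ioc_self ht
    rw [← integral_const_mul]
    congr 1 with x
    by_cases hx : x ∈ ball (0 : E3) ϱ
    · rw [hu.gradSq_fderiv_curl ht' hx, hb.gradSq_fderiv_curl ht' hx]
      simp only [palin, Finset.sum_add_distrib]
      ring
    · rw [hψ.eq_zero fun h => hx (ball_subset_ball hϱ.le h)]
      ring
  have h2 : ∫ x, 1 / 2 * (‖curl Du T x‖ ^ 2 + ‖curl Db T x‖ ^ 2) * ψ₀ x
      = ∫ x, ψ₀ x * enst (cp u) (cp b) T x := by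
    congr 1 with x
    by_cases hx : x ∈ ball (0 : E3) ϱ
    · rw [hu.norm_curl_sq hTm hx, hb.norm_curl_sq hTm hx]
      simp only [enst, ← Finset.mul_sum, Finset.sum_add_distrib]
      ring
    · rw [hψ.eq_zero fun h => hx (ball_subset_ball hϱ.le h)]
      ring
  rw [palenstrophy₀, dissip, h2, integral_const_mul, setIntegral_congr_fun measurableSet_Ioo h1]
  field_simp

theorem enstrophy₀_eq (hu : SmoothIn T ϱ u Du) (hb : SmoothIn T ϱ b Db) (hT : 0 < T)
    (hR₀ : 0 < R₀) (hψ : IsIntegralCutoff C₀ ρ R₀ ψ₀) (hϱ : 2 * R₀ < ϱ)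
    (hη : IsTimeCutoff C₀ δ T η) (hρ : 3 / 4 < ρ) :
    T * R₀ ^ 3 * enstrophy₀ ρ T R₀ η ψ₀ Du Db = 2 * ∫ t in Ioo 0 T, η t ^ (2 * ρ - 1) *
      ∫ x, ψ₀ x ^ (2 * ρ - 1) * enst (cp u) (cp b) t x := by
  have h1 : ∀ t ∈ Ioo 0 T, ∫ x, (η t * ψ₀ x) ^ (2 * ρ - 1) *
      (‖curl Du t x‖ ^ 2 + ‖curl Db t x‖ ^ 2)
      = 2 * (η t ^ (2 * ρ - 1) * ∫ x, ψ₀ x ^ (2 * ρ - 1) * enst (cp u) (cp b) t x) := by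
    intro t ht
    have ht' := Ioo_subset_Ioc_self ht
    rw [← integral_const_mul, ← integral_const_mul]
    congr 1 with x
    rw [Real.mul_rpow (hη.nonneg t ht) (hψ.refined.nonneg x)]
    by_cases hx : x ∈ ball (0 : E3) ϱ
    · rw [hu.norm_curl_sq ht' hx, hb.norm_curl_sq ht' hx]
      simp only [enst, ← Finset.mul_sum, Finset.sum_add_distrib]
      ring
    · rw [hψ.eq_zero fun h => hx (ball_subset_ball hϱ.le h), Real.zero_rpow (by linarith)]
      ring
  rw [enstrophy₀, integral_const_mul, setIntegral_congr_fun measurableSet_Ioo h1,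
    integral_const_mul]
  field_simp

theorem energy₀_eq (hT : 0 < T) (hR₀ : 0 < R₀) (hψ : IsIntegralCutoff C₀ ρ R₀ ψ₀)
    (hη : IsTimeCutoff C₀ δ T η) :
    T * R₀ ^ 3 * energy₀ ρ T R₀ η ψ₀ u b = ∫ t in Ioo 0 T, η t ^ (4 * ρ - 3) *
      ∫ x, ψ₀ x ^ (4 * ρ - 3) * kin (cp u) (cp b) t x := by
  have h1 : ∀ t ∈ Ioo 0 T, ∫ x, (η t * ψ₀ x) ^ (4 * ρ - 3) *
      (‖u t x‖ ^ 2 / 2 + ‖b t x‖ ^ 2 / 2)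
      = η t ^ (4 * ρ - 3) * ∫ x, ψ₀ x ^ (4 * ρ - 3) * kin (cp u) (cp b) t x := by
    intro t ht
    rw [← integral_const_mul]
    congr 1 with x
    rw [Real.mul_rpow (hη.nonneg t ht) (hψ.refined.nonneg x), norm_sq_eq_sum_cp,
      norm_sq_eq_sum_cp]
    simp only [kin, ← Finset.mul_sum, Finset.sum_add_distrib]
    ring
  rw [energy₀, integral_const_mul, setIntegral_congr_fun measurableSet_Ioo h1]
  field_simp

/-- The Kraichnan-type scale bounds the enstrophy and the energy by the dissipation. -/
theorem kraichnan_bounds (hu : SmoothIn T ϱ u Du) (hb : SmoothIn T ϱ b Db) (hT : 0 < T)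
    (hR₀ : 0 < R₀) (hψ : IsIntegralCutoff C₀ ρ R₀ ψ₀) (hϱ : 2 * R₀ < ϱ)
    (hη : IsTimeCutoff C₀ δ T η) (hρ : 3 / 4 < ρ) (hρ' : ρ < 1)
    (hP : 0 < palenstrophy₀ T R₀ η ψ₀ Du Db) :
    0 ≤ kraichnan ρ T R₀ η ψ₀ u b Du Db ∧
    ∫ t in Ioo 0 T, η t * ∫ x, ψ₀ x ^ (2 * ρ - 1) * enst (cp u) (cp b) t x
      ≤ kraichnan ρ T R₀ η ψ₀ u b Du Db ^ 2 * dissip T η (cp u) (cp b) ψ₀ / 2 ∧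
    ∫ t in Ioo 0 T, η t * ∫ x, ψ₀ x ^ (4 * ρ - 3) * kin (cp u) (cp b) t x
      ≤ kraichnan ρ T R₀ η ψ₀ u b Du Db ^ 4 * dissip T η (cp u) (cp b) ψ₀ := by
  set P := palenstrophy₀ T R₀ η ψ₀ Du Db with hPdef
  set E := enstrophy₀ ρ T R₀ η ψ₀ Du Db with hEdef
  set k := energy₀ ρ T R₀ η ψ₀ u b with hkdef
  set σ := kraichnan ρ T R₀ η ψ₀ u b Du Db with hσdef
  have e₁ : 0 < 2 * ρ - 1 := by linarith
  have e₂ : 0 < 4 * ρ - 3 := by linarith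
  have hA : 0 < T * R₀ ^ 3 := by positivity
  have q1 := enstrophy₀_eq hu hb hT hR₀ hψ hϱ hη hρ
  have q2 := energy₀_eq (u := u) (b := b) hT hR₀ hψ hη
  have n1 : ∀ t, 0 ≤ ∫ x, ψ₀ x ^ (2 * ρ - 1) * enst (cp u) (cp b) t x := fun t =>
    integral_nonneg fun x =>
      mul_nonneg (Real.rpow_nonneg (hψ.refined.nonneg x) _) (enst_nonneg _ _ t x)
  have n2 : ∀ t, 0 ≤ ∫ x, ψ₀ x ^ (4 * ρ - 3) * kin (cp u) (cp b) t x := fun t =>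
    integral_nonneg fun x =>
      mul_nonneg (Real.rpow_nonneg (hψ.refined.nonneg x) _) (kin_nonneg _ _ t x)
  have m1 := hη.setIntegral_mul_le_rpow hT (continuousOn_integral_cutoff (hψ.continuous_rpow e₁)
    (hψ.compact_rpow e₁) (hψ.tsupport_rpow_subset hϱ e₁) (Sm.enst hu.sm hb.sm).continuousOn) n1 e₁
    (by linarith)
  have m2 := hη.setIntegral_mul_le_rpow hT (continuousOn_integral_cutoff (hψ.continuous_rpow e₂)
    (hψ.compact_rpow e₂) (hψ.tsupport_rpow_subset hϱ e₂) (Sm.kin hu.sm hb.sm).continuousOn) n2 e₂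
    (by linarith)
  have hE0 : 0 ≤ E := by
    refine nonneg_of_mul_nonneg_right (a := T * R₀ ^ 3) ?_ hA
    rw [q1]
    exact mul_nonneg zero_le_two (setIntegral_nonneg measurableSet_Ioo fun t ht =>
      mul_nonneg (Real.rpow_nonneg (hη.nonneg t ht) _) (n1 t))
  have hk0 : 0 ≤ k := by
    refine nonneg_of_mul_nonneg_right (a := T * R₀ ^ 3) ?_ hA
    rw [q2]
    exact setIntegral_nonneg measurableSet_Ioo fun t ht =>
      mul_nonneg (Real.rpow_nonneg (hη.nonneg t ht) _) (n2 t)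
  have s1 : (E / P) ^ (1 / 2 : ℝ) ≤ σ := le_max_left _ _
  have s2 : (k / P) ^ (1 / 4 : ℝ) ≤ σ := le_max_right _ _
  have r1 : E ≤ σ ^ 2 * P := by
    rw [← div_le_iff₀ hP]
    have := pow_le_pow_left₀ (Real.rpow_nonneg (div_nonneg hE0 hP.le) _) s1 2
    rwa [← Real.rpow_natCast, ← Real.rpow_mul (div_nonneg hE0 hP.le),
      show (1 / 2 : ℝ) * (2 : ℕ) = 1 by norm_num, Real.rpow_one] at this
  have r2 : k ≤ σ ^ 4 * P := by
    rw [← div_le_iff₀ hP]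
    have := pow_le_pow_left₀ (Real.rpow_nonneg (div_nonneg hk0 hP.le) _) s2 4
    rwa [← Real.rpow_natCast, ← Real.rpow_mul (div_nonneg hk0 hP.le),
      show (1 / 4 : ℝ) * (4 : ℕ) = 1 by norm_num, Real.rpow_one] at this
  rw [← palenstrophy₀_eq hu hb hT hR₀ hψ hϱ]
  refine ⟨(Real.rpow_nonneg (div_nonneg hE0 hP.le) _).trans s1, m1.trans ?_, m2.trans ?_⟩
  · have := mul_le_mul_of_nonneg_left r1 hA.le
    rw [q1] at this
    linarith
  · have := mul_le_mul_of_nonneg_left r2 hA.le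
    rw [q2] at this
    linarith

theorem integral_enst_eq (hu : SmoothIn T ϱ u Du) (hb : SmoothIn T ϱ b Db)
    (hψ : IsIntegralCutoff C₀ ρ R₀ ψ₀) (hϱ : 2 * R₀ < ϱ) {t : ℝ} (ht : t ∈ Ioc 0 T) :
    ∫ x, ψ₀ x * enst (cp u) (cp b) t x
      = 1 / 2 * ((∫ x, ‖curl Du t x‖ ^ 2 * ψ₀ x) + ∫ x, ‖curl Db t x‖ ^ 2 * ψ₀ x) := by
  have key : ∀ {f : ℝ → E3 → E3} {Df : ℝ → E3 → E3 →L[ℝ] E3}, SmoothIn T ϱ f Df →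
      (fun x => ‖curl Df t x‖ ^ 2 * ψ₀ x) = fun x => ψ₀ x * ∑ i, crlc (cp f) i t x ^ 2 := by
    intro f Df hf
    ext x
    by_cases hx : x ∈ ball (0 : E3) ϱ
    · rw [hf.norm_curl_sq ht hx, mul_comm]
    · rw [hψ.eq_zero fun h => hx (ball_subset_ball hϱ.le h)]
      ring
  have ii : ∀ {F : Fin 3 → ℝ → E3 → ℝ}, (∀ k, Sm T ϱ (F k)) →
      Integrable fun x => ψ₀ x * ∑ i, crlc F i t x ^ 2 := fun hF =>
    hψ.integrable_mul hϱ ((Sm.sum (s := Finset.univ) fun i _ =>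
      (Sm.crl hF (i + 1) (i + 2)).pow 2).slice ht).continuousOn
  rw [key hu, key hb, ← integral_add (ii hu.sm) (ii hb.sm), ← integral_const_mul]
  congr 1 with x
  simp only [enst, ← Finset.mul_sum, Finset.sum_add_distrib]
  ring

/-- The modulation assumption bounds the localized enstrophy at all times by its final value, hence
by the total dissipation. -/
theorem integral_enst_le_dissip (hu : SmoothIn T ϱ u Du) (hb : SmoothIn T ϱ b Db) (hT : 0 < T)
    (hψ : IsIntegralCutoff C₀ ρ R₀ ψ₀) (hϱ : 2 * R₀ < ϱ) (hη : IsTimeCutoff C₀ δ T η)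
    (hmu : ModulationAssumption T ψ₀ Du) (hmb : ModulationAssumption T ψ₀ Db) :
    ∀ t ∈ Ioo 0 T, ∫ x, ψ₀ x * enst (cp u) (cp b) t x ≤ 2 * dissip T η (cp u) (cp b) ψ₀ := by
  intro t ht
  have h1 := hmu t ht
  have h2 := hmb t ht
  have h3 : 0 ≤ ∫ t in Ioo 0 T, η t * ∫ x, ψ₀ x * palin (cp u) (cp b) t x :=
    setIntegral_nonneg measurableSet_Ioo fun t ht => mul_nonneg (hη.nonneg t ht)
      (integral_nonneg fun x => mul_nonneg (hψ.refined.nonneg x) (palin_nonneg _ _ t x))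
  rw [integral_enst_eq hu hb hψ hϱ (Ioo_subset_Ioc_self ht), dissip,
    integral_enst_eq hu hb hψ hϱ ⟨hT, le_rfl⟩]
  linarith

/-! ### The flux in components -/

/-- The flux through one cut-off of the curl of a single field. -/
theorem localFlux_eq {f : ℝ → E3 → E3} {Df : ℝ → E3 → E3 →L[ℝ] E3} (hu : SmoothIn T ϱ u Du)
    (hf : SmoothIn T ϱ f Df) {ψ : E3 → ℝ} (hψ : ContDiff ℝ ∞ ψ) (hc : HasCompactSupport ψ)
    (hs : tsupport ψ ⊆ ball 0 ϱ) :
    localFlux T η ψ u Df = 1 / T * ∫ t in Ioo 0 T, η t * ∑ l, ∫ x, pdx l ψ x *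
      (cp u l t x * ∑ i, 1 / 2 * crlc (cp f) i t x ^ 2) := by
  rw [localFlux]
  congr 1
  refine setIntegral_congr_fun measurableSet_Ioo fun t ht => ?_
  have ht' := Ioo_subset_Ioc_self ht
  have hi : ∀ l, Integrable fun x => pdx l ψ x *
      (cp u l t x * ∑ i, 1 / 2 * crlc (cp f) i t x ^ 2) := fun l =>
    integrable_cutoff_mul isOpen_ball (hψ.pdx l).continuous (hc.fderiv_apply ℝ (e l))
      ((tsupport_pdx_subset l).trans hs) (((hu.sm l).mul (Sm.sum (s := Finset.univ) fun i _ =>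
        (Sm.const (1 / 2)).mul ((Sm.crl hf.sm (i + 1) (i + 2)).pow 2))).slice ht').continuousOn
  rw [← integral_finsetSum _ fun l _ => hi l, ← integral_const_mul]
  congr 1 with x
  have hd : fderiv ℝ (fun y => η t * ψ y) x (u t x) = η t * ∑ l, cp u l t x * pdx l ψ x := by
    rw [fderiv_const_mul (hψ.differentiable (by simp) x)]
    exact congrArg (η t * ·) (fderiv_eq_sum_pdx ψ x (u t x))
  rw [hd]
  by_cases hx : x ∈ ball (0 : E3) ϱ
  · have hS : ∀ S : ℝ, ∑ l, pdx l ψ x * (cp u l t x * S) = S * ∑ l, cp u l t x * pdx l ψ x := by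
      intro S
      rw [Finset.mul_sum]
      exact Finset.sum_congr rfl fun l _ => by ring
    rw [hf.norm_curl_sq ht' hx, hS, ← Finset.mul_sum]
    ring
  · simp [pdx_eq_zero_of_notMem_tsupport _ fun h => hx (hs h)]

theorem combinedFlux_eq (hu : SmoothIn T ϱ u Du) (hb : SmoothIn T ϱ b Db) (hT : 0 < T)
    (hη : IsTimeCutoff C₀ δ T η) {ψ : E3 → ℝ} (hψ : ContDiff ℝ ∞ ψ) (hc : HasCompactSupport ψ)
    (hs : tsupport ψ ⊆ ball 0 ϱ) :
    combinedFlux T η ψ u Du Db = 1 / T * flux T η (cp u) (cp b) ψ := by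
  have hsm : ∀ {f : ℝ → E3 → E3} {Df : ℝ → E3 → E3 →L[ℝ] E3}, SmoothIn T ϱ f Df → ∀ l,
      Sm T ϱ fun t x => cp u l t x * ∑ i, 1 / 2 * crlc (cp f) i t x ^ 2 := fun hf l =>
    (hu.sm l).mul (Sm.sum (s := Finset.univ) fun i _ =>
      (Sm.const (1 / 2)).mul ((Sm.crl hf.sm (i + 1) (i + 2)).pow 2))
  have hi : ∀ {f : ℝ → E3 → E3} {Df : ℝ → E3 → E3 →L[ℝ] E3}, SmoothIn T ϱ f Df → ∀ l, ∀ t ∈ Ioc 0 T,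
      Integrable fun x => pdx l ψ x * (cp u l t x * ∑ i, 1 / 2 * crlc (cp f) i t x ^ 2) :=
    fun hf l t ht => integrable_cutoff_mul isOpen_ball (hψ.pdx l).continuous
      (hc.fderiv_apply ℝ (e l)) ((tsupport_pdx_subset l).trans hs)
      ((hsm hf l).slice ht).continuousOn
  have hit : ∀ {f : ℝ → E3 → E3} {Df : ℝ → E3 → E3 →L[ℝ] E3}, SmoothIn T ϱ f Df →
      IntegrableOn (fun t => η t * ∑ l, ∫ x, pdx l ψ x *
        (cp u l t x * ∑ i, 1 / 2 * crlc (cp f) i t x ^ 2)) (Ioo 0 T) := fun hf =>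
    hη.integrableOn_mul hT (continuousOn_finsetSum _ fun l _ => continuousOn_integral_cutoff
      (hψ.pdx l).continuous (hc.fderiv_apply ℝ (e l)) ((tsupport_pdx_subset l).trans hs)
      (hsm hf l).continuousOn)
  rw [combinedFlux, localFlux_eq hu hu hψ hc hs, localFlux_eq hu hb hψ hc hs, ← mul_add,
    ← integral_add (hit hu) (hit hb), flux]
  congr 1
  refine setIntegral_congr_fun measurableSet_Ioo fun t ht => ?_
  have ht' := Ioo_subset_Ioc_self ht
  rw [← mul_add, ← Finset.sum_add_distrib]
  congr 1
  refine Finset.sum_congr rfl fun l _ => ?_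
  rw [← integral_add (hi hu l t ht') (hi hb l t ht')]
  congr 1 with x
  simp only [enst, mul_add, Finset.sum_add_distrib]

theorem SmoothMHD.flux_sum {U B : Fin 3 → ℝ → E3 → ℝ} (h : SmoothMHD T ϱ U B) (hT : 0 < T)
    (hη : IsTimeCutoff C₀ δ T η) {n : ℕ} {ψ : Fin n → E3 → ℝ} (hψ : ∀ i, ContDiff ℝ ∞ (ψ i))
    (hc : ∀ i, HasCompactSupport (ψ i)) (hs : ∀ i, tsupport (ψ i) ⊆ ball 0 ϱ) :
    flux T η U B (fun x => ∑ i, ψ i x) = ∑ i, flux T η U B (ψ i) := by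
  have hsm : ∀ l, Sm T ϱ fun t x => U l t x * enst U B t x := fun l =>
    (h.smU l).mul (Sm.enst h.smU h.smB)
  have hi : ∀ i l, ∀ t ∈ Ioc 0 T,
      Integrable fun x => pdx l (ψ i) x * (U l t x * enst U B t x) :=
    fun i l t ht => integrable_cutoff_mul isOpen_ball ((hψ i).pdx l).continuous
      ((hc i).fderiv_apply ℝ (e l)) ((tsupport_pdx_subset l).trans (hs i))
      ((hsm l).slice ht).continuousOn
  have hit : ∀ i, IntegrableOn (fun t => η t * ∑ l, ∫ x, pdx l (ψ i) x *
        (U l t x * enst U B t x)) (Ioo 0 T) := fun i =>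
    hη.integrableOn_mul hT (continuousOn_finsetSum _ fun l _ => continuousOn_integral_cutoff
      ((hψ i).pdx l).continuous ((hc i).fderiv_apply ℝ (e l))
      ((tsupport_pdx_subset l).trans (hs i)) (hsm l).continuousOn)
  simp only [flux]
  rw [← integral_finsetSum _ fun i _ => hit i]
  refine setIntegral_congr_fun measurableSet_Ioo fun t ht => ?_
  have ht' := Ioo_subset_Ioc_self ht
  rw [← Finset.mul_sum, Finset.sum_comm]
  congr 1
  refine Finset.sum_congr rfl fun l _ => ?_
  rw [← integral_finsetSum _ fun i _ => hi i l t ht']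
  congr 1 with x
  rw [pdx_sum _ l fun i _ => (hψ i).differentiable (by simp) x, Finset.sum_mul]

end

/-! ### The locality of the flux -/

section

variable {C₀ ρ δ T ϱ R₀ : ℝ} {u b : ℝ → E3 → E3} {Du Db : ℝ → E3 → E3 →L[ℝ] E3} {η : ℝ → ℝ}
  {ψ₀ : E3 → ℝ}

/-- The weight `V` in front of the localized enstrophy is integrable in time, so that this enstrophy
enters through its supremum; the constant part of `V` is absorbed by the smallness of the scale. -/
theorem weighted_enstrophy_bound {M G κ Ω σ L : ℝ} {g W : ℝ → ℝ} (hT : 0 < T)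
    (hη : IsTimeCutoff C₀ δ T η) (hg : ContinuousOn g (Ioc 0 T)) (hg0 : ∀ t, 0 ≤ g t)
    (hmod : ∀ t ∈ Ioo 0 T, g t ≤ 2 * L) (hL : 0 ≤ L) (hgσ : ∫ t in Ioo 0 T, η t * g t ≤ σ ^ 2 * L / 2)
    (hW : IntegrableOn W (Ioo 0 T)) (hW0 : ∀ t, 0 ≤ W t) (hWΩ : ∫ t in Ioo 0 T, W t ≤ Ω)
    (hR₀ : 0 < R₀) (hσ0 : 0 ≤ σ) (hσ : σ ≤ R₀) (hκ : R₀ ≤ κ) :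
    IntegrableOn (fun t => η t * ((2 * M ^ 2 + 2 * (G / R₀) ^ 2 * W t) * g t)) (Ioo 0 T) ∧
    ∫ t in Ioo 0 T, η t * ((2 * M ^ 2 + 2 * (G / R₀) ^ 2 * W t) * g t)
      ≤ (M ^ 2 * κ ^ 4 + 4 * G ^ 2 * Ω) * L / R₀ ^ 2 := by
  have ig := hη.integrableOn_mul hT hg
  have hηg : ∀ t ∈ Ioo 0 T, 0 ≤ η t * g t ∧ η t * g t ≤ 2 * L := fun t ht =>
    ⟨mul_nonneg (hη.nonneg t ht) (hg0 t),
      (mul_le_of_le_one_left (hg0 t) (hη.le_one t ht)).trans (hmod t ht)⟩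
  have iW : IntegrableOn (fun t => η t * g t * W t) (Ioo 0 T) := by
    refine Integrable.bdd_mul (c := 2 * L) hW ig.aestronglyMeasurable ?_
    filter_upwards [ae_restrict_mem measurableSet_Ioo] with t ht
    rw [Real.norm_of_nonneg (hηg t ht).1]
    exact (hηg t ht).2
  have e : (fun t => η t * ((2 * M ^ 2 + 2 * (G / R₀) ^ 2 * W t) * g t))
      = fun t => 2 * M ^ 2 * (η t * g t) + 2 * (G / R₀) ^ 2 * (η t * g t * W t) := by
    ext t
    ring
  rw [e]
  refine ⟨(ig.const_mul _).add (iW.const_mul _), ?_⟩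
  rw [integral_add (ig.const_mul _) (iW.const_mul _), integral_const_mul, integral_const_mul]
  have h1 : ∫ t in Ioo 0 T, η t * g t * W t ≤ 2 * L * Ω := by
    have : ∫ t in Ioo 0 T, η t * g t * W t ≤ ∫ t in Ioo 0 T, 2 * L * W t :=
      setIntegral_mono_on iW (hW.const_mul _) measurableSet_Ioo fun t ht =>
        mul_le_mul_of_nonneg_right (hηg t ht).2 (hW0 t)
    rw [integral_const_mul] at this
    exact this.trans (by gcongr)
  have h2 : σ ^ 2 ≤ κ ^ 4 / R₀ ^ 2 := by
    rw [le_div_iff₀ (by positivity)]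
    calc σ ^ 2 * R₀ ^ 2 ≤ R₀ ^ 2 * R₀ ^ 2 := by gcongr
      _ = R₀ ^ 4 := by ring
      _ ≤ κ ^ 4 := by gcongr
  calc 2 * M ^ 2 * (∫ t in Ioo 0 T, η t * g t)
        + 2 * (G / R₀) ^ 2 * ∫ t in Ioo 0 T, η t * g t * W t
      ≤ 2 * M ^ 2 * (κ ^ 4 / R₀ ^ 2 * L / 2) + 2 * (G / R₀) ^ 2 * (2 * L * Ω) := by
        have h3 : σ ^ 2 * L / 2 ≤ κ ^ 4 / R₀ ^ 2 * L / 2 := by gcongr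
        have h4 := hgσ.trans h3
        gcongr
    _ = (M ^ 2 * κ ^ 4 + 4 * G ^ 2 * Ω) * L / R₀ ^ 2 := by
        field_simp
        ring

/-- The summed flux of a cover at any scale of the inertial range is comparable to the total
dissipation, with constants that do not depend on the scale. -/
theorem summed_flux_bounds {G M κ Ω β R : ℝ} {u₀ b₀ : E3 → E3} {K₁ K₂ n : ℕ} {c : Fin n → E3}
    {ψ : Fin n → E3 → ℝ} (hT : 0 < T) (hR₀ : 0 < R₀) (hC₀ : 0 < C₀) (hρ : 3 / 4 < ρ)
    (hρ' : ρ < 1) (hδ : 1 / 2 ≤ δ) (hRκ : R₀ ≤ κ) (hκ : R₀ ^ 2 ≤ κ * T)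
    (hsol : IsWeakSolution T u b u₀ b₀ Du Db)
    (hu : SmoothIn T ϱ u Du) (hb : SmoothIn T ϱ b Db) (hϱ : 2 * R₀ < ϱ)
    (hΩ : curlSq T univ Du ≤ Ω)
    (hη : IsTimeCutoff C₀ δ T η) (hψ₀ : IsIntegralCutoff C₀ ρ R₀ ψ₀)
    (hP : 0 < palenstrophy₀ T R₀ η ψ₀ Du Db)
    (hgrad : ∀ᵐ t ∂(volume.restrict (Ioo 0 T)), ∀ x ∈ ball (0 : E3) (2 * R₀),
      √(gradSq (Du t x)) ≤ M + G / R₀ * √(∫ y, ‖curl Du t y‖ ^ 2))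
    (hmu : ModulationAssumption T ψ₀ Du) (hmb : ModulationAssumption T ψ₀ Db)
    (hβ : 0 < β) (hβ1 : β ≤ 1)
    (hβc : K₂ * errConst C₀ κ (M ^ 2 * κ ^ 4 + 4 * G ^ 2 * Ω) * β ≤ 1 / 2)
    (hσ : kraichnan ρ T R₀ η ψ₀ u b Du Db ≤ β * R)
    (hc : IsCover K₁ K₂ R₀ R c) (hi : ∀ i, IsLocalCutoff C₀ ρ R₀ ψ₀ R (c i) (ψ i)) :
    0 < dissip T η (cp u) (cp b) ψ₀ ∧
    dissip T η (cp u) (cp b) ψ₀ / 2 ≤ T * ∑ i, combinedFlux T η (ψ i) u Du Db ∧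
    T * ∑ i, combinedFlux T η (ψ i) u Du Db
      ≤ (K₂ + 1 / 2) * dissip T η (cp u) (cp b) ψ₀ := by
  set σ := kraichnan ρ T R₀ η ψ₀ u b Du Db with hσdef
  set L := dissip T η (cp u) (cp b) ψ₀ with hLdef
  have hR := hc.pos
  have hL : 0 < L := by
    rw [hLdef, ← palenstrophy₀_eq hu hb hT hR₀ hψ₀ hϱ]
    positivity
  have h := hsol.smoothMHD hu hb
  have hΦ := hc.isSumCutoff hψ₀ hC₀ (by linarith) hi
  obtain ⟨hσ0, hE, hkin⟩ := kraichnan_bounds hu hb hT hR₀ hψ₀ hϱ hη hρ hρ' hP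
  have hmod := integral_enst_le_dissip hu hb hT hψ₀ hϱ hη hmu hmb
  have hσR₀ : σ ≤ R₀ := hσ.trans ((mul_le_of_le_one_left hR.le hβ1).trans hc.le)
  set W : ℝ → ℝ := fun t => ∫ y, ‖curl Du t y‖ ^ 2 with hWdef
  have hW0 : ∀ t, 0 ≤ W t := fun t => integral_nonneg fun y => by positivity
  have hWΩ : ∫ t in Ioo 0 T, W t ≤ Ω := by
    simpa only [curlSq, Measure.restrict_univ] using hΩ
  have cg := continuousOn_integral_cutoff hψ₀.refined.smooth.continuous hψ₀.refined.compact
    (hψ₀.tsupport_subset hϱ) (Sm.enst h.smU h.smB).continuousOn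
  have g0 : ∀ t, 0 ≤ ∫ x, ψ₀ x * enst (cp u) (cp b) t x := fun t =>
    integral_nonneg fun x => mul_nonneg (hψ₀.refined.nonneg x) (enst_nonneg _ _ t x)
  have e₁ : 0 < 2 * ρ - 1 := by linarith
  have hgσ : ∫ t in Ioo 0 T, η t * ∫ x, ψ₀ x * enst (cp u) (cp b) t x ≤ σ ^ 2 * L / 2 := by
    refine (hη.setIntegral_mono hT cg (continuousOn_integral_cutoff (hψ₀.continuous_rpow e₁)
      (hψ₀.compact_rpow e₁) (hψ₀.tsupport_rpow_subset hϱ e₁)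
      (Sm.enst h.smU h.smB).continuousOn) fun t ht => ?_).trans hE
    have hct := ((Sm.enst h.smU h.smB).slice (Ioo_subset_Ioc_self ht)).continuousOn
    exact integral_mono (hψ₀.integrable_mul hϱ hct) (hψ₀.integrable_rpow_mul hϱ hct e₁) fun x =>
      mul_le_mul_of_nonneg_right (hψ₀.le_rpow e₁ (by linarith) x) (enst_nonneg _ _ t x)
  obtain ⟨hVi, hVQ⟩ := weighted_enstrophy_bound (M := M) (G := G) hT hη cg g0 hmod hL.le hgσ
    hsol.u_class.integrable_curlSq hW0 hWΩ hR₀ hσ0 hσR₀ hRκ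
  have hV : ∀ᵐ t ∂(volume.restrict (Ioo 0 T)), ∀ x ∈ ball (0 : E3) (2 * R₀), ∀ l k,
      pd l (cp u k) t x ^ 2 ≤ 2 * M ^ 2 + 2 * (G / R₀) ^ 2 * W t := by
    filter_upwards [hgrad, ae_restrict_mem measurableSet_Ioo] with t ht htm x hx l k
    have h1 := ht x hx
    have hsq : pd l (cp u k) t x ^ 2 ≤ gradSq (Du t x) := by
      rw [hu.gradSq_eq (Ioo_subset_Ioc_self htm) (ball_subset_ball hϱ.le hx)]
      exact (Finset.single_le_sum (f := fun k => pd l (cp u k) t x ^ 2)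
        (fun _ _ => sq_nonneg _) (Finset.mem_univ k)).trans
        (Finset.single_le_sum (f := fun l => ∑ k, pd l (cp u k) t x ^ 2)
          (fun _ _ => Finset.sum_nonneg fun _ _ => sq_nonneg _) (Finset.mem_univ l))
    have h2 := pow_le_pow_left₀ (Real.sqrt_nonneg _) h1 2
    rw [Real.sq_sqrt (gradSq_nonneg _)] at h2
    have h3 : (G / R₀ * √(W t)) ^ 2 = (G / R₀) ^ 2 * W t := by
      rw [mul_pow, Real.sq_sqrt (hW0 t)]
    refine hsq.trans (h2.trans ?_)
    change (M + G / R₀ * √(W t)) ^ 2 ≤ _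
    nlinarith [sq_nonneg (M - G / R₀ * √(W t))]
  have herr := h.abs_dissip_sub_flux_le hT hC₀ hδ hη hψ₀ hϱ hρ hρ' hR hc.le
    (Nat.cast_nonneg K₂) hΦ hV hσ0 hβ hβ1 hσ hL.le hκ hmod hE hkin hVi hVQ
  have hD := h.dissip_bounds hT hη hψ₀ hϱ hΦ
  have hflux : T * ∑ i, combinedFlux T η (ψ i) u Du Db
      = flux T η (cp u) (cp b) fun x => ∑ i, ψ i x := by
    have hs : ∀ i, tsupport (ψ i) ⊆ ball 0 ϱ := fun i => by
      have hsup : Function.support (ψ i) ⊆ Function.support ψ₀ := by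
        intro x hx h0
        exact hx (le_antisymm (((hi i).le_integral x).trans_eq h0) ((hi i).refined.nonneg x))
      exact (closure_mono hsup).trans (hψ₀.tsupport_subset hϱ)
    rw [h.flux_sum hT hη (fun i => (hi i).refined.smooth) (fun i => (hi i).refined.compact) hs,
      Finset.mul_sum]
    refine Finset.sum_congr rfl fun i _ => ?_
    rw [combinedFlux_eq hu hb hT hη (hi i).refined.smooth (hi i).refined.compact (hs i)]
    field_simp
  rw [hflux]
  have hsmall := mul_le_mul_of_nonneg_right hβc hL.le
  have h1 := (abs_le.1 herr).1
  have h2 := (abs_le.1 herr).2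
  refine ⟨hL, ?_, ?_⟩
  · linarith [hD.1]
  · linarith [hD.2]

end

/-- Two quantities comparable to the same number, divided by the cardinalities of two covers. -/
theorem ratio_bounds {L T r R R₀ F₁ F₂ K : ℝ} {K₁ K₂ m n : ℕ} (hL : 0 < L) (hT : 0 < T)
    (hr : 0 < r) (hR : 0 < R) (hR₀ : 0 < R₀) (hK₁ : 0 < K₁) (hK₂ : 0 < K₂)
    (hK : √((K₁ : ℝ) * K₂) ≤ K)
    (h₁ : L / 2 ≤ T * F₁) (h₁' : T * F₁ ≤ (K₂ + 1 / 2) * L)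
    (h₂ : L / 2 ≤ T * F₂) (h₂' : T * F₂ ≤ (K₂ + 1 / 2) * L)
    (hm : (R₀ / r) ^ 3 ≤ m) (hm' : (m : ℝ) ≤ K₁ * (R₀ / r) ^ 3)
    (hn : (R₀ / R) ^ 3 ≤ n) (hn' : (n : ℝ) ≤ K₁ * (R₀ / R) ^ 3) :
    1 / (16 * K ^ 2) * (r / R) ^ 3 ≤ (1 / (m : ℝ) * F₁) / (1 / (n : ℝ) * F₂) ∧
      (1 / (m : ℝ) * F₁) / (1 / (n : ℝ) * F₂) ≤ 16 * K ^ 2 * (r / R) ^ 3 := by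
  have k1 : (0 : ℝ) < K₁ := by exact_mod_cast hK₁
  have k2 : (1 : ℝ) ≤ K₂ := by exact_mod_cast hK₂
  have hK2 : (K₁ : ℝ) * K₂ ≤ K ^ 2 := by
    have := pow_le_pow_left₀ (Real.sqrt_nonneg _) hK 2
    rwa [Real.sq_sqrt (by positivity)] at this
  have pm : (0 : ℝ) < m := lt_of_lt_of_le (by positivity) hm
  have pn : (0 : ℝ) < n := lt_of_lt_of_le (by positivity) hn
  have p1 : 0 < F₁ := pos_of_mul_pos_right (lt_of_lt_of_le (by linarith) h₁) hT.le
  have p2 : 0 < F₂ := pos_of_mul_pos_right (lt_of_lt_of_le (by linarith) h₂) hT.le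
  have b1 : F₁ ≤ 3 * K₂ * F₂ := by
    refine le_of_mul_le_mul_left ?_ hT
    nlinarith
  have b2 : F₂ ≤ 3 * K₂ * F₁ := by
    refine le_of_mul_le_mul_left ?_ hT
    nlinarith
  have e1 : (R₀ / R) ^ 3 = (R₀ / r) ^ 3 * (r / R) ^ 3 := by
    rw [← mul_pow, div_mul_div_cancel₀ hr.ne']
  have c1 : (n : ℝ) ≤ K₁ * (r / R) ^ 3 * m := by
    calc (n : ℝ) ≤ K₁ * (r / R) ^ 3 * (R₀ / r) ^ 3 := by rw [e1] at hn'; linarith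
      _ ≤ K₁ * (r / R) ^ 3 * m := by gcongr
  have c2 : (r / R) ^ 3 * m ≤ K₁ * n := by
    calc (r / R) ^ 3 * m ≤ (r / R) ^ 3 * (K₁ * (R₀ / r) ^ 3) := by gcongr
      _ = K₁ * (R₀ / R) ^ 3 := by rw [e1]; ring
      _ ≤ K₁ * n := by gcongr
  have e2 : (1 / (m : ℝ) * F₁) / (1 / (n : ℝ) * F₂) = (n * F₁) / (m * F₂) := by
    field_simp
  have pq : 0 < (r / R) ^ 3 := by positivity
  have hKpos : 0 < K ^ 2 := lt_of_lt_of_le (by positivity) hK2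
  rw [e2]
  constructor
  · rw [le_div_iff₀ (by positivity), div_mul_eq_mul_div, one_mul, div_mul_eq_mul_div,
      div_le_iff₀ (by positivity)]
    calc (r / R) ^ 3 * (m * F₂) = (r / R) ^ 3 * m * F₂ := by ring
      _ ≤ K₁ * n * (3 * K₂ * F₁) := by gcongr
      _ = n * F₁ * (3 * (K₁ * K₂)) := by ring
      _ ≤ n * F₁ * (16 * K ^ 2) := by
        gcongr
        norm_num
  · rw [div_le_iff₀ (by positivity)]
    calc n * F₁ ≤ K₁ * (r / R) ^ 3 * m * (3 * K₂ * F₂) := by gcongr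
      _ = 3 * (K₁ * K₂) * (r / R) ^ 3 * (m * F₂) := by ring
      _ ≤ 16 * K ^ 2 * (r / R) ^ 3 * (m * F₂) := by
        gcongr
        norm_num

end MHD

end

theorem theorem2 (C₀ ρ δ : ℝ) (hC₀ : 0 < C₀) (hρ : 3 / 4 < ρ) (hρ' : ρ < 1)
    (hδ : 3 / 4 < δ) (hδ' : δ < 1) (K₁ K₂ : ℕ) (hK₁ : 0 < K₁) (hK₂ : 0 < K₂) :
    -- the constant in `α = 4 K_P K_*²`
    ∃ K_P : ℝ, 0 < K_P ∧ ∀ K_star : ℝ, √((K₁ : ℝ) * K₂) ≤ K_star → 3 * (K₂ : ℝ) / 4 ≤ K_star →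
      (K₁ : ℝ) ≤ K_star →
    ∀ M Ω κ : ℝ, 0 < M → 0 < κ → ∃ β : ℝ, 0 < β ∧ β < 1 ∧
    ∀ (T R₀ : ℝ), 0 < T → 0 < R₀ → R₀ ≤ κ → R₀ ^ 2 ≤ κ * T →
    ∀ (u b : ℝ → MHD.E3 → MHD.E3) (u₀ b₀ : MHD.E3 → MHD.E3)
      (Du Db : ℝ → MHD.E3 → MHD.E3 →L[ℝ] MHD.E3),
      MHD.IsWeakSolution T u b u₀ b₀ Du Db →
      MHD.SmoothIn T (2 * R₀ + R₀ ^ (2 / 3 : ℝ)) u Du →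
      MHD.SmoothIn T (2 * R₀ + R₀ ^ (2 / 3 : ℝ)) b Db →
      MHD.curlSq T Set.univ Du ≤ Ω →
    ∀ (η : ℝ → ℝ) (ψ₀ : MHD.E3 → ℝ),
      MHD.IsTimeCutoff C₀ δ T η → MHD.IsIntegralCutoff C₀ ρ R₀ ψ₀ →
      0 < MHD.palenstrophy₀ T R₀ η ψ₀ Du Db →
      -- (A1)
      MHD.HybridAssumption T R₀ M Du →
      -- (A2)
      MHD.kraichnan ρ T R₀ η ψ₀ u b Du Db < β * R₀ →
      -- (A3)
      MHD.LocalizationAssumption T R₀ (4 * K_P * K_star ^ 2) Du →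
      MHD.ModulationAssumption T ψ₀ Du → MHD.ModulationAssumption T ψ₀ Db →
    ∀ r R : ℝ,
      MHD.kraichnan ρ T R₀ η ψ₀ u b Du Db / β ≤ r → r ≤ R₀ →
      MHD.kraichnan ρ T R₀ η ψ₀ u b Du Db / β ≤ R → R ≤ R₀ →
    ∀ (m n : ℕ) (c : Fin m → MHD.E3) (d : Fin n → MHD.E3)
      (χ : Fin m → MHD.E3 → ℝ) (ψ : Fin n → MHD.E3 → ℝ),
      MHD.IsCover K₁ K₂ R₀ r c → (∀ i, MHD.IsLocalCutoff C₀ ρ R₀ ψ₀ r (c i) (χ i)) →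
      MHD.IsCover K₁ K₂ R₀ R d → (∀ i, MHD.IsLocalCutoff C₀ ρ R₀ ψ₀ R (d i) (ψ i)) →
      1 / (16 * K_star ^ 2) * (r / R) ^ 3
          ≤ MHD.ensembleFlux T η χ u Du Db / MHD.ensembleFlux T η ψ u Du Db ∧
        MHD.ensembleFlux T η χ u Du Db / MHD.ensembleFlux T η ψ u Du Db
          ≤ 16 * K_star ^ 2 * (r / R) ^ 3 := by
  obtain ⟨C, hC, hgrad⟩ := MHD.exists_velocity_gradient_bound
  -- the estimates are uniform in `K_P`, so that any positive value serves
  refine ⟨1, one_pos, fun K_star hK _ _ M Ω κ hM hκ => ?_⟩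
  set G := C * (1 + 8 * κ) with hG
  have hG0 : 0 < G := by positivity
  set A := (K₂ : ℝ) * MHD.errConst C₀ κ (M ^ 2 * κ ^ 4 + 4 * G ^ 2 * |Ω|) with hA
  have hA0 : 0 < A := by
    have : (0 : ℝ) < K₂ := by exact_mod_cast hK₂
    rw [hA, MHD.errConst]
    positivity
  -- `A β L` bounds the difference of flux and dissipation; this `β` makes it at most `L / 2`
  have hmin : 0 < min (1 / 2) (1 / (2 * A)) := lt_min (by norm_num) (by positivity)
  refine ⟨min (1 / 2) (1 / (2 * A)), hmin, (min_le_left _ _).trans_lt (by norm_num), ?_⟩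
  set β := min (1 / 2) (1 / (2 * A)) with hβ
  have hβA : A * β ≤ 1 / 2 := by
    calc A * β ≤ A * (1 / (2 * A)) := by
          gcongr
          exact min_le_right _ _
      _ = 1 / 2 := by field_simp
  intro T R₀ hT hR₀ hRκ hκT u b u₀ b₀ Du Db hsol hu hb hΩ η ψ₀ hη hψ₀ hP hA1 _ _ hmu hmb r R hr _
    hR _ m n c d χ ψ hc hχ hd hψ
  have hϱ : 2 * R₀ < 2 * R₀ + R₀ ^ (2 / 3 : ℝ) := by
    have := Real.rpow_pos_of_pos hR₀ (2 / 3)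
    linarith
  have hg := hgrad T R₀ M κ hR₀ hRκ hM u Du hsol.u_class hu hA1
  have hβ1 : β ≤ 1 := (min_le_left _ _).trans (by norm_num)
  rw [div_le_iff₀' hmin] at hr hR
  obtain ⟨hL, h₁, h₁'⟩ := MHD.summed_flux_bounds hT hR₀ hC₀ hρ hρ' (by linarith) hRκ hκT hsol
    hu hb hϱ (hΩ.trans (le_abs_self Ω)) hη hψ₀ hP hg hmu hmb hmin hβ1 hβA hr hc hχ
  obtain ⟨-, h₂, h₂'⟩ := MHD.summed_flux_bounds hT hR₀ hC₀ hρ hρ' (by linarith) hRκ hκT hsol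
    hu hb hϱ (hΩ.trans (le_abs_self Ω)) hη hψ₀ hP hg hmu hmb hmin hβ1 hβA hR hd hψ
  exact MHD.ratio_bounds hL hT hc.pos hd.pos hR₀ hK₁ hK₂ hK h₁ h₁' h₂ h₂' hc.card_ge hc.card_le
    hd.card_ge hd.card_le
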